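/- Let $\mathbb{N}=\{0,1,2,\dots\}$. A sequence $f\in\mathbb{R}^{\mathbb{N}}$ has the ultimate sign $(s_0,\dots,s_{\tau-1})\in\{+,-,0\}^*$, $\tau\ge 1$, if there is $N\in\mathbb{N}$ with $\operatorname{sgn} f(n)=s_{n\bmod\tau}$ for all $n\ge N$; a sequence with no ultimate sign is said to have the shortest ultimate sign $\bot$. For $P,Q\in\mathbb{R}(x)$ without poles in $\mathbb{N}$, $f$ is $(P,Q)$-holonomic if $f(n+2)=P(n)f(n+1)+Q(n)f(n)$ for all $n\in\mathbb{N}$. Let $$S_{P,Q}:=\{\,s\in\{+,-,0\}^*\cup\{\bot\} : \text{some nonzero } (P,Q)\text{-holonomic sequence has the shortest ultimate sign } s\,\}.$$ For nonzero $P,Q\in\mathbb{R}(x)$ put $R(x):=\frac{Q(x)}{P(x)P(x-1)}$, let $d$ be the degree of $R$ (that is, $|R(x)|=\Theta(x^d)$ as $x\to\infty$), and let $(s)$, $s\in\{+,-\}$, be the ultimate sign of $(R(n))_{n}$. If $d\le 0$, write $R(x)=\alpha_0+\frac{\alpha_1}{x}+\frac{\alpha_2}{x^2}+O(x^{-3})$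 as $x\to\infty$. The pair $(P,Q)$ is - of loxodromic type if $s=+$ (of $\infty$-$O$ loxodromic type if moreover $d>2$, of $\infty$-$\Omega$ loxodromic type if $d\le2$); - of hyperbolic type if $s=-$, $d\le 0$ and $(\alpha_0,\alpha_1,\alpha_2)\ge(-\frac14,0,-\frac1{16})$ in lexicographic order; - of $\theta$-$O$ elliptic type, for a rational $\theta\in(0,\frac12)$, if $s=-$, $d\le 0$, $(\alpha_0,\alpha_1,\alpha_2)<(-\frac14,0,-\frac1{16})$ in lexicographic order, $\alpha_0=-\frac{1}{4\cos^2\theta\pi}$ and $\alpha_1=0$; and of $\frac12$-$O$ elliptic type if $s=-$ and $d>2$; - of $\mathbb{Q}$-$\Omega$ elliptic type if $s=-$ and either $d\in\{1,2\}$, or $d\le 0$, $(\alpha_0,\alpha_1,\alpha_2)<(-\frac14,0,-\frac1{16})$ in lexicographic order and, for the $\theta\in[0,\frac12)$ with $\alpha_0=-\frac1{4\cos^2\theta\pi}$, it is not the case that $\theta$ is a positive rational number and $\alpha_1=0$. **Statement.** Let $P,Q\in\mathbb{R}(x)$ be rational functions without poles or zeros in $\mathbb{N}$, and suppose that $(P(n))_n$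 has ultimate sign $(+)$. 1. If $(P,Q)$ is of loxodromic type, then $S_{P,Q}=\{(+),(-),(+,-),(-,+)\}$. 2. If $(P,Q)$ is of hyperbolic type, then $S_{P,Q}=\{(+),(-)\}$. 3. If $(P,Q)$ is of $\frac kr$-$O$ elliptic type, where $k$ and $r$ are coprime positive integers, let $$s_j=\Bigl(\operatorname{sgn}\sin\tfrac{j-ik+0.5}{r}\pi\Bigr)_{i=0,\dots,(k\bmod 2)r+r-1},\qquad t_j=\Bigl(\operatorname{sgn}\sin\tfrac{j-ik}{r}\pi\Bigr)_{i=0,\dots,(k\bmod 2)r+r-1}$$ for $j=0,\dots,2r-1$, where $k\bmod 2$ is $0$ if $k$ is even and $1$ if $k$ is odd. If $\frac{Q(x)}{P(x)P(x-1)}$ is constant, then $S_{P,Q}=\{s_j\mid 0\le j\le 2r-1\}\cup\{t_j\mid 0\le j\le 2r-1\}$; otherwise $S_{P,Q}=\{s_j\mid 0\le j\le 2r-1\}$. 4. If $(P,Q)$ is of $\mathbb{Q}$-$\Omega$ elliptic type, then $S_{P,Q}=\{\bot\}$. -/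

import Mathlib

open Filter Asymptotics Polynomial

namespace Holonomic

noncomputable section

/-- Signs are elements of `SignType`: `1` is `+`, `-1` is `-`, `0` is `0`.
The sequence `f` has the ultimate sign `s = (s₀, …, s_{τ-1})`, a nonempty word, at the index `N`. -/
def HasUltimateSignAt (f : ℕ → ℝ) (s : List SignType) (N : ℕ) : Prop :=
  s ≠ [] ∧ ∀ n : ℕ, N ≤ n → s[n % s.length]? = some (SignType.sign (f n))

/-- The sequence `f` has the ultimate sign `s` (at some index). -/
def HasUltimateSign (f : ℕ → ℝ) (s : List SignType) : Prop :=
  ∃ N : ℕ, HasUltimateSignAt f s N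

/-- The shortest ultimate sign of `f` is `s`; the value `⊥` stands for
"`f` has no ultimate sign". -/
def HasShortestUltimateSign (f : ℕ → ℝ) (s : WithBot (List SignType)) : Prop :=
  (s = ⊥ ∧ ∀ w : List SignType, ¬ HasUltimateSign f w) ∨
  ∃ w : List SignType, s = (w : WithBot (List SignType)) ∧ HasUltimateSign f w ∧
    ∀ w' : List SignType, HasUltimateSign f w' → w.length ≤ w'.length

/-- The value of a rational function at a real number (used only away from the poles,
or for all sufficiently large arguments). -/
def value (R : RatFunc ℝ) (x : ℝ) : ℝ := R.eval (RingHom.id ℝ) x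

/-- The rational function `R` has no pole at any natural number. -/
def NoPolesInNat (R : RatFunc ℝ) : Prop := ∀ n : ℕ, R.denom.eval (n : ℝ) ≠ 0

/-- The rational function `R` has no zero at any natural number. -/
def NoZerosInNat (R : RatFunc ℝ) : Prop := ∀ n : ℕ, R.num.eval (n : ℝ) ≠ 0

/-- `f` is `(P, Q)`-holonomic. -/
def IsHolonomic (P Q : RatFunc ℝ) (f : ℕ → ℝ) : Prop :=
  ∀ n : ℕ, f (n + 2) = value P n * f (n + 1) + value Q n * f n

/-- The rational function has ultimate sign `(s)`. -/
def RatHasUltimateSign (R : RatFunc ℝ) (s : SignType) : Prop :=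
  HasUltimateSign (fun n : ℕ => value R n) [s]

/-- The rational function `P(x - 1)`. -/
def shiftBack (P : RatFunc ℝ) : RatFunc ℝ :=
  algebraMap ℝ[X] (RatFunc ℝ) (P.num.comp (X - C 1)) /
    algebraMap ℝ[X] (RatFunc ℝ) (P.denom.comp (X - C 1))

/-- The rational function `Q(x) / (P(x) P(x - 1))`. -/
def ratio (P Q : RatFunc ℝ) : RatFunc ℝ := Q / (P * shiftBack P)

/-- `R(x) = α₀ + α₁ / x + α₂ / x ^ 2 + O(x ^ (-3))` as `x → ∞`. -/
def HasExpansion (R : RatFunc ℝ) (α₀ α₁ α₂ : ℝ) : Prop :=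
  (fun x : ℝ => value R x - (α₀ + α₁ / x + α₂ / x ^ 2)) =O[atTop] fun x : ℝ => x ^ (-3 : ℤ)

/-- `(α₀, α₁, α₂) ≥ (-1/4, 0, -1/16)` in the lexicographic order. -/
def LexBound (α₀ α₁ α₂ : ℝ) : Prop :=
  (toLex (-1 / 4, toLex (0, -1 / 16)) : ℝ ×ₗ ℝ ×ₗ ℝ) ≤ toLex (α₀, toLex (α₁, α₂))

/-- `∞`-`O` loxodromic type. -/
def IsInftyOLoxodromic (P Q : RatFunc ℝ) : Prop :=
  RatHasUltimateSign (ratio P Q) 1 ∧ 2 < (ratio P Q).intDegree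

/-- `∞`-`Ω` loxodromic type. -/
def IsInftyOmegaLoxodromic (P Q : RatFunc ℝ) : Prop :=
  RatHasUltimateSign (ratio P Q) 1 ∧ (ratio P Q).intDegree ≤ 2

/-- Loxodromic type. -/
def IsLoxodromic (P Q : RatFunc ℝ) : Prop :=
  IsInftyOLoxodromic P Q ∨ IsInftyOmegaLoxodromic P Q

/-- Hyperbolic type. -/
def IsHyperbolic (P Q : RatFunc ℝ) : Prop :=
  RatHasUltimateSign (ratio P Q) (-1) ∧ (ratio P Q).intDegree ≤ 0 ∧
    ∃ α₀ α₁ α₂ : ℝ, HasExpansion (ratio P Q) α₀ α₁ α₂ ∧ LexBound α₀ α₁ α₂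

/-- The case of negative sign and nonpositive degree that is not hyperbolic, with the coefficient
`α₁` and the number `θ ∈ [0, 1/2)` such that `α₀ = -1 / (4 cos² (θ π))`. -/
def IsNonHyperbolicWith (P Q : RatFunc ℝ) (θ α₁ : ℝ) : Prop :=
  RatHasUltimateSign (ratio P Q) (-1) ∧ (ratio P Q).intDegree ≤ 0 ∧
    ∃ α₀ α₂ : ℝ, HasExpansion (ratio P Q) α₀ α₁ α₂ ∧ ¬ LexBound α₀ α₁ α₂ ∧
      0 ≤ θ ∧ θ < 1 / 2 ∧ α₀ = -1 / (4 * Real.cos (θ * Real.pi) ^ 2)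

/-- `θ` is a positive rational number. -/
def IsPosRational (θ : ℝ) : Prop := ∃ q : ℚ, 0 < q ∧ θ = (q : ℝ)

/-- `θ`-`O` elliptic type. -/
def IsOElliptic (θ : ℝ) (P Q : RatFunc ℝ) : Prop :=
  (IsPosRational θ ∧ IsNonHyperbolicWith P Q θ 0) ∨
  (θ = 1 / 2 ∧ RatHasUltimateSign (ratio P Q) (-1) ∧ 2 < (ratio P Q).intDegree)

/-- `ℚ`-`Ω` elliptic type. -/
def IsRatOmegaElliptic (P Q : RatFunc ℝ) : Prop :=
  (∃ θ α₁ : ℝ, IsNonHyperbolicWith P Q θ α₁ ∧ ¬ (IsPosRational θ ∧ α₁ = 0)) ∨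
  (RatHasUltimateSign (ratio P Q) (-1) ∧
    ((ratio P Q).intDegree = 1 ∨ (ratio P Q).intDegree = 2))

/-- The set `S_{P,Q}` of the shortest ultimate signs of the nonzero `(P, Q)`-holonomic
sequences. -/
def shortestSigns (P Q : RatFunc ℝ) : Set (WithBot (List SignType)) :=
  {s | ∃ f : ℕ → ℝ, IsHolonomic P Q f ∧ f ≠ 0 ∧ HasShortestUltimateSign f s}

/-- The word `(sgn sin ((j - i k + c) π / r))`, `i = 0, …, (k mod 2) r + r - 1`. -/
def sineWord (c : ℝ) (k r j : ℕ) : List SignType :=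
  (List.range ((k % 2) * r + r)).map fun i : ℕ =>
    SignType.sign (Real.sin (((j : ℝ) - (i : ℝ) * (k : ℝ) + c) / (r : ℝ) * Real.pi))

/-- The word `s_j` for the type `k/r`-`O` elliptic. -/
def sWord (k r j : ℕ) : List SignType := sineWord (1 / 2) k r j

/-- The word `t_j` for the type `k/r`-`O` elliptic. -/
def tWord (k r j : ℕ) : List SignType := sineWord 0 k r j

/-- The set `{s_j | j = 0, …, 2 r - 1}`. -/
def sWords (k r : ℕ) : Set (WithBot (List SignType)) :=
  {s | ∃ j : ℕ, j < 2 * r ∧ s = (sWord k r j : WithBot (List SignType))}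

/-- The set `{t_j | j = 0, …, 2 r - 1}`. -/
def tWords (k r : ℕ) : Set (WithBot (List SignType)) :=
  {s | ∃ j : ℕ, j < 2 * r ∧ s = (tWord k r j : WithBot (List SignType))}

end

end Holonomic

namespace Holonomic

noncomputable section

/-! ### Sign words -/

/-! Dividing a solution by a positive sequence `c` with `c (n + 1) = P (n - 1) * c n` preserves
signs for large `n` and turns the recurrence into `g (n + 2) = g (n + 1) + R n * g n` with `R =
ratio P Q`. Since `Q` does not vanish on ℕ, every nonzero pair of values at `N`, `N + 1` comes from
a nonzero solution. Hence `shortestSigns P Q = tailSigns R N` for all large `N`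
(`eventually_shortestSigns_eq`), and only the tail matters.

If `R > 0`, two consecutive values of weakly equal sign force a constant sign from then on, and
otherwise the signs alternate. Alternating solutions exist by compactness (`tailSigns_of_pos`,
`exists_alternating`).

In the hyperbolic case a Riccati-type lower bound yields a positive solution `G`. By the Casoratian,
`g / G` is monotone for every other solution `g`, so `g` has an ultimate constant sign
(`exists_positive_solution`, `tailSigns_of_positive_solution`).

In the elliptic cases the vector `(g (n + 1), g n)` is followed in moving coordinates in which one
step is nearly a rotation by `θ π`. This gives `sgn g n = sgn sin (n θ π + ψ n)`, and everything
depends on the drift of `ψ`. For degree at most 0 the coordinates diagonalize the frozen recurrence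
with roots `1 / 2 ± i √(-R - 1 / 4)`; a step is a rotation by `rootArg (R n)` followed by a stretch
(`hasPhases_elliptic`). For positive degree the coordinates come from `p (n + 2) = -R n * p n`; a
step is a quarter turn followed by a small shear (`hasPhases_shear`).

If the drift is zero, `ψ` may sit on a multiple of `π / r`, and both families of words occur
(`tailSigns_of_const`). If it is one-sided and summable, `ψ` converges without reaching its limit,
so it ends strictly between two multiples of `π / r` and only the words `s_j` occur
(`tailSigns_of_oneSided`). If the drift diverges or `θ` is irrational, there is no ultimate sign
(`tailSigns_of_noSign`). Regular variation of rational functions decides which case holds: the drift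
has the order of `R n - α₀` for `0 < θ < 1 / 2`, of `1 / n` or more for `θ = 0`, and of `n ^ (-d /
2)` for positive degree `d`, which is summable exactly for `d > 2`. -/

lemma HasUltimateSign.congr {f g : ℕ → ℝ} {w : List SignType}
    (h : ∀ᶠ n in atTop, SignType.sign (f n) = SignType.sign (g n)) (hf : HasUltimateSign f w) :
    HasUltimateSign g w := by
  obtain ⟨N, hw, hN⟩ := hf
  obtain ⟨M, hM⟩ := eventually_atTop.1 h
  refine ⟨max N M, hw, fun n hn => ?_⟩
  rw [← hM n (le_trans (le_max_right _ _) hn)]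
  exact hN n (le_trans (le_max_left _ _) hn)

lemma hasUltimateSign_congr {f g : ℕ → ℝ} {w : List SignType}
    (h : ∀ᶠ n in atTop, SignType.sign (f n) = SignType.sign (g n)) :
    HasUltimateSign f w ↔ HasUltimateSign g w :=
  ⟨fun hf => hf.congr h, fun hg => hg.congr (h.mono fun _ hn => hn.symm)⟩

lemma hasShortestUltimateSign_congr {f g : ℕ → ℝ} {s : WithBot (List SignType)}
    (h : ∀ᶠ n in atTop, SignType.sign (f n) = SignType.sign (g n)) :
    HasShortestUltimateSign f s ↔ HasShortestUltimateSign g s := by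
  unfold HasShortestUltimateSign
  simp only [hasUltimateSign_congr h]

lemma HasUltimateSign.length_pos {f : ℕ → ℝ} {w : List SignType} (hf : HasUltimateSign f w) :
    0 < w.length := by
  obtain ⟨N, hw, -⟩ := hf
  exact List.length_pos_iff.2 hw

lemma HasUltimateSign.periodic {f : ℕ → ℝ} {w : List SignType} (hf : HasUltimateSign f w) :
    ∀ᶠ n in atTop, SignType.sign (f (n + w.length)) = SignType.sign (f n) := by
  obtain ⟨N, hw, hN⟩ := hf
  filter_upwards [eventually_ge_atTop N] with n hn
  have h1 := hN n hn
  have h2 := hN (n + w.length) (by omega)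
  rw [Nat.add_mod_right, h1] at h2
  exact (Option.some.inj h2).symm

lemma HasUltimateSign.unique {f : ℕ → ℝ} {w w' : List SignType} (hf : HasUltimateSign f w)
    (hf' : HasUltimateSign f w') (hl : w.length = w'.length) : w = w' := by
  have hpos := hf.length_pos
  obtain ⟨N, hw, hN⟩ := hf
  obtain ⟨N', hw', hN'⟩ := hf'
  apply List.ext_getElem? fun i => ?_
  by_cases hi : i < w.length
  · have e : (i + (max N N') * w.length) % w.length = i := by
      rw [Nat.add_mul_mod_self_right, Nat.mod_eq_of_lt hi]
    have hge : max N N' ≤ i + (max N N') * w.length :=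
      le_trans (Nat.le_mul_of_pos_right _ hpos) (Nat.le_add_left _ _)
    have h1 := hN _ (le_trans (le_max_left _ _) hge)
    have h2 := hN' _ (le_trans (le_max_right _ _) hge)
    rw [← hl, e] at h2
    rw [e] at h1
    rw [h1, h2]
  · rw [List.getElem?_eq_none (by omega), List.getElem?_eq_none (by omega)]

lemma hasShortestUltimateSign_iff_of_le {f : ℕ → ℝ} {w : List SignType}
    (hf : HasUltimateSign f w) (hmin : ∀ w', HasUltimateSign f w' → w.length ≤ w'.length)
    (s : WithBot (List SignType)) :
    HasShortestUltimateSign f s ↔ s = (w : WithBot (List SignType)) := by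
  constructor
  · rintro (⟨-, h⟩ | ⟨v, rfl, hv, hvmin⟩)
    · exact absurd hf (h w)
    · rw [hv.unique hf (le_antisymm (hvmin _ hf) (hmin _ hv))]
  · rintro rfl
    exact Or.inr ⟨w, rfl, hf, hmin⟩

lemma hasShortestUltimateSign_iff_bot {f : ℕ → ℝ} (hf : ∀ w, ¬ HasUltimateSign f w)
    (s : WithBot (List SignType)) : HasShortestUltimateSign f s ↔ s = ⊥ := by
  constructor
  · rintro (⟨h, -⟩ | ⟨v, -, hv, -⟩)
    · exact h
    · exact absurd hv (hf v)
  · rintro rfl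
    exact Or.inl ⟨rfl, hf⟩

lemma hasUltimateSign_of_periodic {f : ℕ → ℝ} {σ : ℕ → SignType} {τ : ℕ} (hτ : 0 < τ)
    (hσ : ∀ n, σ (n + τ) = σ n) (h : ∀ᶠ n in atTop, SignType.sign (f n) = σ n) :
    HasUltimateSign f ((List.range τ).map σ) := by
  obtain ⟨N, hN⟩ := eventually_atTop.1 h
  refine ⟨N, by simpa using hτ.ne', fun n hn => ?_⟩
  rw [hN n hn]
  have hper : Function.Periodic σ τ := hσ
  have hlt : n % τ < τ := Nat.mod_lt _ hτ
  simp [hlt, hper.map_mod_nat n]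

lemma hasShortestUltimateSign_singleton {f : ℕ → ℝ} {a : SignType}
    (h : ∀ᶠ n in atTop, SignType.sign (f n) = a) (s : WithBot (List SignType)) :
    HasShortestUltimateSign f s ↔ s = (([a] : List SignType) : WithBot (List SignType)) := by
  refine hasShortestUltimateSign_iff_of_le (w := [a]) ?_ (fun w' hw' => hw'.length_pos) s
  simpa using hasUltimateSign_of_periodic (σ := fun _ => a) one_pos (fun _ => rfl) h

lemma hasShortestUltimateSign_alternating {f : ℕ → ℝ} {a : SignType} (ha : a ≠ 0)
    (h : ∀ᶠ n in atTop, SignType.sign (f n) = a * (-1) ^ n) (s : WithBot (List SignType)) :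
    HasShortestUltimateSign f s ↔ s = (([a, -a] : List SignType) : WithBot (List SignType)) := by
  refine hasShortestUltimateSign_iff_of_le (w := [a, -a]) ?_ (fun w' hw' => ?_) s
  · have := hasUltimateSign_of_periodic (σ := fun n => a * (-1) ^ n) two_pos
      (fun n => by simp [pow_add]) h
    simpa [show List.range 2 = [0, 1] from rfl] using this
  · by_contra hlt
    have hpos := hw'.length_pos
    have h1 : w'.length = 1 := by simp at hlt; omega
    have hp := hw'.periodic
    rw [h1] at hp
    have h' := (tendsto_add_atTop_nat 1).eventually h
    obtain ⟨n, h2, h3, h4⟩ := (hp.and (h.and h')).exists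
    rw [h4, h3, pow_succ] at h2
    clear h h' h3 h4 hlt
    rcases neg_one_pow_eq_or SignType n with e | e <;> rw [e] at h2 <;>
      revert h2 ha <;> revert a <;> decide

/-! ### Reduction to normalized recurrences -/

/-- The shortest ultimate signs of the sequences that satisfy
`g (n + 2) = g (n + 1) + R n * g n` for `n ≥ N` and do not vanish at both `N` and `N + 1`. -/
def tailSigns (R : ℕ → ℝ) (N : ℕ) : Set (WithBot (List SignType)) :=
  {s | ∃ g : ℕ → ℝ, (∀ n, N ≤ n → g (n + 2) = g (n + 1) + R n * g n) ∧
    (g N ≠ 0 ∨ g (N + 1) ≠ 0) ∧ HasShortestUltimateSign g s}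

lemma exists_recurrence (a b : ℕ → ℝ) (x y : ℝ) :
    ∃ f : ℕ → ℝ, f 0 = x ∧ f 1 = y ∧ ∀ n, f (n + 2) = a n * f (n + 1) + b n * f n := by
  let F : ℕ → ℝ × ℝ := fun n =>
    Nat.rec (x, y) (fun m p => (p.2, a m * p.2 + b m * p.1)) n
  exact ⟨fun n => (F n).1, rfl, rfl, fun n => rfl⟩

lemma exists_recurrence_from (a b : ℕ → ℝ) (N : ℕ) (x y : ℝ) :
    ∃ f : ℕ → ℝ, f N = x ∧ f (N + 1) = y ∧
      ∀ n, N ≤ n → f (n + 2) = a n * f (n + 1) + b n * f n := by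
  obtain ⟨f, h0, h1, h⟩ := exists_recurrence (fun n => a (N + n)) (fun n => b (N + n)) x y
  refine ⟨fun n => f (n - N), by simpa using h0, by simpa using h1, fun n hn => ?_⟩
  obtain ⟨m, rfl⟩ := Nat.exists_eq_add_of_le hn
  have e1 : N + m + 2 - N = m + 2 := by omega
  have e2 : N + m + 1 - N = m + 1 := by omega
  have e3 : N + m - N = m := by omega
  simp only [e1, e2, e3]
  exact h m

/-- As `b` never vanishes, the recurrence can be run backwards, so data may be prescribed at any
index `N`. -/
lemma exists_recurrence_through (a b : ℕ → ℝ) (hb : ∀ n, b n ≠ 0) (N : ℕ) (x y : ℝ) :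
    ∃ f : ℕ → ℝ, f N = x ∧ f (N + 1) = y ∧ ∀ n, f (n + 2) = a n * f (n + 1) + b n * f n := by
  induction N generalizing x y with
  | zero => exact exists_recurrence a b x y
  | succ N ih =>
    obtain ⟨f, h0, h1, h⟩ := ih ((y - a N * x) / b N) x
    refine ⟨f, h1, ?_, h⟩
    rw [h N, h0, h1]
    field_simp [hb N]
    ring

lemma recurrence_ne_zero_step {f a b : ℕ → ℝ} {n : ℕ} (hb : b n ≠ 0)
    (h : f (n + 2) = a n * f (n + 1) + b n * f n) (hn : f n ≠ 0 ∨ f (n + 1) ≠ 0) :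
    f (n + 1) ≠ 0 ∨ f (n + 2) ≠ 0 := by
  by_contra! hc
  rw [hc.1, hc.2] at h
  simp [hb] at h
  rcases hn with h' | h'
  · exact h' h
  · exact h' hc.1

lemma recurrence_ne_zero {f a b : ℕ → ℝ} {N : ℕ} (hb : ∀ n, N ≤ n → b n ≠ 0)
    (h : ∀ n, N ≤ n → f (n + 2) = a n * f (n + 1) + b n * f n) (hN : f N ≠ 0 ∨ f (N + 1) ≠ 0)
    {n : ℕ} (hn : N ≤ n) : f n ≠ 0 ∨ f (n + 1) ≠ 0 := by
  induction n, hn using Nat.le_induction with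
  | base => exact hN
  | succ n hn ih => exact recurrence_ne_zero_step (hb n hn) (h n hn) ih

lemma recurrence_initial_ne_zero {f a b : ℕ → ℝ}
    (h : ∀ n, f (n + 2) = a n * f (n + 1) + b n * f n) (hf : f ≠ 0) :
    f 0 ≠ 0 ∨ f 1 ≠ 0 := by
  by_contra! hc
  apply hf
  have : ∀ n, f n = 0 ∧ f (n + 1) = 0 := by
    intro n
    induction n with
    | zero => exact hc
    | succ n ih => exact ⟨ih.2, by rw [h n, ih.1, ih.2]; ring⟩
  exact funext fun n => (this n).1

lemma scaling_recurrence {p : ℕ → ℝ} {N : ℕ} (hp : ∀ n, N ≤ n → 0 < p n) :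
    ∃ c : ℕ → ℝ, (∀ n, 0 < c n) ∧ ∀ n, N ≤ n → c (n + 1) = p n * c n := by
  refine ⟨fun n => ∏ i ∈ Finset.Ico N n, p i, fun n => ?_, fun n hn => ?_⟩
  · exact Finset.prod_pos fun i hi => hp i (Finset.mem_Ico.1 hi).1
  · beta_reduce
    rw [Finset.prod_Ico_succ_top hn, mul_comm]

lemma sign_div_pos {a b : ℝ} (hb : 0 < b) : SignType.sign (a / b) = SignType.sign a := by
  rw [div_eq_mul_inv, sign_mul, sign_pos (inv_pos.2 hb), mul_one]

lemma sign_pos_mul {a b : ℝ} (hb : 0 < b) : SignType.sign (b * a) = SignType.sign a := by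
  rw [sign_mul, sign_pos hb, one_mul]

/-- The substitution `f = c * g` with `c > 0` and `c (n + 1) = P (n - 1) * c n` turns the
coefficients `P`, `Q` into `1`, `R`. -/
lemma shortestSigns_eq_tailSigns (P Q : RatFunc ℝ) (hQ : ∀ n : ℕ, value Q n ≠ 0)
    {N : ℕ} (hP : ∀ n : ℕ, N ≤ n → 0 < value P ((n : ℝ) - 1))
    {R : ℕ → ℝ} (hR : ∀ n : ℕ, N ≤ n → R n = value Q n / (value P n * value P ((n : ℝ) - 1))) :
    shortestSigns P Q = tailSigns R N := by
  obtain ⟨c, hc, hcs⟩ := scaling_recurrence (p := fun n => value P ((n : ℝ) - 1)) hP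
  have hP' : ∀ n : ℕ, N ≤ n → 0 < value P (n : ℝ) := fun n hn => by
    have := hP (n + 1) (by omega)
    simpa using this
  have hcs2 : ∀ n : ℕ, N ≤ n → c (n + 2) = value P n * (value P ((n : ℝ) - 1) * c n) :=
    fun n hn => by
      rw [hcs (n + 1) (by omega), hcs n hn]
      push_cast
      rw [add_sub_cancel_right]
  ext s
  constructor
  · rintro ⟨f, hf, hf0, hs⟩
    refine ⟨fun n => f n / c n, fun n hn => ?_, ?_, ?_⟩
    · have h1 := (hP n hn).ne'
      have h2 := (hP' n hn).ne'
      have h3 := (hc n).ne'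
      beta_reduce
      rw [hcs2 n hn, hcs n hn, hR n hn, hf n]
      field_simp
    · have h0 := recurrence_initial_ne_zero hf hf0
      have := recurrence_ne_zero (N := 0) (fun n _ => hQ n) (fun n _ => hf n) h0 (Nat.zero_le N)
      simpa [(hc N).ne', (hc (N + 1)).ne'] using this
    · rwa [hasShortestUltimateSign_congr (g := f)]
      exact Eventually.of_forall fun n => sign_div_pos (hc n)
  · rintro ⟨g, hg, hg0, hs⟩
    obtain ⟨f, h0, h1, hf⟩ := exists_recurrence_through (fun n : ℕ => value P n)
      (fun n : ℕ => value Q n) hQ N (c N * g N) (c (N + 1) * g (N + 1))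
    have key : ∀ n, N ≤ n → f n = c n * g n ∧ f (n + 1) = c (n + 1) * g (n + 1) := by
      intro n hn
      induction n, hn using Nat.le_induction with
      | base => exact ⟨h0, h1⟩
      | succ n hn ih =>
        refine ⟨ih.2, ?_⟩
        have h1 := (hP n hn).ne'
        have h2 := (hP' n hn).ne'
        rw [hf n, ih.1, ih.2, hg n hn, hcs2 n hn, hcs n hn, hR n hn]
        field_simp
    refine ⟨f, hf, ?_, ?_⟩
    · rintro rfl
      rcases hg0 with h | h
      · exact h (by simpa [(hc N).ne'] using (key N le_rfl).1.symm)
      · exact h (by simpa [(hc (N + 1)).ne'] using (key N le_rfl).2.symm)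
    · rwa [hasShortestUltimateSign_congr (g := g)]
      filter_upwards [eventually_ge_atTop N] with n hn
      rw [(key n hn).1, sign_pos_mul (hc n)]

/-! ### Loxodromic type -/

lemma neg_ne_zero_of {a : SignType} (ha : a ≠ 0) : -a ≠ 0 := by
  revert ha; revert a; decide

lemma eventually_pos_of_nonneg {g R : ℕ → ℝ} {N M : ℕ} (hR : ∀ n, N ≤ n → 0 < R n)
    (hg : ∀ n, N ≤ n → g (n + 2) = g (n + 1) + R n * g n) (hM : N ≤ M)
    (h0 : 0 ≤ g M) (h1 : 0 ≤ g (M + 1)) (hne : g M ≠ 0 ∨ g (M + 1) ≠ 0) :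
    ∀ n, M + 2 ≤ n → 0 < g n := by
  have key : ∀ n, M ≤ n → 0 ≤ g n ∧ 0 ≤ g (n + 1) ∧ 0 < g (n + 2) := by
    intro n hn
    induction n, hn using Nat.le_induction with
    | base =>
      refine ⟨h0, h1, ?_⟩
      rw [hg M hM]
      rcases hne with h | h
      · exact add_pos_of_nonneg_of_pos h1 (mul_pos (hR M hM) (lt_of_le_of_ne h0 h.symm))
      · exact add_pos_of_pos_of_nonneg (lt_of_le_of_ne h1 h.symm) (mul_nonneg (hR M hM).le h0)
    | succ n hn ih =>
      refine ⟨ih.2.1, ih.2.2.le, ?_⟩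
      rw [hg (n + 1) (by omega)]
      exact add_pos_of_pos_of_nonneg ih.2.2 (mul_nonneg (hR _ (by omega)).le ih.2.1)
  intro n hn
  obtain ⟨m, rfl⟩ := Nat.exists_eq_add_of_le hn
  have := (key (M + m) (by omega)).2.2
  rwa [show M + 2 + m = M + m + 2 by omega]

/-- Either two consecutive values have a nonnegative product, and the sign is frozen two steps
later, or all consecutive products are negative. -/
lemma sign_cases_of_pos {g R : ℕ → ℝ} {N : ℕ} (hR : ∀ n, N ≤ n → 0 < R n)
    (hg : ∀ n, N ≤ n → g (n + 2) = g (n + 1) + R n * g n) (hne : g N ≠ 0 ∨ g (N + 1) ≠ 0) :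
    (∃ a : SignType, a ≠ 0 ∧ ∀ᶠ n in atTop, SignType.sign (g n) = a) ∨
    (∃ a : SignType, a ≠ 0 ∧ ∀ᶠ n in atTop, SignType.sign (g n) = a * (-1) ^ n) := by
  have hne' : ∀ n, N ≤ n → g n ≠ 0 ∨ g (n + 1) ≠ 0 := fun n hn =>
    recurrence_ne_zero (a := fun _ => 1) (fun n hn => (hR n hn).ne')
      (fun n hn => by rw [hg n hn, one_mul]) hne hn
  by_cases h : ∃ M, N ≤ M ∧ 0 ≤ g M * g (M + 1)
  · left
    obtain ⟨M, hM, hp⟩ := h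
    rcases mul_nonneg_iff.1 hp with ⟨h0, h1⟩ | ⟨h0, h1⟩
    · refine ⟨1, by decide, eventually_atTop.2 ⟨M + 2, fun n hn => sign_pos ?_⟩⟩
      exact eventually_pos_of_nonneg hR hg hM h0 h1 (hne' M hM) n hn
    · refine ⟨-1, by decide, eventually_atTop.2 ⟨M + 2, fun n hn => sign_neg ?_⟩⟩
      have := eventually_pos_of_nonneg (g := fun n => - g n) hR
        (fun n hn => by linarith [hg n hn]) hM (by linarith) (by linarith)
        (by simpa using hne' M hM) n hn
      linarith
  · right
    push Not at h
    have hgN : g N ≠ 0 := fun h0 => by simpa [h0] using h N le_rfl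
    refine ⟨SignType.sign (g N) * (-1) ^ N, ?_, eventually_atTop.2 ⟨N, fun n hn => ?_⟩⟩
    · have := sign_ne_zero.2 hgN
      rcases neg_one_pow_eq_or SignType N with e | e <;> simpa [e] using this
    · induction n, hn using Nat.le_induction with
      | base =>
        rcases neg_one_pow_eq_or SignType N with e | e <;> simp [e]
      | succ n hn ih =>
        have h2 : SignType.sign (g (n + 1)) = - SignType.sign (g n) := by
          rcases mul_neg_iff.1 (h n hn) with ⟨h0, h1⟩ | ⟨h0, h1⟩
          · rw [sign_pos h0, sign_neg h1]
          · rw [sign_neg h0, sign_pos h1]; rfl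
        rw [h2, ih, pow_succ]
        simp

/-- With `h n = (-1) ^ n * g n` the recurrence becomes `h (n + 2) = -h (n + 1) + R n * h n`, whose
backward form preserves nonnegativity. For each `n` some initial vector on a fixed segment gives `h
≥ 0` up to `n`; compactness of the segment yields one vector good for all `n`. -/
lemma exists_alternating {R : ℕ → ℝ} {N : ℕ} (hR : ∀ n, N ≤ n → 0 < R n) :
    ∃ g : ℕ → ℝ, (∀ n, N ≤ n → g (n + 2) = g (n + 1) + R n * g n) ∧
      (g N ≠ 0 ∨ g (N + 1) ≠ 0) ∧ ∀ n, N ≤ n → 0 ≤ (-1) ^ n * g n := by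
  obtain ⟨u, u0, u1, hu⟩ := exists_recurrence_from (fun _ => -1) R N 1 0
  obtain ⟨v, v0, v1, hv⟩ := exists_recurrence_from (fun _ => -1) R N 0 1
  have hcomb : ∀ c d : ℝ, ∀ n, N ≤ n → c * u (n + 2) + d * v (n + 2) =
      -(c * u (n + 1) + d * v (n + 1)) + R n * (c * u n + d * v n) := fun c d n hn => by
    rw [hu n hn, hv n hn]; ring
  have hne : ∀ n, N ≤ n → ∃ c : ℝ, c ∈ Set.Icc (0 : ℝ) 1 ∧ ∀ m, N ≤ m → m ≤ n →
      0 ≤ c * u m + (1 - c) * v m := by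
    intro n hn
    -- Backward propagation: `R n * h n = h (n + 2) + h (n + 1)` with `R n > 0`.
    have hback : ∀ n, N ≤ n → ∀ c d : ℝ, 0 ≤ c * u n + d * v n →
        0 ≤ c * u (n + 1) + d * v (n + 1) → ∀ m, N ≤ m → m ≤ n + 1 →
        0 ≤ c * u m + d * v m := by
      intro n hn
      induction n, hn using Nat.le_induction with
      | base =>
        intro c d h0 h1 m hm hm'
        rcases Nat.le_succ_iff_eq_or_le.1 hm' with rfl | h
        · exact h1
        · rwa [le_antisymm h hm]
      | succ n hn ih =>
        intro c d h0 h1 m hm hm'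
        rcases Nat.le_succ_iff_eq_or_le.1 hm' with rfl | h
        · exact h1
        · refine ih c d ?_ h0 m hm h
          have := hcomb c d n hn
          have h1' : 0 ≤ c * u (n + 2) + d * v (n + 2) := h1
          have hmul : 0 ≤ R n * (c * u n + d * v n) := by linarith
          exact nonneg_of_mul_nonneg_right hmul (hR n hn)
    have hW : ∀ n, N ≤ n → u n * v (n + 1) - u (n + 1) * v n ≠ 0 := by
      intro n hn
      induction n, hn using Nat.le_induction with
      | base => rw [u0, u1, v0, v1]; norm_num
      | succ n hn ih =>
        rw [hu n hn, hv n hn]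
        have : u (n + 1) * (-1 * v (n + 1) + R n * v n) -
            (-1 * u (n + 1) + R n * u n) * v (n + 1) =
            - R n * (u n * v (n + 1) - u (n + 1) * v n) := by ring
        rw [this]
        exact mul_ne_zero (neg_ne_zero.2 (hR n hn).ne') ih
    -- Cramer's rule with the nonzero Casoratian prescribes the values `1, 0` at `n, n + 1`; going
    -- back, the initial values `c, d` are nonnegative and can be scaled to sum 1.
    obtain ⟨c, d, hc1, hc2⟩ : ∃ c d : ℝ, c * u n + d * v n = 1 ∧
        c * u (n + 1) + d * v (n + 1) = 0 :=
      ⟨v (n + 1) / (u n * v (n + 1) - u (n + 1) * v n),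
        -u (n + 1) / (u n * v (n + 1) - u (n + 1) * v n), by
          rw [div_mul_eq_mul_div, div_mul_eq_mul_div, ← add_div, div_eq_one_iff_eq (hW n hn)]
          ring, by ring⟩
    have hall := hback n hn c d (by rw [hc1]; norm_num) hc2.ge
    have hc0 : 0 ≤ c := by simpa [u0, v0] using hall N le_rfl (by omega)
    have hd0 : 0 ≤ d := by simpa [u1, v1] using hall (N + 1) (by omega) (by omega)
    have hs : 0 < c + d := by
      rcases hc0.eq_or_lt with h | h
      · rcases hd0.eq_or_lt with h' | h'
        · rw [← h, ← h'] at hc1; norm_num at hc1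
        · linarith
      · linarith
    refine ⟨c / (c + d), ⟨by positivity, by rw [div_le_one hs]; linarith⟩, fun m hm hm' => ?_⟩
    have e : c / (c + d) * u m + (1 - c / (c + d)) * v m = (c * u m + d * v m) / (c + d) := by
      field_simp; ring
    rw [e]
    exact div_nonneg (hall m hm (by omega)) hs.le
  let K : ℕ → Set ℝ := fun n => {c | c ∈ Set.Icc (0 : ℝ) 1 ∧ ∀ m, N ≤ m → m ≤ N + n →
      0 ≤ c * u m + (1 - c) * v m}
  have hclosed : ∀ n, IsClosed (K n) := by
    intro n
    have : K n = Set.Icc (0 : ℝ) 1 ∩ ⋂ m, ⋂ (_ : N ≤ m), ⋂ (_ : m ≤ N + n),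
        {c : ℝ | 0 ≤ c * u m + (1 - c) * v m} := by
      ext c; simp [K]
    rw [this]
    refine isClosed_Icc.inter (isClosed_iInter fun m => isClosed_iInter fun _ =>
      isClosed_iInter fun _ => isClosed_le continuous_const (by fun_prop))
  obtain ⟨c, hc⟩ := IsCompact.nonempty_iInter_of_sequence_nonempty_isCompact_isClosed K
    (fun n c hc => ⟨hc.1, fun m hm hm' => hc.2 m hm (by omega)⟩)
    (fun n => let ⟨c, hc⟩ := hne (N + n) (by omega); ⟨c, hc⟩)
    (isCompact_Icc.of_isClosed_subset (hclosed 0) fun c hc => hc.1) hclosed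
  rw [Set.mem_iInter] at hc
  refine ⟨fun n => (-1) ^ n * (c * u n + (1 - c) * v n), fun n hn => ?_, ?_, fun n hn => ?_⟩
  · have := hcomb c (1 - c) n hn
    beta_reduce
    rw [this]; ring
  · by_contra! h
    rw [u0, v0, u1, v1] at h
    simp at h
    have h3 := h.2
    rw [h.1] at h3
    norm_num at h3
  · rw [← mul_assoc, ← mul_pow]
    simpa using (hc n).2 n hn (by omega)

lemma tailSigns_of_pos {R : ℕ → ℝ} {N : ℕ} (hR : ∀ n, N ≤ n → 0 < R n) :
    tailSigns R N = {(([1] : List SignType) : WithBot (List SignType)),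
         (([-1] : List SignType) : WithBot (List SignType)),
         (([1, -1] : List SignType) : WithBot (List SignType)),
         (([-1, 1] : List SignType) : WithBot (List SignType))} := by
  ext s
  simp only [Set.mem_insert_iff, Set.mem_singleton_iff]
  have hcase : ∀ a : SignType, a ≠ 0 → a = 1 ∨ a = -1 := by decide
  constructor
  · rintro ⟨g, hg, hne, hs⟩
    rcases sign_cases_of_pos hR hg hne with ⟨a, ha, h⟩ | ⟨a, ha, h⟩
    · rw [hasShortestUltimateSign_singleton h] at hs
      rcases hcase a ha with rfl | rfl
      · exact Or.inl hs
      · exact Or.inr (Or.inl hs)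
    · rw [hasShortestUltimateSign_alternating ha h] at hs
      rcases hcase a ha with rfl | rfl
      · exact Or.inr (Or.inr (Or.inl hs))
      · exact Or.inr (Or.inr (Or.inr hs))
  · have hneg : ∀ g : ℕ → ℝ, (∀ n, N ≤ n → g (n + 2) = g (n + 1) + R n * g n) →
        ∀ n, N ≤ n → (-g) (n + 2) = (-g) (n + 1) + R n * (-g) n := fun g hg n hn => by
      simp only [Pi.neg_apply]; linarith [hg n hn]
    obtain ⟨g, g0, g1, hg⟩ := exists_recurrence_from (fun _ => 1) R N 1 1
    simp only [one_mul] at hg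
    have hpos : ∀ᶠ n in atTop, 0 < g n := eventually_atTop.2 ⟨N + 2,
      eventually_pos_of_nonneg hR hg le_rfl (by simp [g0]) (by simp [g1]) (by simp [g0])⟩
    obtain ⟨u, hu, hune, hualt⟩ := exists_alternating hR
    obtain ⟨a, ha, hau⟩ : ∃ a : SignType, a ≠ 0 ∧
        ∀ᶠ n in atTop, SignType.sign (u n) = a * (-1) ^ n := by
      -- An ultimately constant nonzero sign contradicts `(-1) ^ n * u n ≥ 0` at an even and at the
      -- next odd index.
      refine (sign_cases_of_pos hR hu hune).resolve_left ?_
      rintro ⟨a, ha, h⟩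
      obtain ⟨M, hM⟩ := eventually_atTop.1 h
      have h1 := hM (2 * (M + N)) (by omega)
      have h2 := hM (2 * (M + N) + 1) (by omega)
      have h3 := hualt (2 * (M + N)) (by omega)
      have h4 := hualt (2 * (M + N) + 1) (by omega)
      rw [pow_succ, pow_mul] at h4
      rw [pow_mul] at h3
      norm_num at h3 h4
      rcases hcase a ha with rfl | rfl
      · rw [sign_eq_one_iff] at h2; linarith
      · rw [sign_eq_neg_one_iff] at h1; linarith
    have hau' : ∀ᶠ n in atTop, SignType.sign ((-u) n) = -a * (-1) ^ n := hau.mono fun n hn => by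
      rw [Pi.neg_apply, Left.sign_neg, hn, neg_mul]
    have hmem : (([a, -a] : List SignType) : WithBot (List SignType)) ∈ tailSigns R N :=
      ⟨u, hu, hune, (hasShortestUltimateSign_alternating ha hau _).2 rfl⟩
    have hmem' : (([-a, a] : List SignType) : WithBot (List SignType)) ∈ tailSigns R N :=
      ⟨-u, hneg u hu, by simpa using hune, by
        rw [hasShortestUltimateSign_alternating (neg_ne_zero_of ha) hau',
          neg_neg]⟩
    rintro (rfl | rfl | rfl | rfl)
    · exact ⟨g, hg, by simp [g0],
        (hasShortestUltimateSign_singleton (hpos.mono fun n hn => sign_pos hn) _).2 rfl⟩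
    · exact ⟨-g, hneg g hg, by simp [g0],
        (hasShortestUltimateSign_singleton (hpos.mono fun n hn => sign_neg (by simpa using hn)) _).2
          rfl⟩
    · rcases hcase a ha with rfl | rfl
      · exact hmem
      · exact hmem'
    · rcases hcase a ha with rfl | rfl
      · exact hmem'
      · exact hmem

/-! ### Hyperbolic type -/

/-- The Casoratian `W n = G n * g (n + 1) - G (n + 1) * g n` satisfies `W (n + 1) = -R n * W n`, so
with `R < 0` it keeps its sign. Hence `g / G` is strictly monotone or constant, and `g` changes sign
at most once. -/
lemma tailSigns_of_positive_solution {R G : ℕ → ℝ} {N : ℕ} (hR : ∀ n, N ≤ n → R n < 0)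
    (hG : ∀ n, N ≤ n → G (n + 2) = G (n + 1) + R n * G n) (hpos : ∀ n, N ≤ n → 0 < G n) :
    tailSigns R N = {(([1] : List SignType) : WithBot (List SignType)),
         (([-1] : List SignType) : WithBot (List SignType))} := by
  ext s
  simp only [Set.mem_insert_iff, Set.mem_singleton_iff]
  constructor
  · rintro ⟨g, hg, hne, hs⟩
    suffices h : (∀ᶠ n in atTop, 0 < g n) ∨ (∀ᶠ n in atTop, g n < 0) by
      rcases h with h | h
      · exact Or.inl ((hasShortestUltimateSign_singleton (h.mono fun n hn => sign_pos hn) _).1 hs)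
      · exact Or.inr ((hasShortestUltimateSign_singleton (h.mono fun n hn => sign_neg hn) _).1 hs)
    have key : ∀ g : ℕ → ℝ, (∀ n, N ≤ n → g (n + 2) = g (n + 1) + R n * g n) →
        0 < G N * g (N + 1) - G (N + 1) * g N →
        (∀ᶠ n in atTop, 0 < g n) ∨ (∀ᶠ n in atTop, g n < 0) := by
      intro g hg hW
      have hWn : ∀ n, N ≤ n → 0 < G n * g (n + 1) - G (n + 1) * g n := by
        intro n hn
        induction n, hn using Nat.le_induction with
        | base => exact hW
        | succ n hn ih =>
          rw [hg n hn, hG n hn]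
          have := mul_pos (neg_pos.2 (hR n hn)) ih
          linarith
      have hmono : ∀ n, N ≤ n → g n / G n < g (n + 1) / G (n + 1) := fun n hn => by
        rw [div_lt_div_iff₀ (hpos n hn) (hpos (n + 1) (by omega))]
        linarith [hWn n hn]
      by_cases h : ∃ M, N ≤ M ∧ 0 ≤ g M
      · left
        obtain ⟨M, hM, h0⟩ := h
        refine eventually_atTop.2 ⟨M + 1, fun n hn => ?_⟩
        have : 0 < g n / G n := by
          induction n, hn using Nat.le_induction with
          | base => exact (div_nonneg h0 (hpos M hM).le).trans_lt (hmono M hM)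
          | succ n hn ih => exact ih.trans (hmono n (by omega))
        exact (div_pos_iff_of_pos_right (hpos n (by omega))).1 this
      · right
        push Not at h
        exact eventually_atTop.2 ⟨N, h⟩
    rcases lt_trichotomy (G N * g (N + 1) - G (N + 1) * g N) 0 with hW | hW | hW
    · have := key (fun n => - g n) (fun n hn => by linarith [hg n hn]) (by linarith)
      simpa [or_comm] using this
    · have hGN := hpos N le_rfl
      have hprop : ∀ n, N ≤ n → g n = g N / G N * G n ∧
          g (n + 1) = g N / G N * G (n + 1) := by
        intro n hn
        induction n, hn using Nat.le_induction with
        | base =>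
          constructor
          · field_simp
          · field_simp; linarith
        | succ n hn ih =>
          refine ⟨ih.2, ?_⟩
          rw [hg n hn, hG n hn, ih.1, ih.2]; ring
      have hc : g N / G N ≠ 0 := by
        intro h0
        rw [h0] at hprop
        rcases hne with h | h
        · exact h (by simpa using (hprop N le_rfl).1)
        · exact h (by simpa using (hprop N le_rfl).2)
      rcases hc.lt_or_gt with h | h
      · right
        refine eventually_atTop.2 ⟨N, fun n hn => ?_⟩
        rw [(hprop n hn).1]
        exact mul_neg_of_neg_of_pos h (hpos n hn)
      · left
        refine eventually_atTop.2 ⟨N, fun n hn => ?_⟩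
        rw [(hprop n hn).1]
        exact mul_pos h (hpos n hn)
    · exact key g hg hW
  · have hGN := (hpos N le_rfl).ne'
    rintro (rfl | rfl)
    · exact ⟨G, hG, Or.inl hGN, (hasShortestUltimateSign_singleton
        (eventually_atTop.2 ⟨N, fun n hn => sign_pos (hpos n hn)⟩) _).2 rfl⟩
    · exact ⟨fun n => - G n, fun n hn => by linarith [hG n hn], Or.inl (neg_ne_zero.2 hGN),
        (hasShortestUltimateSign_singleton
        (eventually_atTop.2 ⟨N, fun n hn => sign_neg (neg_neg_of_pos (hpos n hn))⟩) _).2 rfl⟩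

/-- The comparison sequence `v n = 1 / 2 + 1 / (4 (n - b))` satisfies `v n * (1 - v (n + 1)) = 1 / 4
+ 1 / (16 (n - b) (n - b + 1))`, which is exactly the assumed bound on `-R n`. It is a subsolution
of the Riccati recurrence for `G (n + 1) / G n`. -/
lemma exists_positive_solution {R : ℕ → ℝ} {N : ℕ} {b : ℝ} (hb : b < N)
    (hR : ∀ n : ℕ, N ≤ n → -R n ≤ 1 / 4 + 1 / (16 * (((n : ℝ) - b) * ((n : ℝ) - b + 1)))) :
    ∃ G : ℕ → ℝ, (∀ n, N ≤ n → G (n + 2) = G (n + 1) + R n * G n) ∧ ∀ n, N ≤ n → 0 < G n := by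
  let v : ℕ → ℝ := fun n => 1 / 2 + 1 / (4 * ((n : ℝ) - b))
  obtain ⟨G, G0, G1, hG⟩ := exists_recurrence_from (fun _ => 1) R N 1 (v N)
  simp only [one_mul] at hG
  have hm : ∀ n : ℕ, N ≤ n → 0 < (n : ℝ) - b := fun n hn => by
    have : (N : ℝ) ≤ n := by exact_mod_cast hn
    linarith
  have hv : ∀ n : ℕ, N ≤ n → 0 < v n := fun n hn => by
    have := hm n hn
    positivity
  have hvv : ∀ n : ℕ, N ≤ n → -R n ≤ v n * (1 - v (n + 1)) := fun n hn => by
    refine (hR n hn).trans (le_of_eq ?_)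
    have h1 := hm n hn
    have h2 : (0 : ℝ) < (n : ℝ) - b + 1 := by linarith
    simp only [v]
    push_cast
    rw [show (n : ℝ) + 1 - b = (n : ℝ) - b + 1 by ring]
    generalize (n : ℝ) - b = m at *
    field_simp
    ring
  -- The invariant `v n * G n ≤ G (n + 1)` propagates, because `G (n + 2) ≥ G (n + 1) - v n * (1 - v
  -- (n + 1)) * G n ≥ v (n + 1) * G (n + 1)`; the last inequality needs `v (n + 1) ≤ 1`.
  have key : ∀ n, N ≤ n → 0 < G n ∧ v n * G n ≤ G (n + 1) := by
    intro n hn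
    induction n, hn using Nat.le_induction with
    | base => simp [G0, G1]
    | succ n hn ih =>
      have h1 : 0 < G (n + 1) := (mul_pos (hv n hn) ih.1).trans_le ih.2
      refine ⟨h1, ?_⟩
      rw [hG n hn]
      have h2 := hv n hn
      have h3 := hv (n + 1) (by omega)
      have h4 : v (n + 1) ≤ 1 := by
        have h7 := hm n hn
        have h8 : 1 / (4 * (((n + 1 : ℕ) : ℝ) - b)) ≤ 1 / 2 := by
          apply one_div_le_one_div_of_le two_pos
          push_cast
          linarith
        simp only [v]
        linarith
      have h5 := mul_le_mul_of_nonneg_right (hvv n hn) ih.1.le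
      have h6 := mul_le_mul_of_nonneg_left ih.2 (sub_nonneg.2 h4)
      linarith
  exact ⟨G, hG, fun n hn => (key n hn).1⟩

/-! ### Asymptotics of rational functions along the natural numbers -/

lemma tendsto_natCast_real : Tendsto (fun n : ℕ => (n : ℝ)) atTop atTop :=
  tendsto_natCast_atTop_atTop

lemma eventually_natCast_pos : ∀ᶠ n : ℕ in atTop, 0 < (n : ℝ) :=
  tendsto_natCast_real.eventually_gt_atTop 0

lemma value_eq_div (R : RatFunc ℝ) (x : ℝ) : value R x = R.num.eval x / R.denom.eval x := by
  simp [value, RatFunc.eval, eval₂_id]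

lemma eventually_eval_ne_zero {p : ℝ[X]} (hp : p ≠ 0) : ∀ᶠ x : ℝ in atTop, p.eval x ≠ 0 := by
  have := p.eventually_atTop_not_isRoot hp
  simpa [IsRoot] using this

/-- `value` evaluates the reduced fraction, so another representation agrees with it only where both
denominators are nonzero, hence for all large `x`. -/
lemma eventually_value_eq {R : RatFunc ℝ} {p q : ℝ[X]} (hq : q ≠ 0)
    (h : R = algebraMap ℝ[X] (RatFunc ℝ) p / algebraMap ℝ[X] (RatFunc ℝ) q) :
    ∀ᶠ x : ℝ in atTop, value R x = p.eval x / q.eval x := by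
  filter_upwards [eventually_eval_ne_zero hq, eventually_eval_ne_zero R.denom_ne_zero] with x h1 h2
  have h3 := congrArg (eval x) ((RatFunc.num_mul_eq_mul_denom_iff hq).2 h)
  rw [eval_mul, eval_mul] at h3
  rw [value_eq_div, div_eq_div_iff h2 h1, h3]

lemma eventually_value_sub_const (R : RatFunc ℝ) (a : ℝ) :
    ∀ᶠ x : ℝ in atTop, value (R - RatFunc.C a) x = value R x - a := by
  have h : R - RatFunc.C a = algebraMap ℝ[X] (RatFunc ℝ) (R.num - C a * R.denom) /
      algebraMap ℝ[X] (RatFunc ℝ) R.denom := by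
    have hd : algebraMap ℝ[X] (RatFunc ℝ) R.denom ≠ 0 :=
      RatFunc.algebraMap_ne_zero R.denom_ne_zero
    rw [map_sub, map_mul, RatFunc.algebraMap_C, sub_div, RatFunc.num_div_denom,
      mul_div_cancel_right₀ _ hd]
  filter_upwards [eventually_value_eq R.denom_ne_zero h,
    eventually_eval_ne_zero R.denom_ne_zero] with x h1 h2
  rw [h1, value_eq_div]
  simp only [eval_sub, eval_mul, eval_C]
  field_simp

lemma comp_sub_one_ne_zero {p : ℝ[X]} (hp : p ≠ 0) : p.comp (X - C 1) ≠ 0 := by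
  intro h
  rcases comp_eq_zero_iff.1 h with h | ⟨-, h⟩
  · exact hp h
  · have := congrArg natDegree h
    rw [natDegree_X_sub_C, natDegree_C] at this
    omega

lemma eventually_value_ratio {P : RatFunc ℝ} (hP : P ≠ 0) (Q : RatFunc ℝ) :
    ∀ᶠ x : ℝ in atTop, value (ratio P Q) x = value Q x / (value P x * value P (x - 1)) := by
  have hn : P.num ≠ 0 := RatFunc.num_ne_zero hP
  have hd := P.denom_ne_zero
  have hq : Q.denom * (P.num * P.num.comp (X - C 1)) ≠ 0 :=
    mul_ne_zero Q.denom_ne_zero (mul_ne_zero hn (comp_sub_one_ne_zero hn))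
  have h : ratio P Q = algebraMap ℝ[X] (RatFunc ℝ)
      (Q.num * (P.denom * P.denom.comp (X - C 1))) /
      algebraMap ℝ[X] (RatFunc ℝ) (Q.denom * (P.num * P.num.comp (X - C 1))) := by
    unfold ratio shiftBack
    conv_lhs => rw [← RatFunc.num_div_denom Q]
    have e : P = algebraMap ℝ[X] (RatFunc ℝ) P.num / algebraMap ℝ[X] (RatFunc ℝ) P.denom :=
      (RatFunc.num_div_denom P).symm
    conv_lhs => enter [2, 1]; rw [e]
    simp only [map_mul]
    have h1 := RatFunc.algebraMap_ne_zero hn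
    have h2 := RatFunc.algebraMap_ne_zero hd
    have h3 := RatFunc.algebraMap_ne_zero (comp_sub_one_ne_zero hn)
    have h4 := RatFunc.algebraMap_ne_zero (comp_sub_one_ne_zero hd)
    have h5 := RatFunc.algebraMap_ne_zero Q.denom_ne_zero
    field_simp
  filter_upwards [eventually_value_eq hq h, eventually_eval_ne_zero hn,
    eventually_eval_ne_zero hd, eventually_eval_ne_zero (comp_sub_one_ne_zero hn),
    eventually_eval_ne_zero (comp_sub_one_ne_zero hd),
    eventually_eval_ne_zero Q.denom_ne_zero] with x h1 h2 h3 h4 h5 h6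
  rw [h1, value_eq_div, value_eq_div, value_eq_div]
  simp only [eval_mul, eval_comp, eval_sub, eval_X, eval_C] at h4 h5 ⊢
  field_simp

/-- `F n ~ c n ^ δ` with `c ≠ 0`, and `F (n + 1) / F n = 1 + δ / n + O(n ^ (-2))`. -/
def RegularlyVarying (F : ℕ → ℝ) (δ : ℤ) : Prop :=
  (∃ c : ℝ, c ≠ 0 ∧ Tendsto (fun n : ℕ => F n / (n : ℝ) ^ δ) atTop (nhds c)) ∧
  (fun n : ℕ => F (n + 1) / F n - 1 - δ / n) =O[atTop] fun n : ℕ => ((n : ℝ) ^ 2)⁻¹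

lemma RegularlyVarying.congr {F G : ℕ → ℝ} {δ : ℤ} (hF : RegularlyVarying F δ)
    (h : ∀ᶠ n in atTop, F n = G n) : RegularlyVarying G δ := by
  obtain ⟨⟨c, hc, hlim⟩, hO⟩ := hF
  refine ⟨⟨c, hc, hlim.congr' (h.mono fun n hn => by rw [hn])⟩, ?_⟩
  refine hO.congr' ?_ EventuallyEq.rfl
  filter_upwards [h, (tendsto_add_atTop_nat 1).eventually h] with n h1 h2
  rw [h1, h2]

lemma RegularlyVarying.eventually_ne_zero {F : ℕ → ℝ} {δ : ℤ} (hF : RegularlyVarying F δ) :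
    ∀ᶠ n in atTop, F n ≠ 0 := by
  obtain ⟨⟨c, hc, hlim⟩, -⟩ := hF
  filter_upwards [hlim.eventually_ne hc] with n hn h0
  simp [h0] at hn

lemma tendsto_inv_natCast : Tendsto (fun n : ℕ => ((n : ℝ))⁻¹) atTop (nhds 0) :=
  tendsto_inv_atTop_zero.comp tendsto_natCast_real

lemma RegularlyVarying.tendsto_mul {F : ℕ → ℝ} {δ : ℤ} (hF : RegularlyVarying F δ) :
    Tendsto (fun n : ℕ => n * (F (n + 1) / F n - 1)) atTop (nhds δ) := by
  have h1 : (fun n : ℕ => n * (F (n + 1) / F n - 1 - δ / n)) =O[atTop]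
      fun n : ℕ => ((n : ℝ))⁻¹ := by
    refine ((isBigO_refl (fun n : ℕ => (n : ℝ)) atTop).mul hF.2).congr' EventuallyEq.rfl ?_
    filter_upwards [eventually_natCast_pos] with n hn
    field_simp
  have h2 := (h1.trans_tendsto tendsto_inv_natCast).add_const (δ : ℝ)
  rw [zero_add] at h2
  refine h2.congr' ?_
  filter_upwards [eventually_natCast_pos] with n hn
  field_simp
  ring

lemma RegularlyVarying.tendsto_one {F : ℕ → ℝ} {δ : ℤ} (hF : RegularlyVarying F δ) :
    Tendsto (fun n : ℕ => F (n + 1) / F n) atTop (nhds 1) := by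
  have h := (hF.tendsto_mul.mul tendsto_inv_natCast).add_const (1 : ℝ)
  rw [mul_zero, zero_add] at h
  refine h.congr' ?_
  filter_upwards [eventually_natCast_pos] with n hn
  field_simp
  ring

/-- With `A`, `B` the consecutive ratios of `F`, `G`, the error for `A / B` is `((A - 1 - δ / n) -
(B - 1 - ε / n) (1 + (δ - ε) / n) - (δ - ε) ε / n ^ 2) / B`. -/
lemma RegularlyVarying.div {F G : ℕ → ℝ} {δ ε : ℤ} (hF : RegularlyVarying F δ)
    (hG : RegularlyVarying G ε) : RegularlyVarying (fun n => F n / G n) (δ - ε) := by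
  refine ⟨?_, ?_⟩
  · obtain ⟨⟨c, hc, hlim⟩, -⟩ := hF
    obtain ⟨⟨c', hc', hlim'⟩, -⟩ := hG
    refine ⟨c / c', div_ne_zero hc hc', (hlim.div hlim' hc').congr' ?_⟩
    filter_upwards [eventually_natCast_pos] with n hn
    rw [Pi.div_apply, zpow_sub₀ hn.ne']
    field_simp
  · have hden : (fun n : ℕ => (G (n + 1) / G n)⁻¹) =O[atTop] fun _ => (1 : ℝ) :=
      (hG.tendsto_one.inv₀ one_ne_zero).isBigO_one ℝ
    have hinv : (fun n : ℕ => (1 : ℝ) + (δ - ε) / n) =O[atTop] fun _ => (1 : ℝ) := by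
      have h := (tendsto_inv_natCast.const_mul ((δ : ℝ) - ε)).const_add 1
      exact h.isBigO_one ℝ
    have h1 := hG.2.mul hinv
    have h2 : (fun n : ℕ => ((δ : ℝ) - ε) * ε * ((n : ℝ) ^ 2)⁻¹) =O[atTop]
        fun n : ℕ => ((n : ℝ) ^ 2)⁻¹ := isBigO_const_mul_self _ _ _
    have h3 := ((hF.2.sub (h1.congr_right fun n => mul_one _)).sub h2).mul hden
    refine h3.congr' ?_ (Eventually.of_forall fun n => mul_one _)
    filter_upwards [eventually_natCast_pos, hF.eventually_ne_zero, hG.eventually_ne_zero,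
      (tendsto_add_atTop_nat 1).eventually hF.eventually_ne_zero,
      (tendsto_add_atTop_nat 1).eventually hG.eventually_ne_zero] with n h0 h4 h5 h6 h7
    push_cast
    field_simp
    ring

lemma isBigO_pow_difference (i : ℕ) :
    (fun n : ℕ => (n : ℝ) * (((n : ℝ) + 1) ^ i - (n : ℝ) ^ i) - i * (n : ℝ) ^ i) =O[atTop]
      fun n : ℕ => (n : ℝ) ^ ((i : ℤ) - 1) := by
  induction i with
  | zero => simpa using isBigO_zero _ _
  | succ i ih =>
    have h1 : (fun n : ℕ => (n : ℝ) + 1) =O[atTop] fun n : ℕ => (n : ℝ) := by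
      refine (isBigO_refl _ _).add ?_
      refine IsBigO.of_bound 1 ?_
      filter_upwards [eventually_ge_atTop 1] with n hn
      simpa using hn
    have h2 := h1.mul ih
    have h3 : (fun n : ℕ => (i : ℝ) * (n : ℝ) ^ i) =O[atTop] fun n : ℕ => (n : ℝ) ^ i :=
      isBigO_const_mul_self _ _ _
    have h4 := (h2.congr' EventuallyEq.rfl (g₂ := fun n : ℕ => (n : ℝ) ^ i) (by
      filter_upwards [eventually_natCast_pos] with n hn
      rw [zpow_sub₀ hn.ne', zpow_natCast, zpow_one]
      field_simp)).add h3
    refine h4.congr (fun n => ?_) (fun n => ?_)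
    · push_cast
      ring
    · push_cast
      rw [add_sub_cancel_right, zpow_natCast]

lemma regularlyVarying_eval {p : ℝ[X]} (hp : p ≠ 0) :
    RegularlyVarying (fun n : ℕ => p.eval (n : ℝ)) p.natDegree := by
  have hlc : p.leadingCoeff ≠ 0 := leadingCoeff_ne_zero.2 hp
  have hlim : Tendsto (fun n : ℕ => p.eval (n : ℝ) / (n : ℝ) ^ (p.natDegree : ℤ)) atTop
      (nhds p.leadingCoeff) := by
    have h := (p.isEquivalent_atTop_lead).comp_tendsto tendsto_natCast_real
    have h2 := h.div (IsEquivalent.refl (u := fun n : ℕ => (n : ℝ) ^ p.natDegree))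
    have h3 : Tendsto (fun n : ℕ => (p.leadingCoeff * (n : ℝ) ^ p.natDegree) /
        (n : ℝ) ^ p.natDegree) atTop (nhds p.leadingCoeff) := by
      refine tendsto_const_nhds.congr' ?_
      filter_upwards [eventually_natCast_pos] with n hn
      field_simp
    exact (h2.symm.tendsto_nhds h3)
  refine ⟨⟨_, hlc, hlim⟩, ?_⟩
  have hnum : (fun n : ℕ => (n : ℝ) * (p.eval ((n : ℝ) + 1) - p.eval (n : ℝ)) -
      p.natDegree * p.eval (n : ℝ)) =O[atTop] fun n : ℕ => (n : ℝ) ^ ((p.natDegree : ℤ) - 1) := by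
    have e : (fun n : ℕ => (n : ℝ) * (p.eval ((n : ℝ) + 1) - p.eval (n : ℝ)) -
        p.natDegree * p.eval (n : ℝ)) = fun n : ℕ => ∑ i ∈ Finset.range (p.natDegree + 1),
        p.coeff i * (((n : ℝ) * (((n : ℝ) + 1) ^ i - (n : ℝ) ^ i) - i * (n : ℝ) ^ i) +
          ((i : ℝ) - p.natDegree) * (n : ℝ) ^ i) := by
      funext n
      rw [eval_eq_sum_range, eval_eq_sum_range, ← Finset.sum_sub_distrib, Finset.mul_sum,
        Finset.mul_sum, ← Finset.sum_sub_distrib]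
      exact Finset.sum_congr rfl fun i _ => by ring
    rw [e]
    refine IsBigO.fun_sum fun i hi => ?_
    have hi' : i ≤ p.natDegree := by simpa [Nat.lt_succ_iff] using hi
    have hmono : ∀ a b : ℤ, a ≤ b →
        (fun n : ℕ => (n : ℝ) ^ a) =O[atTop] fun n : ℕ => (n : ℝ) ^ b := fun a b hab => by
      refine IsBigO.of_bound 1 ?_
      filter_upwards [eventually_ge_atTop 1] with n hn
      have h1 : (1 : ℝ) ≤ n := by exact_mod_cast hn
      rw [one_mul, Real.norm_of_nonneg (by positivity), Real.norm_of_nonneg (by positivity)]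
      exact zpow_le_zpow_right₀ h1 hab
    refine IsBigO.const_mul_left (g := fun n : ℕ => (n : ℝ) ^ ((p.natDegree : ℤ) - 1))
      (IsBigO.add ?_ ?_) _
    · exact (isBigO_pow_difference i).trans (hmono _ _ (by omega))
    -- The factor `i - p.natDegree` kills the leading term; this cancellation gains one order.
    · rcases hi'.eq_or_lt with h | h
      · have e2 : (fun n : ℕ => ((i : ℝ) - p.natDegree) * (n : ℝ) ^ i) = fun _ => 0 := by
          funext n
          rw [h]
          ring
        rw [e2]
        exact isBigO_zero _ _
      · refine IsBigO.const_mul_left ?_ _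
        exact (hmono i _ (by omega)).congr_left fun n => by simp
  have hinv : (fun n : ℕ => (p.eval (n : ℝ) / (n : ℝ) ^ (p.natDegree : ℤ))⁻¹) =O[atTop]
      fun _ => (1 : ℝ) := (hlim.inv₀ hlc).isBigO_one ℝ
  have h0 : ∀ᶠ n : ℕ in atTop, p.eval (n : ℝ) ≠ 0 :=
    tendsto_natCast_real.eventually (eventually_eval_ne_zero hp)
  have h1 := (hnum.mul hinv).mul
    (isBigO_refl (fun n : ℕ => ((n : ℝ) ^ ((p.natDegree : ℤ) + 1))⁻¹) atTop)
  refine h1.congr' ?_ ?_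
  · filter_upwards [eventually_natCast_pos, h0] with n hn h0
    rw [zpow_add₀ hn.ne', zpow_natCast, zpow_one]
    push_cast
    field_simp
  · filter_upwards [eventually_natCast_pos] with n hn
    rw [zpow_add₀ hn.ne', zpow_sub₀ hn.ne', zpow_natCast, zpow_one]
    field_simp

lemma regularlyVarying_value {R : RatFunc ℝ} (hR : R ≠ 0) :
    RegularlyVarying (fun n : ℕ => value R (n : ℝ)) R.intDegree := by
  have h := (regularlyVarying_eval (RatFunc.num_ne_zero hR)).div
    (regularlyVarying_eval R.denom_ne_zero)
  exact h.congr (Eventually.of_forall fun n => (value_eq_div R n).symm)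

/-! ### Consequences of the expansion at infinity -/

lemma HasExpansion.bound {R : RatFunc ℝ} {a b c : ℝ} (h : HasExpansion R a b c) :
    ∃ K : ℝ, 0 < K ∧ ∀ᶠ n : ℕ in atTop,
      |value R n - (a + b / n + c / (n : ℝ) ^ 2)| ≤ K / (n : ℝ) ^ 3 := by
  obtain ⟨K, hK, hb⟩ := IsBigO.exists_pos h
  refine ⟨K, hK, ?_⟩
  filter_upwards [tendsto_natCast_real.eventually hb.bound, eventually_natCast_pos] with n hn h0
  rw [Real.norm_eq_abs, Real.norm_of_nonneg (by positivity)] at hn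
  refine hn.trans (le_of_eq ?_)
  rw [zpow_neg, div_eq_mul_inv]
  norm_cast

lemma HasExpansion.tendsto_scaled {R : RatFunc ℝ} {a b c : ℝ} (h : HasExpansion R a b c) :
    Tendsto (fun n : ℕ => (n : ℝ) ^ 2 * (value R n - a - b / n)) atTop (nhds c) := by
  obtain ⟨K, hK, hb⟩ := h.bound
  rw [tendsto_iff_dist_tendsto_zero]
  have hlim : Tendsto (fun n : ℕ => K * (n : ℝ)⁻¹) atTop (nhds 0) := by
    simpa using tendsto_inv_natCast.const_mul K
  refine squeeze_zero' (Eventually.of_forall fun n => dist_nonneg) ?_ hlim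
  filter_upwards [hb, eventually_natCast_pos] with n hn h0
  rw [Real.dist_eq]
  have e : (n : ℝ) ^ 2 * (value R n - a - b / n) - c =
      (n : ℝ) ^ 2 * (value R n - (a + b / n + c / (n : ℝ) ^ 2)) := by
    field_simp; ring
  rw [e, abs_mul, abs_of_pos (by positivity)]
  calc (n : ℝ) ^ 2 * |value R n - (a + b / n + c / (n : ℝ) ^ 2)|
      ≤ (n : ℝ) ^ 2 * (K / (n : ℝ) ^ 3) := by gcongr
    _ = K * (n : ℝ)⁻¹ := by field_simp

lemma HasExpansion.tendsto_mul {R : RatFunc ℝ} {a b c : ℝ} (h : HasExpansion R a b c) :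
    Tendsto (fun n : ℕ => (n : ℝ) * (value R n - a)) atTop (nhds b) := by
  have h1 := (h.tendsto_scaled.mul tendsto_inv_natCast).add_const b
  rw [mul_zero, zero_add] at h1
  refine h1.congr' ?_
  filter_upwards [eventually_natCast_pos] with n h0
  field_simp
  ring

lemma HasExpansion.tendsto {R : RatFunc ℝ} {a b c : ℝ} (h : HasExpansion R a b c) :
    Tendsto (fun n : ℕ => value R n) atTop (nhds a) := by
  have h1 := (h.tendsto_mul.mul tendsto_inv_natCast).add_const a
  rw [mul_zero, zero_add] at h1
  refine h1.congr' ?_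
  filter_upwards [eventually_natCast_pos] with n h0
  field_simp
  ring

lemma lexBound_iff (a b c : ℝ) : LexBound a b c ↔
    -1 / 4 < a ∨ a = -1 / 4 ∧ (0 < b ∨ b = 0 ∧ -1 / 16 ≤ c) := by
  unfold LexBound
  rw [Prod.Lex.le_iff]
  simp only [ofLex_toLex]
  rw [Prod.Lex.le_iff]
  simp only [ofLex_toLex]
  tauto

lemma HasExpansion.hyperbolic_bound {R : RatFunc ℝ} {a b c : ℝ} (h : HasExpansion R a b c)
    (hl : LexBound a b c) : ∃ K : ℝ, 0 < K ∧ ∀ᶠ n : ℕ in atTop,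
      - value R n ≤ 1 / 4 + 1 / (16 * (n : ℝ) ^ 2) + K / (n : ℝ) ^ 3 := by
  rw [lexBound_iff] at hl
  rcases hl with hl | ⟨rfl, hl | ⟨rfl, hl⟩⟩
  · refine ⟨1, one_pos, ?_⟩
    filter_upwards [h.tendsto.eventually_const_lt hl, eventually_natCast_pos] with n hn h0
    have h1 : 0 ≤ 1 / (16 * (n : ℝ) ^ 2) := by positivity
    have h2 : 0 ≤ 1 / (n : ℝ) ^ 3 := by positivity
    linarith
  · refine ⟨1, one_pos, ?_⟩
    filter_upwards [h.tendsto_mul.eventually_const_lt hl, eventually_natCast_pos] with n hn h0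
    have h1 : 0 ≤ 1 / (16 * (n : ℝ) ^ 2) := by positivity
    have h2 : 0 ≤ 1 / (n : ℝ) ^ 3 := by positivity
    have h3 := pos_of_mul_pos_right hn h0.le
    linarith
  · obtain ⟨K, hK, hb⟩ := h.bound
    refine ⟨K, hK, ?_⟩
    filter_upwards [hb, eventually_natCast_pos] with n hn h0
    have h1 := (abs_le.1 hn).1
    have h2 : -1 / 16 / (n : ℝ) ^ 2 ≤ c / (n : ℝ) ^ 2 := by gcongr
    have h3 : -1 / 16 / (n : ℝ) ^ 2 = - (1 / (16 * (n : ℝ) ^ 2)) := by field_simp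
    rw [h3] at h2
    rw [zero_div] at h1
    linarith

/-- Shifting `n` by `b` raises `1 / (16 n ^ 2)` by about `(2 b - 1) / (16 n ^ 3)`, so a large `b`
absorbs `K / n ^ 3`. -/
lemma exists_shift_bound (K : ℝ) : ∃ b : ℝ, ∀ᶠ n : ℕ in atTop,
    1 / 4 + 1 / (16 * (n : ℝ) ^ 2) + K / (n : ℝ) ^ 3 ≤
      1 / 4 + 1 / (16 * (((n : ℝ) - b) * ((n : ℝ) - b + 1))) := by
  obtain ⟨b, hb⟩ : ∃ b : ℝ, b = 8 * |K| + 2 := ⟨_, rfl⟩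
  have hb0 : 2 ≤ b := by linarith [abs_nonneg K]
  refine ⟨b, ?_⟩
  filter_upwards [tendsto_natCast_real.eventually_gt_atTop (b * b + b + 16 * |K| * b)] with n hn
  have hK := abs_nonneg K
  have hKb : 0 ≤ 16 * |K| * b := by positivity
  have hbb : 0 ≤ b * b := by positivity
  have h0 : (0 : ℝ) < n := by linarith
  have h1 : 0 < (n : ℝ) - b := by linarith
  have h2 : 0 < (n : ℝ) - b + 1 := by linarith
  have h3 : K / (n : ℝ) ^ 3 ≤ |K| / (n : ℝ) ^ 3 := by gcongr; exact le_abs_self K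
  have h4 : 1 / (16 * (n : ℝ) ^ 2) + |K| / (n : ℝ) ^ 3 ≤
      1 / (16 * (((n : ℝ) - b) * ((n : ℝ) - b + 1))) := by
    rw [div_add_div _ _ (by positivity) (by positivity), div_le_div_iff₀ (by positivity)
      (by positivity)]
    obtain ⟨k, hk⟩ : ∃ k, k = |K| := ⟨_, rfl⟩
    rw [← hk] at hn hK hb hKb ⊢
    have e : (16 * (n : ℝ) ^ 2 * (n : ℝ) ^ 3) - ((n : ℝ) ^ 3 + 16 * (n : ℝ) ^ 2 * k) *
        (16 * (((n : ℝ) - b) * ((n : ℝ) - b + 1))) = 16 * (n : ℝ) ^ 2 *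
        ((2 * b - 1 - 16 * k) * (n : ℝ) ^ 2 - (b * (b - 1) - 16 * k * (2 * b - 1)) * n
          - 16 * k * (b * (b - 1))) := by ring
    -- The choice of `b` makes the leading coefficient of the difference equal to 3, which dominates
    -- the lower terms for large `n`.
    have e2 : 2 * b - 1 - 16 * k = 3 := by rw [hb]; ring
    rw [e2] at e
    have h5 : 0 ≤ (3 * (n : ℝ) ^ 2 - (b * (b - 1) - 16 * k * (2 * b - 1)) * n
          - 16 * k * (b * (b - 1))) := by
      have h6 : b * (b - 1) ≤ n := by nlinarith
      have h7 : 16 * k * (b * (b - 1)) ≤ n * n := by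
        have : b * (b - 1) * (16 * k) ≤ n * n := by
          apply mul_le_mul h6 _ (by positivity) h0.le
          nlinarith
        linarith
      have h8 : b * (b - 1) * n ≤ n * n := mul_le_mul_of_nonneg_right h6 h0.le
      have h9 : 0 ≤ 16 * k * (2 * b - 1) * n :=
        mul_nonneg (mul_nonneg (by positivity) (by linarith)) h0.le
      nlinarith
    have h10 : 0 ≤ 16 * (n : ℝ) ^ 2 *
        ((3 * (n : ℝ) ^ 2 - (b * (b - 1) - 16 * k * (2 * b - 1)) * n
          - 16 * k * (b * (b - 1)))) := mul_nonneg (by positivity) h5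
    linarith
  linarith

/-! ### Phases -/

/-- `φ` is a phase of the nonzero vector `(x, y)`. -/
def HasPhase (x y φ : ℝ) : Prop :=
  ∃ ρ : ℝ, 0 < ρ ∧ x = ρ * Real.cos φ ∧ y = ρ * Real.sin φ

lemma HasPhase.sign_eq {x y φ : ℝ} (h : HasPhase x y φ) :
    SignType.sign y = SignType.sign (Real.sin φ) := by
  obtain ⟨ρ, hρ, -, rfl⟩ := h
  exact sign_pos_mul hρ

lemma HasPhase.sq_add_sq_pos {x y φ : ℝ} (h : HasPhase x y φ) : 0 < x ^ 2 + y ^ 2 := by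
  obtain ⟨ρ, hρ, rfl, rfl⟩ := h
  have : (ρ * Real.cos φ) ^ 2 + (ρ * Real.sin φ) ^ 2 = ρ ^ 2 := by
    linear_combination ρ ^ 2 * Real.cos_sq_add_sin_sq φ
  rw [this]
  positivity

lemma exists_hasPhase {x y : ℝ} (h : x ≠ 0 ∨ y ≠ 0) : ∃ φ, HasPhase x y φ := by
  have hz : (⟨x, y⟩ : ℂ) ≠ 0 := by
    intro h0
    have h1 := congrArg Complex.re h0
    have h2 := congrArg Complex.im h0
    simp only [Complex.zero_re, Complex.zero_im] at h1 h2
    tauto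
  exact ⟨Complex.arg ⟨x, y⟩, ‖(⟨x, y⟩ : ℂ)‖, norm_pos_iff.2 hz,
    (Complex.norm_mul_cos_arg ⟨x, y⟩).symm, (Complex.norm_mul_sin_arg ⟨x, y⟩).symm⟩

/-- The product of `x' + i y'` with the conjugate of `x + i y` has positive real part, so its
argument is the arctangent of the quotient of its parts. -/
lemma HasPhase.add_arctan {x y φ x' y' : ℝ} (h : HasPhase x y φ) (hre : 0 < x' * x + y' * y) :
    HasPhase x' y' (φ + Real.arctan ((y' * x - x' * y) / (x' * x + y' * y))) := by
  have hn := h.sq_add_sq_pos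
  obtain ⟨ρ, hρ, hx, hy⟩ := h
  obtain ⟨a, ha⟩ : ∃ a, a = x' * x + y' * y := ⟨_, rfl⟩
  obtain ⟨b, hb⟩ : ∃ b, b = y' * x - x' * y := ⟨_, rfl⟩
  rw [← ha, ← hb]
  rw [← ha] at hre
  have hc := Real.cos_arctan_pos (b / a)
  have ht := Real.tan_arctan (b / a)
  obtain ⟨δ, hδ⟩ : ∃ δ, δ = Real.arctan (b / a) := ⟨_, rfl⟩
  rw [← hδ] at hc ht ⊢
  rw [Real.tan_eq_sin_div_cos] at ht
  have hs : a * Real.sin δ = b * Real.cos δ := by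
    field_simp at ht
    linarith
  have hxe : x' * (x ^ 2 + y ^ 2) = x * a - y * b := by rw [ha, hb]; ring
  have hye : y' * (x ^ 2 + y ^ 2) = y * a + x * b := by rw [ha, hb]; ring
  refine ⟨ρ * a / ((x ^ 2 + y ^ 2) * Real.cos δ), by positivity, ?_, ?_⟩
  · rw [Real.cos_add, div_mul_eq_mul_div, eq_div_iff (by positivity)]
    linear_combination Real.cos δ * hxe + a * Real.cos δ * hx + ρ * Real.sin φ * hs
      - b * Real.cos δ * hy
  · rw [Real.sin_add, div_mul_eq_mul_div, eq_div_iff (by positivity)]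
    linear_combination Real.cos δ * hye + a * Real.cos δ * hy - ρ * Real.cos φ * hs
      + b * Real.cos δ * hx

lemma arctan_le_self {x : ℝ} (hx : 0 ≤ x) : Real.arctan x ≤ x := by
  by_contra! h
  have h1 := Real.lt_tan (lt_of_le_of_lt hx h) (Real.arctan_lt_pi_div_two x)
  rw [Real.tan_arctan] at h1
  linarith

lemma abs_arctan_le (x : ℝ) : |Real.arctan x| ≤ |x| := by
  rcases le_total 0 x with h | h
  · rw [abs_of_nonneg h, abs_of_nonneg (Real.arctan_nonneg.2 h)]
    exact arctan_le_self h
  · have := arctan_le_self (neg_nonneg.2 h)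
    rw [Real.arctan_neg] at this
    rw [abs_of_nonpos h, abs_of_nonpos (by simpa using h)]
    exact this

lemma half_le_arctan {x : ℝ} (h0 : 0 ≤ x) (h1 : x ≤ 1) : x / 2 ≤ Real.arctan x := by
  have hmono : MonotoneOn (fun x => Real.arctan x - x / 2) (Set.Icc 0 1) := by
    refine monotoneOn_of_deriv_nonneg (convex_Icc 0 1) (by fun_prop)
      (Real.differentiable_arctan.sub (differentiable_id.div_const 2)).differentiableOn ?_
    intro x hx
    rw [interior_Icc] at hx
    have hd : HasDerivAt (fun x => Real.arctan x - x / 2) (1 / (1 + x ^ 2) - 1 / 2) x :=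
      (Real.hasDerivAt_arctan x).sub ((hasDerivAt_id x).div_const 2)
    rw [hd.deriv, sub_nonneg]
    apply one_div_le_one_div_of_le (by positivity)
    nlinarith [hx.1, hx.2]
  have := hmono (Set.left_mem_Icc.2 zero_le_one) ⟨h0, h1⟩ h0
  simp at this
  linarith

/-- The map is multiplication by `1 / 2 + i ω`, of argument `arctan (2 ω)`, followed by stretching
the second coordinate by `t`. Writing `(u, v)` for the rotated vector, the stretch turns it by
`arctan ((t - 1) u v / (u ^ 2 + t v ^ 2))`, and `u ^ 2 + t v ^ 2 ≥ 2 √t |u v|`. -/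
lemma HasPhase.elliptic_step {x y φ : ℝ} (h : HasPhase x y φ) (ω : ℝ) {t : ℝ} (ht : 0 < t) :
    ∃ φ', HasPhase (x / 2 - ω * y) (t * (ω * x + y / 2)) φ' ∧
      |φ' - φ - Real.arctan (2 * ω)| ≤ |t - 1| / (2 * √t) := by
  have hn := h.sq_add_sq_pos
  have h1 : HasPhase (x / 2 - ω * y) (ω * x + y / 2) (φ + Real.arctan (2 * ω)) := by
    have e1 : (x / 2 - ω * y) * x + (ω * x + y / 2) * y = (x ^ 2 + y ^ 2) / 2 := by ring
    have e2 : (ω * x + y / 2) * x - (x / 2 - ω * y) * y = ω * (x ^ 2 + y ^ 2) := by ring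
    have := h.add_arctan (x' := x / 2 - ω * y) (y' := ω * x + y / 2) (by rw [e1]; positivity)
    rw [e1, e2] at this
    convert this using 3
    field_simp
  have hn1 := h1.sq_add_sq_pos
  generalize x / 2 - ω * y = u at *
  generalize ω * x + y / 2 = v at *
  have hst : 0 < √t := Real.sqrt_pos.2 ht
  have hss : √t * √t = t := Real.mul_self_sqrt ht.le
  have hden : 0 < u ^ 2 + t * v ^ 2 := by
    rcases eq_or_ne v 0 with hv | hv
    · rw [hv] at hn1 ⊢
      simpa using hn1
    · positivity
  refine ⟨_, h1.add_arctan (x' := u) (y' := t * v) (by linarith), ?_⟩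
  have e1 : u * u + t * v * v = u ^ 2 + t * v ^ 2 := by ring
  have e2 : t * v * u - u * v = (t - 1) * (u * v) := by ring
  rw [e1, e2]
  have e3 : φ + Real.arctan (2 * ω) + Real.arctan ((t - 1) * (u * v) / (u ^ 2 + t * v ^ 2)) - φ -
      Real.arctan (2 * ω) = Real.arctan ((t - 1) * (u * v) / (u ^ 2 + t * v ^ 2)) := by ring
  rw [e3]
  refine (abs_arctan_le _).trans ?_
  rw [abs_div, abs_mul, abs_of_pos hden, div_le_div_iff₀ hden (by positivity), mul_assoc]
  refine mul_le_mul_of_nonneg_left ?_ (abs_nonneg _)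
  rw [abs_mul]
  have h2 := sq_nonneg (|u| - √t * |v|)
  have h3 := sq_abs u
  have h4 := sq_abs v
  nlinarith

/-- A quarter turn followed by a shear, which turns the vector back by `arctan (η C ^ 2 / (1 - η C
S))` with `C = cos φ`, `S = sin φ`. The loss vanishes when `C = 0`, so a single step gives only a
weak inequality. -/
lemma HasPhase.shear_step {x y φ : ℝ} (h : HasPhase x y φ) {η : ℝ} (h0 : 0 < η) (h1 : η ≤ 1 / 2) :
    ∃ φ', HasPhase (η * x - y) x φ' ∧ η * Real.cos φ ^ 2 / 3 ≤ φ + Real.pi / 2 - φ' ∧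
      φ + Real.pi / 2 - φ' ≤ 2 * η := by
  obtain ⟨ρ, hρ, hx, hy⟩ := h
  have hrot : HasPhase (-y) x (φ + Real.pi / 2) := by
    refine ⟨ρ, hρ, ?_, ?_⟩
    · rw [Real.cos_add_pi_div_two, hy]; ring
    · rw [Real.sin_add_pi_div_two, hx]
  have hs := Real.cos_sq_add_sin_sq φ
  obtain ⟨C, hC⟩ : ∃ C, C = Real.cos φ := ⟨_, rfl⟩
  obtain ⟨S, hS⟩ : ∃ S, S = Real.sin φ := ⟨_, rfl⟩
  rw [← hC] at hx ⊢
  rw [← hS] at hy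
  rw [← hC, ← hS] at hs
  have hab1 : C * S ≤ 1 / 2 := by nlinarith [sq_nonneg (C - S)]
  have hab2 : -(1 / 2) ≤ C * S := by nlinarith [sq_nonneg (C + S)]
  have hq1 : 1 - η * (C * S) ≤ 3 / 2 := by nlinarith
  have hq2 : 1 / 2 ≤ 1 - η * (C * S) := by nlinarith
  have e1 : (η * x - y) * -y + x * x = ρ ^ 2 * (1 - η * (C * S)) := by
    rw [hx, hy]; linear_combination ρ ^ 2 * hs
  have e2 : x * -y - (η * x - y) * x = - (ρ ^ 2 * (η * C ^ 2)) := by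
    rw [hx, hy]; ring
  refine ⟨_, hrot.add_arctan (x' := η * x - y) (y' := x) (by rw [e1]; positivity), ?_⟩
  rw [e1, e2, neg_div, Real.arctan_neg, mul_div_mul_left _ _ (by positivity)]
  have hu0 : 0 ≤ η * C ^ 2 / (1 - η * (C * S)) := by positivity
  have hC1 : C ^ 2 ≤ 1 := by nlinarith [sq_nonneg S]
  have hηC : η * C ^ 2 ≤ η := by nlinarith
  have hu1 : η * C ^ 2 / (1 - η * (C * S)) ≤ 2 * η := by
    rw [div_le_iff₀ (by linarith)]
    nlinarith
  have hu2 : η * C ^ 2 * (2 / 3) ≤ η * C ^ 2 / (1 - η * (C * S)) := by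
    rw [le_div_iff₀ (by linarith)]
    have : 0 ≤ η * C ^ 2 := by positivity
    nlinarith
  -- The denominator lies in `[1 / 2, 3 / 2]`, so the argument of `arctan` is at least `2 / 3 * η C
  -- ^ 2` and at most `2 η ≤ 1`, where `arctan x ≥ x / 2`.
  have h2 := half_le_arctan hu0 (by linarith)
  have h3 := arctan_le_self hu0
  constructor <;> linarith

/-- Dependent choice with an invariant `I` and a step relation `r`; it selects the phases
consistently, each being determined only modulo `2 π`. -/
lemma exists_seq_from {A : Type*} (N : ℕ) (a : A) (r : ℕ → A → A → Prop) (I : ℕ → A → Prop)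
    (h0 : I N a) (hstep : ∀ n, N ≤ n → ∀ x, I n x → ∃ y, I (n + 1) y ∧ r n x y) :
    ∃ u : ℕ → A, u N = a ∧ ∀ n, N ≤ n → I n (u n) ∧ r n (u n) (u (n + 1)) := by
  classical
  choose! f hf using hstep
  let u : ℕ → A := fun n => Nat.rec a (fun m x => f (N + m) x) (n - N)
  have hu0 : u N = a := by simp [u]
  have hus : ∀ n, N ≤ n → u (n + 1) = f n (u n) := by
    intro n hn
    obtain ⟨m, rfl⟩ := Nat.exists_eq_add_of_le hn
    have e1 : N + m + 1 - N = m + 1 := by omega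
    have e2 : N + m - N = m := by omega
    simp only [u, e1, e2]
  have hI : ∀ n, N ≤ n → I n (u n) := by
    intro n hn
    induction n, hn using Nat.le_induction with
    | base => rwa [hu0]
    | succ n hn ih => rw [hus n hn]; exact (hf n hn _ ih).1
  exact ⟨u, hu0, fun n hn => ⟨hI n hn, by rw [hus n hn]; exact (hf n hn _ (hI n hn)).2⟩⟩

/-- Each solution `g` of `g (n + 2) = g (n + 1) + R n * g n` (`n ≥ N`) with nonzero initial
vector satisfies `sgn g n = sgn sin (n θ π + ψ n)` for `n ≥ N`, where `ψ` has the property `C`,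
and every value of `ψ N` occurs. -/
def HasPhases (R : ℕ → ℝ) (N : ℕ) (θ : ℝ) (C : (ℕ → ℝ) → Prop) : Prop :=
  (∀ g : ℕ → ℝ, (∀ n, N ≤ n → g (n + 2) = g (n + 1) + R n * g n) → (g N ≠ 0 ∨ g (N + 1) ≠ 0) →
    ∃ ψ : ℕ → ℝ, (∀ n : ℕ, N ≤ n → SignType.sign (g n) =
      SignType.sign (Real.sin (n * (θ * Real.pi) + ψ n))) ∧ C ψ) ∧
  ∀ α : ℝ, ∃ g : ℕ → ℝ, (∀ n, N ≤ n → g (n + 2) = g (n + 1) + R n * g n) ∧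
    (g N ≠ 0 ∨ g (N + 1) ≠ 0) ∧ ∃ ψ : ℕ → ℝ, ψ N = α ∧
    (∀ n : ℕ, N ≤ n → SignType.sign (g n) =
      SignType.sign (Real.sin (n * (θ * Real.pi) + ψ n))) ∧ C ψ

lemma HasPhases.mono {R : ℕ → ℝ} {N : ℕ} {θ : ℝ} {C C' : (ℕ → ℝ) → Prop}
    (h : HasPhases R N θ C) (hC : ∀ ψ, C ψ → C' ψ) : HasPhases R N θ C' := by
  refine ⟨fun g hg hne => ?_, fun α => ?_⟩
  · obtain ⟨ψ, h1, h2⟩ := h.1 g hg hne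
    exact ⟨ψ, h1, hC ψ h2⟩
  · obtain ⟨g, hg, hne, ψ, h0, h1, h2⟩ := h.2 α
    exact ⟨g, hg, hne, ψ, h0, h1, hC ψ h2⟩

/-- The argument of the roots of `x ^ 2 - x - r`. -/
def rootArg (r : ℝ) : ℝ := Real.arctan (2 * √(-r - 1 / 4))

/-- The stretch factor between consecutive phases. -/
def stretch (R : ℕ → ℝ) (n : ℕ) : ℝ := √(-R (n + 1) - 1 / 4) / √(-R n - 1 / 4)

/-- The phase is that of `(g (n + 1) - g n / 2, ω n * g n)` with `ω n = √(-R n - 1 / 4)`. In these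
coordinates the recurrence is multiplication by the root `1 / 2 + i ω n`, then a rescaling of the
second coordinate by `ω (n + 1) / ω n`. -/
lemma hasPhases_elliptic {R : ℕ → ℝ} {N : ℕ} (hR : ∀ n, N ≤ n → R n < -1 / 4) (θ : ℝ) :
    HasPhases R N θ fun ψ => ∀ n, N ≤ n →
      |ψ (n + 1) - ψ n - (rootArg (R n) - θ * Real.pi)| ≤
        |stretch R n - 1| / (2 * √(stretch R n)) := by
  obtain ⟨ω, hω⟩ : ∃ ω : ℕ → ℝ, ω = fun n => √(-R n - 1 / 4) := ⟨_, rfl⟩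
  have hωpos : ∀ n, N ≤ n → 0 < ω n := fun n hn => by
    rw [hω]
    exact Real.sqrt_pos.2 (by linarith [hR n hn])
  have hωsq : ∀ n, N ≤ n → ω n * ω n = -R n - 1 / 4 := fun n hn => by
    rw [hω]
    exact Real.mul_self_sqrt (by linarith [hR n hn])
  have hstr : ∀ n, stretch R n = ω (n + 1) / ω n := fun n => by rw [hω]; rfl
  have hroot : ∀ n, rootArg (R n) = Real.arctan (2 * ω n) := fun n => by rw [hω]; rfl
  have key : ∀ g : ℕ → ℝ, (∀ n, N ≤ n → g (n + 2) = g (n + 1) + R n * g n) → ∀ α : ℝ,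
      HasPhase (g (N + 1) - g N / 2) (ω N * g N) (N * (θ * Real.pi) + α) →
      ∃ ψ : ℕ → ℝ, ψ N = α ∧ (∀ n : ℕ, N ≤ n → SignType.sign (g n) =
      SignType.sign (Real.sin (n * (θ * Real.pi) + ψ n))) ∧ ∀ n, N ≤ n →
      |ψ (n + 1) - ψ n - (rootArg (R n) - θ * Real.pi)| ≤
        |stretch R n - 1| / (2 * √(stretch R n)) := by
    intro g hg α hα
    obtain ⟨ψ, h0, hψ⟩ := exists_seq_from N α
      (fun n x y => |y - x - (rootArg (R n) - θ * Real.pi)| ≤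
        |stretch R n - 1| / (2 * √(stretch R n)))
      (fun n x => HasPhase (g (n + 1) - g n / 2) (ω n * g n) (n * (θ * Real.pi) + x)) hα
      (fun n hn x hx => by
        have h1 := hωpos n hn
        have h2 := hωpos (n + 1) (by omega)
        obtain ⟨φ', hφ', hb⟩ := hx.elliptic_step (ω n) (t := stretch R n)
          (by rw [hstr]; positivity)
        have e1 : (g (n + 1) - g n / 2) / 2 - ω n * (ω n * g n) =
            g (n + 1 + 1) - g (n + 1) / 2 := by
          rw [hg n hn]
          linear_combination - g n * hωsq n hn
        have e2 : stretch R n * (ω n * (g (n + 1) - g n / 2) + ω n * g n / 2) =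
            ω (n + 1) * g (n + 1) := by
          rw [hstr]
          field_simp
          ring
        rw [e1, e2] at hφ'
        refine ⟨φ' - (n + 1 : ℕ) * (θ * Real.pi), by simpa using hφ', ?_⟩
        rw [hroot]
        convert hb using 2
        push_cast
        ring)
    refine ⟨ψ, h0, fun n hn => ?_, fun n hn => (hψ n hn).2⟩
    rw [← (hψ n hn).1.sign_eq, sign_pos_mul (hωpos n hn)]
  have hN := hωpos N le_rfl
  refine ⟨fun g hg hne => ?_, fun α => ?_⟩
  · obtain ⟨φ, hφ⟩ : ∃ φ, HasPhase (g (N + 1) - g N / 2) (ω N * g N) φ := by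
      apply exists_hasPhase
      by_contra! hc
      have h1 : g N = 0 := (mul_eq_zero.1 hc.2).resolve_left hN.ne'
      have h2 : g (N + 1) = 0 := by simpa [h1] using hc.1
      tauto
    obtain ⟨ψ, -, h1, h2⟩ := key g hg (φ - N * (θ * Real.pi)) (by simpa using hφ)
    exact ⟨ψ, h1, h2⟩
  · obtain ⟨φ, hφ⟩ : ∃ φ, φ = N * (θ * Real.pi) + α := ⟨_, rfl⟩
    obtain ⟨g, g0, g1, hg⟩ := exists_recurrence_from (fun _ => 1) R N (Real.sin φ / ω N)
      (Real.cos φ + Real.sin φ / ω N / 2)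
    simp only [one_mul] at hg
    have hph : HasPhase (g (N + 1) - g N / 2) (ω N * g N) (N * (θ * Real.pi) + α) := by
      refine ⟨1, one_pos, ?_, ?_⟩
      · rw [g0, g1, hφ]; ring
      · rw [g0, hφ]; field_simp
    refine ⟨g, hg, ?_, key g hg α hph⟩
    have := hph.sq_add_sq_pos
    by_contra! hc
    rw [hc.1, hc.2] at this
    norm_num at this

/-- The phase is that of `(g (n + 1) / p (n + 1), g n / p n)`; since `p (n + 2) = -R n * p n`, a
step sends `(x, y)` to `(η x - y, x)` with `η = p (n + 1) / p (n + 2)`. -/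
lemma hasPhases_shear {R p : ℕ → ℝ} {N : ℕ} (hp : ∀ n, N ≤ n → 0 < p n)
    (hrec : ∀ n, N ≤ n → p (n + 2) = -R n * p n)
    (hη : ∀ n, N ≤ n → p (n + 1) / p (n + 2) ≤ 1 / 2) :
    HasPhases R N (1 / 2) fun ψ => ∀ n, N ≤ n →
      p (n + 1) / p (n + 2) * Real.cos (n * (1 / 2 * Real.pi) + ψ n) ^ 2 / 3 ≤ ψ n - ψ (n + 1) ∧
      ψ n - ψ (n + 1) ≤ 2 * (p (n + 1) / p (n + 2)) := by
  have key : ∀ g : ℕ → ℝ, (∀ n, N ≤ n → g (n + 2) = g (n + 1) + R n * g n) → ∀ α : ℝ,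
      HasPhase (g (N + 1) / p (N + 1)) (g N / p N) (N * (1 / 2 * Real.pi) + α) →
      ∃ ψ : ℕ → ℝ, ψ N = α ∧ (∀ n : ℕ, N ≤ n → SignType.sign (g n) =
      SignType.sign (Real.sin (n * (1 / 2 * Real.pi) + ψ n))) ∧ ∀ n, N ≤ n →
      p (n + 1) / p (n + 2) * Real.cos (n * (1 / 2 * Real.pi) + ψ n) ^ 2 / 3 ≤ ψ n - ψ (n + 1) ∧
      ψ n - ψ (n + 1) ≤ 2 * (p (n + 1) / p (n + 2)) := by
    intro g hg α hα
    obtain ⟨ψ, h0, hψ⟩ := exists_seq_from N α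
      (fun n x y => p (n + 1) / p (n + 2) * Real.cos (n * (1 / 2 * Real.pi) + x) ^ 2 / 3 ≤ x - y ∧
        x - y ≤ 2 * (p (n + 1) / p (n + 2)))
      (fun n x => HasPhase (g (n + 1) / p (n + 1)) (g n / p n) (n * (1 / 2 * Real.pi) + x)) hα
      (fun n hn x hx => by
        have h1 := hp n hn
        have h2 := hp (n + 1) (by omega)
        have h3 := hp (n + 2) (by omega)
        obtain ⟨φ', hφ', hb⟩ := hx.shear_step (η := p (n + 1) / p (n + 2)) (by positivity)
          (hη n hn)
        have e1 : p (n + 1) / p (n + 2) * (g (n + 1) / p (n + 1)) - g n / p n =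
            g (n + 1 + 1) / p (n + 1 + 1) := by
          have h4 : p (n + 1 + 1) = p (n + 2) := rfl
          rw [hg n hn, h4]
          field_simp
          rw [hrec n hn]
          ring
        rw [e1] at hφ'
        refine ⟨φ' - (n + 1 : ℕ) * (1 / 2 * Real.pi), by simpa using hφ', ?_⟩
        have e2 : x - (φ' - (n + 1 : ℕ) * (1 / 2 * Real.pi)) =
            n * (1 / 2 * Real.pi) + x + Real.pi / 2 - φ' := by
          push_cast
          ring
        rw [e2]
        exact hb)
    refine ⟨ψ, h0, fun n hn => ?_, fun n hn => (hψ n hn).2⟩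
    rw [← (hψ n hn).1.sign_eq, sign_div_pos (hp n hn)]
  have hN := hp N le_rfl
  have hN1 := hp (N + 1) (by omega)
  refine ⟨fun g hg hne => ?_, fun α => ?_⟩
  · obtain ⟨φ, hφ⟩ : ∃ φ, HasPhase (g (N + 1) / p (N + 1)) (g N / p N) φ := by
      apply exists_hasPhase
      rcases hne with h | h
      · exact Or.inr (div_ne_zero h hN.ne')
      · exact Or.inl (div_ne_zero h hN1.ne')
    obtain ⟨ψ, -, h1, h2⟩ := key g hg (φ - N * (1 / 2 * Real.pi)) (by simpa using hφ)
    exact ⟨ψ, h1, h2⟩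
  · obtain ⟨φ, hφ⟩ : ∃ φ, φ = N * (1 / 2 * Real.pi) + α := ⟨_, rfl⟩
    obtain ⟨g, g0, g1, hg⟩ := exists_recurrence_from (fun _ => 1) R N (Real.sin φ * p N)
      (Real.cos φ * p (N + 1))
    simp only [one_mul] at hg
    have hph : HasPhase (g (N + 1) / p (N + 1)) (g N / p N) (N * (1 / 2 * Real.pi) + α) := by
      refine ⟨1, one_pos, ?_, ?_⟩
      · rw [g1, hφ]; field_simp
      · rw [g0, hφ]; field_simp
    refine ⟨g, hg, ?_, key g hg α hph⟩
    have := hph.sq_add_sq_pos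
    by_contra! hc
    rw [hc.1, hc.2] at this
    norm_num at this

/-! ### Sign patterns of sequences of phases -/

/-- Steps shorter than `π` cannot jump over an interval of length `π` on which the sine is negative:
the first index beyond `2 k π + π` lands inside it. -/
lemma frequently_sin_neg_of_atTop {x : ℕ → ℝ} (hx : Tendsto x atTop atTop)
    (hstep : ∀ᶠ n in atTop, x (n + 1) - x n < Real.pi) :
    ∃ᶠ n in atTop, Real.sin (x n) < 0 := by
  rw [frequently_atTop]
  intro M
  obtain ⟨M', hM'⟩ := eventually_atTop.1 hstep
  have hpi := Real.pi_pos
  obtain ⟨k, hk⟩ := exists_nat_gt ((x (max M M')) / (2 * Real.pi))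
  rw [div_lt_iff₀ (by positivity)] at hk
  have hex : ∃ n, max M M' ≤ n ∧ k * (2 * Real.pi) + Real.pi < x n := by
    obtain ⟨n, h1, h2⟩ := ((hx.eventually_gt_atTop (k * (2 * Real.pi) + Real.pi)).and
      (eventually_ge_atTop (max M M'))).exists
    exact ⟨n, h2, h1⟩
  classical
  have hspec := Nat.find_spec hex
  have hmin := fun m (hm : m < Nat.find hex) => Nat.find_min hex hm
  generalize Nat.find hex = n at hspec hmin
  obtain ⟨h1, h2⟩ := hspec
  have hne : n ≠ max M M' := by
    rintro rfl
    linarith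
  obtain ⟨m, rfl⟩ : ∃ m, n = m + 1 := ⟨n - 1, by omega⟩
  have h3 := hmin m (by omega)
  push Not at h3
  have h4 := h3 (by omega)
  have h5 := hM' m (by omega)
  refine ⟨m + 1, by omega, ?_⟩
  rw [← Real.sin_sub_nat_mul_two_pi _ k]
  have h6 := Real.sin_pos_of_pos_of_lt_pi (x := x (m + 1) - k * (2 * Real.pi) - Real.pi)
    (by linarith) (by linarith)
  rw [Real.sin_sub_pi] at h6
  linarith

lemma not_eventually_sign_const_of_atTop {x : ℕ → ℝ} (hx : Tendsto x atTop atTop)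
    (hstep : ∀ᶠ n in atTop, x (n + 1) - x n < Real.pi) (a : SignType) :
    ¬ ∀ᶠ n in atTop, SignType.sign (Real.sin (x n)) = a := by
  intro h
  have h1 := frequently_sin_neg_of_atTop hx hstep
  have h2 := frequently_sin_neg_of_atTop (x := fun n => x n + Real.pi)
    (tendsto_atTop_add_const_right _ _ hx) (by simpa using hstep)
  obtain ⟨n, h3, h4⟩ := (h1.and_eventually h).exists
  obtain ⟨m, h5, h6⟩ := (h2.and_eventually h).exists
  rw [Real.sin_add_pi] at h5
  rw [sign_neg h3] at h4
  rw [sign_pos (by linarith), ← h4] at h6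
  exact absurd h6 (by decide)

lemma not_eventually_sign_const {x : ℕ → ℝ} (hx : Tendsto x atTop atTop ∨ Tendsto x atTop atBot)
    (hstep : ∀ᶠ n in atTop, |x (n + 1) - x n| < Real.pi) (a : SignType) :
    ¬ ∀ᶠ n in atTop, SignType.sign (Real.sin (x n)) = a := by
  rcases hx with hx | hx
  · exact not_eventually_sign_const_of_atTop hx (hstep.mono fun n hn => (abs_lt.1 hn).2) a
  · intro h
    refine not_eventually_sign_const_of_atTop (x := fun n => - x n)
      (tendsto_neg_atBot_atTop.comp hx)
      (hstep.mono fun n hn => by linarith [(abs_lt.1 hn).1]) (-a) (h.mono fun n hn => ?_)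
    rw [Real.sin_neg, Left.sign_neg, hn]

lemma HasUltimateSign.eventually_const {f : ℕ → ℝ} {w : List SignType}
    (hf : HasUltimateSign f w) : ∃ a : SignType, ∀ᶠ m in atTop,
      SignType.sign (f (w.length * m)) = a := by
  obtain ⟨N, hw, hN⟩ := id hf
  have hpos := hf.length_pos
  refine ⟨w[0], eventually_atTop.2 ⟨N, fun m hm => ?_⟩⟩
  have h := hN (w.length * m) (hm.trans (Nat.le_mul_of_pos_left _ hpos))
  rw [Nat.mul_mod_right, List.getElem?_eq_getElem hpos] at h
  exact (Option.some.inj h).symm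

lemma HasUltimateSign.eventually_const_two_mul {f : ℕ → ℝ} {w : List SignType}
    (hf : HasUltimateSign f w) : ∃ a : SignType, ∀ᶠ m in atTop,
      SignType.sign (f (2 * w.length * m)) = a := by
  obtain ⟨a, ha⟩ := hf.eventually_const
  refine ⟨a, ?_⟩
  have ht : Tendsto (fun m : ℕ => 2 * m) atTop atTop :=
    tendsto_id.const_mul_atTop' two_pos
  refine (ht.eventually ha).mono fun m hm => ?_
  rwa [show 2 * w.length * m = w.length * (2 * m) by ring]

lemma tendsto_shift_sub {φ : ℕ → ℝ} {c : ℝ}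
    (h : Tendsto (fun n => φ (n + 1) - φ n) atTop (nhds c)) (k : ℕ) :
    Tendsto (fun n => φ (n + k) - φ n) atTop (nhds (k * c)) := by
  induction k with
  | zero => simp
  | succ k ih =>
    have h1 := (h.comp (tendsto_add_atTop_nat k)).add ih
    refine (h1.congr fun n => ?_).trans (le_of_eq ?_)
    · simp only [Function.comp]
      rw [show n + k + 1 = n + (k + 1) by ring]
      ring
    · push_cast
      ring_nf

lemma tendsto_atTop_of_step {x : ℕ → ℝ} {δ : ℝ} (hδ : 0 < δ)
    (h : ∀ᶠ n in atTop, δ ≤ x (n + 1) - x n) : Tendsto x atTop atTop := by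
  obtain ⟨N, hN⟩ := eventually_atTop.1 h
  rw [← tendsto_add_atTop_iff_nat N]
  have hle : ∀ n : ℕ, x N + n * δ ≤ x (n + N) := by
    intro n
    induction n with
    | zero => simp
    | succ n ih =>
      have := hN (n + N) (by omega)
      rw [show n + N + 1 = n + 1 + N by ring] at this
      push_cast
      linarith
  exact tendsto_atTop_mono hle
    (tendsto_atTop_add_const_left _ _ (tendsto_natCast_real.atTop_mul_const hδ))

/-- If a sequence whose phases rotate asymptotically by the angle `θ π` has an ultimate sign, then
`θ` times the length of the word is an integer. -/
lemma HasUltimateSign.exists_int {f φ : ℕ → ℝ} {θ : ℝ} {w : List SignType}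
    (hs : ∀ᶠ n in atTop, SignType.sign (f n) = SignType.sign (Real.sin (φ n)))
    (hφ : Tendsto (fun n => φ (n + 1) - φ n) atTop (nhds (θ * Real.pi)))
    (hf : HasUltimateSign f w) : ∃ l : ℤ, (w.length : ℝ) * θ = l := by
  by_contra! hint
  have hpi := Real.pi_pos
  obtain ⟨a, ha⟩ := hf.eventually_const
  have hpos := hf.length_pos
  have ht : Tendsto (fun m : ℕ => w.length * m) atTop atTop :=
    tendsto_id.const_mul_atTop' hpos
  obtain ⟨l, hl⟩ : ∃ l : ℤ, l = ⌊(w.length : ℝ) * θ / 2⌋ := ⟨_, rfl⟩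
  -- Along multiples of the word length the sign is constant, while each sample turns the phase by
  -- about `γ` modulo `2 π`, where `0 < γ < 2 π` and, `θ` times the length not being an integer, `γ
  -- ≠ π`.
  obtain ⟨γ, hγ⟩ : ∃ γ : ℝ, γ = Real.pi * ((w.length : ℝ) * θ - 2 * l) := ⟨_, rfl⟩
  have h0 : 0 < (w.length : ℝ) * θ - 2 * l := by
    have h1 := Int.floor_le ((w.length : ℝ) * θ / 2)
    have h2 := hint (2 * l)
    rw [← hl] at h1
    push_cast at h2
    exact lt_of_le_of_ne (by linarith) (Ne.symm (sub_ne_zero.2 h2))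
  have h1 : (w.length : ℝ) * θ - 2 * l < 2 := by
    have := Int.lt_floor_add_one ((w.length : ℝ) * θ / 2)
    rw [hl]; linarith
  have hlim : Tendsto (fun m : ℕ => φ (w.length * (m + 1)) - φ (w.length * m)) atTop
      (nhds (γ + l * (2 * Real.pi))) := by
    have := (tendsto_shift_sub hφ (w.length)).comp ht
    refine (this.congr fun m => ?_).trans (le_of_eq ?_)
    · simp only [Function.comp, mul_add, mul_one]
    · rw [hγ]; ring_nf
  have hsign : ∀ j : ℤ, ∀ᶠ m : ℕ in atTop,
      SignType.sign (Real.sin (φ (w.length * m) - m * (j * (2 * Real.pi)))) = a := by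
    intro j
    filter_upwards [ha, ht.eventually hs] with m h2 h3
    rw [← h2, h3]
    congr 1
    have := Real.sin_sub_int_mul_two_pi (φ (w.length * m)) (m * j)
    rw [← this]
    push_cast
    ring_nf
  have hstep : ∀ j : ℤ, Tendsto (fun m : ℕ =>
      (φ (w.length * (m + 1)) - (m + 1 : ℕ) * (j * (2 * Real.pi))) -
      (φ (w.length * m) - m * (j * (2 * Real.pi)))) atTop
      (nhds (γ + (l - j) * (2 * Real.pi))) := by
    intro j
    refine ((hlim.sub_const (j * (2 * Real.pi))).congr fun m => ?_).trans (le_of_eq ?_)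
    · push_cast; ring
    · ring_nf
  have hγ0 : 0 < γ := by rw [hγ]; positivity
  have hγ2 : γ < 2 * Real.pi := by
    rw [hγ]; nlinarith
  rcases lt_trichotomy γ Real.pi with hlt | heq | hgt
  · have h2 := hstep l
    rw [sub_self, zero_mul, add_zero] at h2
    refine not_eventually_sign_const (Or.inl (tendsto_atTop_of_step (δ := γ / 2) (by positivity)
      ((h2.eventually_const_lt (u := γ / 2) (by linarith)).mono fun m hm => hm.le))) ?_ a (hsign l)
    filter_upwards [h2.eventually_const_lt (u := -Real.pi) (by linarith),
      h2.eventually_lt_const hlt] with m h3 h4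
    exact abs_lt.2 ⟨h3, h4⟩
  · refine absurd ?_ (hint (2 * l + 1))
    rw [hγ] at heq
    have h2 := mul_left_cancel₀ hpi.ne' (heq.trans (mul_one _).symm)
    push_cast
    linarith
  -- For `γ > π` one more full turn is removed, and the phase runs backwards with steps near `γ - 2
  -- π`, of absolute value below `π`.
  · have h2 := hstep (l + 1)
    push_cast at h2
    rw [show γ + ((l : ℝ) - (l + 1)) * (2 * Real.pi) = γ - 2 * Real.pi by ring] at h2
    refine not_eventually_sign_const (Or.inr ?_) ?_ a (hsign (l + 1))
    · have h5 := tendsto_atTop_of_step (x := fun m : ℕ => -(φ (w.length * m) -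
        m * (((l + 1 : ℤ) : ℝ) * (2 * Real.pi)))) (δ := (2 * Real.pi - γ) / 2) (by linarith) (by
        filter_upwards [h2.eventually_lt_const (u := (γ - 2 * Real.pi) / 2) (by linarith)]
          with m hm
        push_cast at hm ⊢
        linarith)
      exact tendsto_neg_atTop_iff.1 h5
    · filter_upwards [h2.eventually_const_lt (u := -Real.pi) (by linarith),
        h2.eventually_lt_const (u := Real.pi) (by linarith)] with m h3 h4
      push_cast
      exact abs_lt.2 ⟨h3, h4⟩

/-- A sequence whose phases rotate asymptotically by the angle `θ π`, where `θ` is irrational or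
the phases drift away from `n θ π`, has no ultimate sign. -/
lemma not_hasUltimateSign_of_phase {f φ : ℕ → ℝ} {θ : ℝ}
    (hs : ∀ᶠ n in atTop, SignType.sign (f n) = SignType.sign (Real.sin (φ n)))
    (hφ : Tendsto (fun n => φ (n + 1) - φ n) atTop (nhds (θ * Real.pi)))
    (hθ : Irrational θ ∨ Tendsto (fun n : ℕ => φ n - n * (θ * Real.pi)) atTop atTop ∨
      Tendsto (fun n : ℕ => φ n - n * (θ * Real.pi)) atTop atBot) (w : List SignType) :
    ¬ HasUltimateSign f w := by
  intro hf
  have hpos := hf.length_pos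
  obtain ⟨l, hl⟩ := hf.exists_int hs hφ
  rcases hθ with hθ | hθ
  · refine hθ ⟨(l : ℚ) / w.length, ?_⟩
    push_cast
    rw [← hl]
    field_simp
  -- Over twice the word length the rotation `2 l π` is a whole number of full turns. Without these
  -- turns the sampled phases have steps tending to 0 but still drift to infinity, so they meet both
  -- signs.
  · obtain ⟨a, ha⟩ := hf.eventually_const_two_mul
    have ht : Tendsto (fun m : ℕ => 2 * w.length * m) atTop atTop :=
      tendsto_id.const_mul_atTop' (by omega)
    have hrw : ∀ m : ℕ, φ (2 * w.length * m) - (2 * w.length * m : ℕ) * (θ * Real.pi) =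
        φ (2 * w.length * m) - m * (l * (2 * Real.pi)) := by
      intro m
      push_cast
      rw [← hl]
      ring
    refine not_eventually_sign_const (x := fun m : ℕ =>
      φ (2 * w.length * m) - m * (l * (2 * Real.pi))) ?_ ?_ a ?_
    · refine hθ.imp (fun h => ?_) (fun h => ?_)
      · exact (h.comp ht).congr hrw
      · exact (h.comp ht).congr hrw
    · have h1 := ((tendsto_shift_sub hφ (2 * w.length)).comp ht).sub_const
        ((2 * w.length : ℕ) * (θ * Real.pi))
      rw [sub_self] at h1
      have h2 := h1.abs
      rw [abs_zero] at h2
      filter_upwards [h2.eventually_lt_const Real.pi_pos] with m hm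
      refine lt_of_eq_of_lt (congrArg abs ?_) hm
      simp only [Function.comp]
      push_cast
      rw [← hl, show 2 * w.length * (m + 1) = 2 * w.length * m + 2 * w.length by ring]
      ring
    · filter_upwards [ha, ht.eventually hs] with m h2 h3
      rw [← h2, h3]
      congr 1
      have := Real.sin_sub_int_mul_two_pi (φ (2 * w.length * m)) (m * l)
      rw [← this]
      push_cast
      ring_nf

/-! ### Sine words -/

/-- The sequence of which the word `sineWord c k r j` is the period. -/
def sineSign (c : ℝ) (k r : ℕ) (j : ℤ) (n : ℕ) : SignType :=
  SignType.sign (Real.sin (((j : ℝ) - (n : ℝ) * (k : ℝ) + c) / (r : ℝ) * Real.pi))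

/-- A shift by `r` changes the angle by `-k π`: a multiple of `2 π` for even `k`, whereas odd `k`
needs `2 r`. -/
lemma sineSign_periodic (c : ℝ) {k r : ℕ} (hr : 0 < r) (j : ℤ) (n : ℕ) :
    sineSign c k r j (n + ((k % 2) * r + r)) = sineSign c k r j n := by
  unfold sineSign
  congr 1
  obtain ⟨l, hl⟩ : ∃ l : ℕ, (k % 2 + 1) * k = 2 * l := by
    rcases Nat.even_or_odd k with h | h
    · obtain ⟨l, hl⟩ := h.two_dvd
      exact ⟨l, by rw [Nat.even_iff.1 h]; omega⟩
    · exact ⟨k, by rw [Nat.odd_iff.1 h]⟩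
  have hl' : ((k % 2 : ℕ) + 1 : ℝ) * k = 2 * l := by exact_mod_cast hl
  rw [← Real.sin_add_nat_mul_two_pi _ l]
  congr 1
  have hr' : (r : ℝ) ≠ 0 := by exact_mod_cast hr.ne'
  push_cast at hl' ⊢
  field_simp
  linear_combination (-(r : ℝ)) * hl'

lemma sineSign_add_two_mul (c : ℝ) {k r : ℕ} (hr : 0 < r) (j m : ℤ) (n : ℕ) :
    sineSign c k r (j + 2 * r * m) n = sineSign c k r j n := by
  unfold sineSign
  congr 1
  rw [← Real.sin_sub_int_mul_two_pi _ m]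
  congr 1
  have hr' : (r : ℝ) ≠ 0 := by exact_mod_cast hr.ne'
  push_cast
  field_simp
  ring

/-- By `HasUltimateSign.exists_int` the length of any word makes `length * k / r` an integer, so `r`
divides it. For odd `k` the length `r` is impossible, as a shift by `r` negates the pattern and the
pattern is not identically 0 far out. -/
lemma hasShortestUltimateSign_sineSign {f : ℕ → ℝ} {c : ℝ} {k r : ℕ} (hr : 0 < r)
    (hkr : Nat.Coprime k r) {j : ℤ} (hne : ∀ n, sineSign c k r j n ≠ 0 ∨
      sineSign c k r j (n + 1) ≠ 0)
    (hf : ∀ᶠ n in atTop, SignType.sign (f n) = sineSign c k r j n) (s : WithBot (List SignType)) :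
    HasShortestUltimateSign f s ↔
      s = (((List.range ((k % 2) * r + r)).map (sineSign c k r j) : List SignType) :
        WithBot (List SignType)) := by
  have hr' : (r : ℝ) ≠ 0 := by exact_mod_cast hr.ne'
  refine hasShortestUltimateSign_iff_of_le (hasUltimateSign_of_periodic (by omega)
    (sineSign_periodic c hr j) hf) (fun w hw => ?_) s
  rw [List.length_map, List.length_range]
  have hpos := hw.length_pos
  obtain ⟨l, hl⟩ := hw.exists_int (θ := -((k : ℝ) / r)) (φ := fun n : ℕ =>
    ((j : ℝ) - (n : ℝ) * (k : ℝ) + c) / (r : ℝ) * Real.pi) hf (by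
      refine tendsto_const_nhds.congr fun n => ?_
      push_cast
      field_simp
      ring)
  have hl2 : (w.length : ℤ) * k = -l * r := by
    have h3 : (w.length : ℝ) * k = -l * r := by
      rw [← hl]; field_simp
    exact_mod_cast h3
  have hdvd : (r : ℤ) ∣ w.length * k := ⟨-l, by rw [hl2]; ring⟩
  have hdvd' : r ∣ w.length := by
    refine Nat.Coprime.dvd_of_dvd_mul_right hkr.symm ?_
    exact_mod_cast hdvd
  obtain ⟨u, hu⟩ := hdvd'
  have hu0 : 0 < u := Nat.pos_of_ne_zero (by rintro rfl; omega)
  rcases Nat.even_or_odd k with hk | hk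
  · rw [Nat.even_iff.1 hk, zero_mul, zero_add, hu]
    exact Nat.le_mul_of_pos_right r hu0
  · rw [Nat.odd_iff.1 hk, one_mul, hu]
    suffices h : u ≠ 1 by
      have : 2 ≤ u := by omega
      calc r + r = r * 2 := by ring
        _ ≤ r * u := Nat.mul_le_mul_left r this
    rintro rfl
    rw [mul_one] at hu
    have hper := hw.periodic
    obtain ⟨M, hM⟩ := eventually_atTop.1 (hper.and (hf.and
      ((tendsto_add_atTop_nat w.length).eventually hf)))
    have hflip : ∀ n, sineSign c k r j (n + r) = - sineSign c k r j n := by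
      intro n
      obtain ⟨m, hm⟩ := hk
      unfold sineSign
      rw [← Left.sign_neg, ← Real.sin_sub_pi, ← Real.sin_add_nat_mul_two_pi _ m]
      congr 2
      push_cast [hm]
      field_simp
      ring
    have hzero : ∀ n, M ≤ n → sineSign c k r j n = 0 := by
      intro n hn
      obtain ⟨h1, h2, h3⟩ := hM n hn
      rw [h2, h3, hu, hflip] at h1
      generalize sineSign c k r j n = a at h1
      revert h1; revert a; decide
    rcases hne M with h | h
    · exact h (hzero M le_rfl)
    · exact h (hzero (M + 1) (by omega))

/-- The sine has constant sign between consecutive multiples of `π / r`; as the right side does not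
involve `y`, any `y` in `(0, 1)` may be replaced by `1 / 2`. -/
lemma sign_sin_add_mul {r : ℕ} (hr : 0 < r) (M : ℤ) {y : ℝ} (h0 : 0 < y) (h1 : y < 1) :
    SignType.sign (Real.sin ((M + y) / r * Real.pi)) =
      SignType.sign ((-1 : ℝ) ^ (M / (r : ℤ))) := by
  have hr' : (0 : ℝ) < r := by exact_mod_cast hr
  have hrz : (0 : ℤ) < r := by exact_mod_cast hr
  have hdiv := Int.emod_add_mul_ediv M r
  have hb0 := Int.emod_nonneg M hrz.ne'
  have hb1 : M % (r : ℤ) + 1 ≤ r := Int.emod_lt_of_pos M hrz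
  generalize M / (r : ℤ) = a at *
  generalize M % (r : ℤ) = b at *
  have hb0' : (0 : ℝ) ≤ b := by exact_mod_cast hb0
  have hb1' : (b : ℝ) + 1 ≤ r := by exact_mod_cast hb1
  have e : ((M : ℝ) + y) / r * Real.pi = (b + y) / r * Real.pi + a * Real.pi := by
    rw [← hdiv]
    push_cast
    field_simp
    ring
  have hpos : 0 < Real.sin ((b + y) / r * Real.pi) := by
    apply Real.sin_pos_of_pos_of_lt_pi
    · positivity
    · have : (b + y) / r < 1 := by rw [div_lt_one hr']; linarith
      nlinarith [Real.pi_pos]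
  rw [e, Real.sin_add_int_mul_pi, sign_mul, sign_pos hpos, mul_one]

lemma sineSign_half_ne_zero (k : ℕ) {r : ℕ} (hr : 0 < r) (j : ℤ) (n : ℕ) :
    sineSign (1 / 2) k r j n ≠ 0 := by
  have h := sign_sin_add_mul hr (j - n * k) (y := 1 / 2) (by norm_num) (by norm_num)
  unfold sineSign
  push_cast at h
  rw [h, sign_ne_zero]
  exact zpow_ne_zero _ (by norm_num)

/-- Two consecutive zeros would make `r` divide `k`. -/
lemma sineSign_zero_ne_zero {k r : ℕ} (hr : 2 ≤ r) (hkr : Nat.Coprime k r) (j : ℤ) (n : ℕ) :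
    sineSign 0 k r j n ≠ 0 ∨ sineSign 0 k r j (n + 1) ≠ 0 := by
  by_contra! hc
  unfold sineSign at hc
  rw [sign_eq_zero_iff, sign_eq_zero_iff, Real.sin_eq_zero_iff, Real.sin_eq_zero_iff] at hc
  obtain ⟨⟨a, ha⟩, ⟨b, hb⟩⟩ := hc
  have hr' : (r : ℝ) ≠ 0 := by
    have : r ≠ 0 := by omega
    exact_mod_cast this
  have ha' := mul_right_cancel₀ Real.pi_ne_zero ha
  have hb' := mul_right_cancel₀ Real.pi_ne_zero hb
  rw [eq_div_iff hr'] at ha' hb'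
  push_cast at hb'
  have h1 : (k : ℤ) = r * (a - b) := by
    have : (k : ℝ) = r * (a - b) := by linarith
    exact_mod_cast this
  have h2 : r ∣ k := Int.natCast_dvd_natCast.1 ⟨a - b, h1⟩
  have h3 := Nat.Coprime.eq_one_of_dvd hkr.symm h2
  omega

lemma exists_sineWord_iff (c : ℝ) {k r : ℕ} (hr : 0 < r) (s : WithBot (List SignType)) :
    (∃ j : ℕ, j < 2 * r ∧ s = (sineWord c k r j : WithBot (List SignType))) ↔
      ∃ j : ℤ, s = (((List.range ((k % 2) * r + r)).map (sineSign c k r j) : List SignType) :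
        WithBot (List SignType)) := by
  have hcast : ∀ j : ℕ, sineWord c k r j =
      (List.range ((k % 2) * r + r)).map (sineSign c k r j) := fun j => by
    unfold sineWord sineSign
    simp only [Int.cast_natCast]
  constructor
  · rintro ⟨j, -, rfl⟩
    exact ⟨j, by rw [hcast]⟩
  · rintro ⟨j, rfl⟩
    have hpos : (0 : ℤ) < 2 * r := by omega
    obtain ⟨i, hi⟩ := Int.eq_ofNat_of_zero_le (Int.emod_nonneg j hpos.ne')
    refine ⟨i, ?_, ?_⟩
    · have := Int.emod_lt_of_pos j hpos
      omega
    · rw [hcast, ← hi]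
      congr 2
      funext n
      conv_lhs => rw [← Int.emod_add_mul_ediv j (2 * r)]
      exact sineSign_add_two_mul c hr _ _ _

/-- The words use decreasing angles, hence the reflection `sin (π - x) = sin x` and the index `r - J
- 1`. -/
lemma sign_sin_phase_of_mem {k r : ℕ} (hr : 0 < r) {J : ℤ} {ψ : ℝ}
    (h0 : J * (Real.pi / r) < ψ) (h1 : ψ < (J + 1) * (Real.pi / r)) (n : ℕ) :
    SignType.sign (Real.sin (n * ((k : ℝ) / r * Real.pi) + ψ)) =
      sineSign (1 / 2) k r (r - J - 1) n := by
  have hr' : (0 : ℝ) < r := by exact_mod_cast hr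
  have hpi := Real.pi_pos
  obtain ⟨y, hy⟩ : ∃ y, y = ψ * r / Real.pi - J := ⟨_, rfl⟩
  have hψ : ψ = (J + y) / r * Real.pi := by rw [hy]; field_simp; ring
  have hy0 : 0 < y := by
    rw [hψ] at h0
    have : J * (Real.pi / r) < J * (Real.pi / r) + y * (Real.pi / r) := by
      calc _ < _ := h0
        _ = _ := by ring
    have h2 : 0 < y * (Real.pi / r) := by linarith
    exact pos_of_mul_pos_left h2 (by positivity)
  have hy1 : y < 1 := by
    rw [hψ] at h1
    have h2 : (J + y) * (Real.pi / r) < (J + 1) * (Real.pi / r) := by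
      calc _ = _ := by ring
        _ < _ := h1
    have := lt_of_mul_lt_mul_right h2 (by positivity)
    linarith
  have h2 := sign_sin_add_mul hr (n * k + J) hy0 hy1
  have h3 := sign_sin_add_mul hr (n * k + J) (y := 1 / 2) (by norm_num) (by norm_num)
  rw [← h3] at h2
  have e1 : n * ((k : ℝ) / r * Real.pi) + ψ = (((n * k + J : ℤ) : ℝ) + y) / r * Real.pi := by
    rw [hψ]; push_cast; field_simp; ring
  rw [e1, h2, ← Real.sin_pi_sub]
  unfold sineSign
  congr 2
  push_cast
  field_simp
  ring

lemma sign_sin_phase_of_eq {k r : ℕ} (hr : 0 < r) {J : ℤ} {ψ : ℝ}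
    (h0 : ψ = J * (Real.pi / r)) (n : ℕ) :
    SignType.sign (Real.sin (n * ((k : ℝ) / r * Real.pi) + ψ)) =
      sineSign 0 k r (r - J) n := by
  have hr' : (0 : ℝ) < r := by exact_mod_cast hr
  rw [← Real.sin_pi_sub, h0]
  unfold sineSign
  congr 2
  push_cast
  field_simp
  ring

/-! ### From the drift of the phase corrections to the set of signs -/

/-- The phase corrections `ψ` move strictly in one direction from the index `N` on, and the step
at the index `n` is at most `B n`. -/
def OneSided (N : ℕ) (B ψ : ℕ → ℝ) : Prop :=
  ∃ σ : ℝ, (σ = 1 ∨ σ = -1) ∧ ∀ n, N ≤ n → 0 ≤ σ * (ψ (n + 1) - ψ n) ∧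
    0 < σ * (ψ (n + 2) - ψ n) ∧ |ψ (n + 1) - ψ n| ≤ B n

lemma abs_sub_le_sum {N : ℕ} {B ψ : ℕ → ℝ} (h : ∀ n, N ≤ n → |ψ (n + 1) - ψ n| ≤ B n)
    {n : ℕ} (hn : N ≤ n) : |ψ n - ψ N| ≤ ∑ i ∈ Finset.Ico N n, B i := by
  induction n, hn using Nat.le_induction with
  | base => simp
  | succ n hn ih =>
    rw [Finset.sum_Ico_succ_top hn]
    have e : ψ (n + 1) - ψ N = (ψ n - ψ N) + (ψ (n + 1) - ψ n) := by ring
    rw [e]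
    exact (abs_add_le _ _).trans (add_le_add ih (h n hn))

/-- The sequence increases to a limit `L` that it never attains, so even if `L` is an integer it
ends strictly between `⌈L⌉ - 1` and `⌈L⌉`. -/
lemma eventually_mem_unit_interval {x : ℕ → ℝ} {N : ℕ} {K : ℝ}
    (h1 : ∀ n, N ≤ n → x n ≤ x (n + 1)) (h2 : ∀ n, N ≤ n → x n < x (n + 2))
    (hK : ∀ n, N ≤ n → x n ≤ K) : ∃ J : ℤ, ∀ᶠ n in atTop, (J : ℝ) < x n ∧ x n < J + 1 := by
  have hmono : Monotone fun m => x (N + m) :=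
    monotone_nat_of_le_succ fun m => h1 (N + m) (by omega)
  have hbdd : BddAbove (Set.range fun m => x (N + m)) :=
    ⟨K, by rintro _ ⟨m, rfl⟩; exact hK _ (by omega)⟩
  have hlim := tendsto_atTop_ciSup hmono hbdd
  have hle : ∀ m, x (N + m) ≤ ⨆ m, x (N + m) := fun m => le_ciSup hbdd m
  generalize (⨆ m, x (N + m)) = L at hlim hle
  have h3 : ((⌈L⌉ - 1 : ℤ) : ℝ) < L := by
    have := Int.ceil_lt_add_one L
    push_cast
    linarith
  refine ⟨⌈L⌉ - 1, ?_⟩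
  obtain ⟨M, hM⟩ := eventually_atTop.1 (hlim.eventually_const_lt h3)
  refine eventually_atTop.2 ⟨N + M, fun n hn => ?_⟩
  obtain ⟨m, rfl⟩ := Nat.exists_eq_add_of_le (show N ≤ n by omega)
  refine ⟨hM m (by omega), ?_⟩
  have h4 := h2 (N + m) (by omega)
  have h5 := hle (m + 2)
  have h6 := Int.le_ceil L
  push_cast
  have h7 : x (N + m + 2) = x (N + (m + 2)) := rfl
  linarith

lemma OneSided.exists_int {N : ℕ} {B ψ : ℕ → ℝ} (h : OneSided N B ψ) {K : ℝ}
    (hB : ∀ n, ∑ i ∈ Finset.Ico N n, B i < K) {a : ℝ} (ha : 0 < a) :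
    ∃ J : ℤ, ∀ᶠ n in atTop, J * a < ψ n ∧ ψ n < (J + 1) * a := by
  obtain ⟨σ, hσ, hψ⟩ := h
  have hb : ∀ n, N ≤ n → |ψ n - ψ N| ≤ K := fun n hn =>
    (abs_sub_le_sum (fun n hn => (hψ n hn).2.2) hn).trans (hB n).le
  rcases hσ with rfl | rfl
  · obtain ⟨J, hJ⟩ := eventually_mem_unit_interval (x := fun n => ψ n / a) (N := N)
      (K := (ψ N + K) / a)
      (fun n hn => by
        have := (hψ n hn).1
        exact div_le_div_of_nonneg_right (by linarith) ha.le)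
      (fun n hn => by
        have := (hψ n hn).2.1
        exact div_lt_div_of_pos_right (by linarith) ha)
      (fun n hn => by
        have := (abs_le.1 (hb n hn)).2
        exact div_le_div_of_nonneg_right (by linarith) ha.le)
    refine ⟨J, hJ.mono fun n hn => ?_⟩
    rwa [lt_div_iff₀ ha, div_lt_iff₀ ha] at hn
  · obtain ⟨J, hJ⟩ := eventually_mem_unit_interval (x := fun n => - ψ n / a) (N := N)
      (K := (- ψ N + K) / a)
      (fun n hn => by
        have := (hψ n hn).1
        exact div_le_div_of_nonneg_right (by linarith) ha.le)
      (fun n hn => by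
        have := (hψ n hn).2.1
        exact div_lt_div_of_pos_right (by linarith) ha)
      (fun n hn => by
        have := (abs_le.1 (hb n hn)).1
        exact div_le_div_of_nonneg_right (by linarith) ha.le)
    refine ⟨-J - 1, hJ.mono fun n hn => ?_⟩
    rw [lt_div_iff₀ ha, div_lt_iff₀ ha] at hn
    push_cast
    constructor <;> linarith

/-- Every phase correction ends inside an open interval between multiples of `π / r`. Conversely,
starting at the midpoint of a chosen interval, a total drift below half its length never leaves it,
so every `s_j` occurs. -/
lemma tailSigns_of_oneSided {R B : ℕ → ℝ} {N k r : ℕ} (hr : 0 < r) (hkr : Nat.Coprime k r)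
    (h : HasPhases R N ((k : ℝ) / r) (OneSided N B))
    (hB : ∀ n, ∑ i ∈ Finset.Ico N n, B i < Real.pi / r / 2) :
    tailSigns R N = sWords k r := by
  have hr' : (0 : ℝ) < r := by exact_mod_cast hr
  have ha : 0 < Real.pi / r := div_pos Real.pi_pos hr'
  have hshort : ∀ (g ψ : ℕ → ℝ) (J : ℤ), (∀ n : ℕ, N ≤ n → SignType.sign (g n) =
      SignType.sign (Real.sin (n * ((k : ℝ) / r * Real.pi) + ψ n))) →
      (∀ᶠ n in atTop, J * (Real.pi / r) < ψ n ∧ ψ n < (J + 1) * (Real.pi / r)) → ∀ s,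
      (HasShortestUltimateSign g s ↔ s = (((List.range ((k % 2) * r + r)).map
        (sineSign (1 / 2) k r (r - J - 1)) : List SignType) : WithBot (List SignType))) := by
    intro g ψ J hs hJ s
    refine hasShortestUltimateSign_sineSign hr hkr
      (fun n => Or.inl (sineSign_half_ne_zero k hr _ n)) ?_ s
    filter_upwards [hJ, eventually_ge_atTop N] with n hn hN
    rw [hs n hN, sign_sin_phase_of_mem hr hn.1 hn.2]
  ext s
  refine Iff.trans ?_ (exists_sineWord_iff (1 / 2) hr s).symm
  constructor
  · rintro ⟨g, hg, hne, hgs⟩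
    obtain ⟨ψ, hs, hψ⟩ := h.1 g hg hne
    obtain ⟨J, hJ⟩ := hψ.exists_int hB ha
    exact ⟨_, (hshort g ψ J hs hJ s).1 hgs⟩
  · rintro ⟨j, rfl⟩
    obtain ⟨J, hJ⟩ : ∃ J : ℤ, J = r - j - 1 := ⟨_, rfl⟩
    obtain ⟨g, hg, hne, ψ, hψN, hs, σ, hσ, hψ⟩ := h.2 ((J + 1 / 2) * (Real.pi / r))
    refine ⟨g, hg, hne, (hshort g ψ J hs ?_ _).2 ?_⟩
    · filter_upwards [eventually_ge_atTop N] with n hn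
      have h1 := abs_lt.1 ((abs_sub_le_sum (fun n hn => (hψ n hn).2.2) hn).trans_lt (hB n))
      rw [hψN] at h1
      constructor <;> linarith
    · rw [show (r : ℤ) - J - 1 = j by omega]

lemma tailSigns_of_const {R : ℕ → ℝ} {N k r : ℕ} (hr : 2 ≤ r) (hkr : Nat.Coprime k r)
    (h : HasPhases R N ((k : ℝ) / r) fun ψ => ∀ n, N ≤ n → ψ (n + 1) = ψ n) :
    tailSigns R N = sWords k r ∪ tWords k r := by
  have hr0 : 0 < r := by omega
  have hr' : (0 : ℝ) < r := by exact_mod_cast hr0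
  have ha : 0 < Real.pi / r := div_pos Real.pi_pos hr'
  have hconst : ∀ ψ : ℕ → ℝ, (∀ n, N ≤ n → ψ (n + 1) = ψ n) → ∀ n, N ≤ n → ψ n = ψ N := by
    intro ψ hψ n hn
    induction n, hn using Nat.le_induction with
    | base => rfl
    | succ n hn ih => rw [hψ n hn, ih]
  have hs : ∀ (g ψ : ℕ → ℝ) (J : ℤ), (∀ n : ℕ, N ≤ n → SignType.sign (g n) =
      SignType.sign (Real.sin (n * ((k : ℝ) / r * Real.pi) + ψ n))) →
      (∀ n, N ≤ n → ψ (n + 1) = ψ n) →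
      J * (Real.pi / r) < ψ N → ψ N < (J + 1) * (Real.pi / r) → ∀ s,
      (HasShortestUltimateSign g s ↔ s = (((List.range ((k % 2) * r + r)).map
        (sineSign (1 / 2) k r (r - J - 1)) : List SignType) : WithBot (List SignType))) := by
    intro g ψ J hs hψ h0 h1 s
    refine hasShortestUltimateSign_sineSign hr0 hkr
      (fun n => Or.inl (sineSign_half_ne_zero k hr0 _ n)) ?_ s
    filter_upwards [eventually_ge_atTop N] with n hN
    rw [hs n hN, hconst ψ hψ n hN, sign_sin_phase_of_mem hr0 h0 h1]
  have ht : ∀ (g ψ : ℕ → ℝ) (J : ℤ), (∀ n : ℕ, N ≤ n → SignType.sign (g n) =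
      SignType.sign (Real.sin (n * ((k : ℝ) / r * Real.pi) + ψ n))) →
      (∀ n, N ≤ n → ψ (n + 1) = ψ n) → ψ N = J * (Real.pi / r) → ∀ s,
      (HasShortestUltimateSign g s ↔ s = (((List.range ((k % 2) * r + r)).map
        (sineSign 0 k r (r - J)) : List SignType) : WithBot (List SignType))) := by
    intro g ψ J hs hψ h0 s
    refine hasShortestUltimateSign_sineSign hr0 hkr
      (fun n => sineSign_zero_ne_zero hr hkr _ n) ?_ s
    filter_upwards [eventually_ge_atTop N] with n hN
    rw [hs n hN, hconst ψ hψ n hN, sign_sin_phase_of_eq hr0 h0]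
  ext s
  refine Iff.trans ?_ (or_congr (exists_sineWord_iff (1 / 2) hr0 s).symm
    (exists_sineWord_iff 0 hr0 s).symm)
  constructor
  · rintro ⟨g, hg, hne, hgs⟩
    obtain ⟨ψ, hsg, hψ⟩ := h.1 g hg hne
    have h0 := Int.floor_le (ψ N / (Real.pi / r))
    have h1 := Int.lt_floor_add_one (ψ N / (Real.pi / r))
    generalize ⌊ψ N / (Real.pi / r)⌋ = J at h0 h1
    rw [le_div_iff₀ ha] at h0
    rw [div_lt_iff₀ ha] at h1
    rcases h0.eq_or_lt with h0 | h0
    · exact Or.inr ⟨_, (ht g ψ J hsg hψ h0.symm s).1 hgs⟩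
    · exact Or.inl ⟨_, (hs g ψ J hsg hψ h0 h1 s).1 hgs⟩
  · rintro (⟨j, rfl⟩ | ⟨j, rfl⟩)
    · obtain ⟨J, hJ⟩ : ∃ J : ℤ, J = r - j - 1 := ⟨_, rfl⟩
      obtain ⟨g, hg, hne, ψ, hψN, hsg, hψ⟩ := h.2 ((J + 1 / 2) * (Real.pi / r))
      refine ⟨g, hg, hne, (hs g ψ J hsg hψ ?_ ?_ _).2 ?_⟩
      · rw [hψN]; linarith
      · rw [hψN]; linarith
      · rw [show (r : ℤ) - J - 1 = j by omega]
    · obtain ⟨J, hJ⟩ : ∃ J : ℤ, J = r - j := ⟨_, rfl⟩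
      obtain ⟨g, hg, hne, ψ, hψN, hsg, hψ⟩ := h.2 (J * (Real.pi / r))
      refine ⟨g, hg, hne, (ht g ψ J hsg hψ hψN _).2 ?_⟩
      rw [show (r : ℤ) - J = j by omega]

lemma tailSigns_of_noSign {R : ℕ → ℝ} {N : ℕ} {θ : ℝ} {C : (ℕ → ℝ) → Prop}
    (h : HasPhases R N θ C) (hstep : ∀ ψ, C ψ → Tendsto (fun n => ψ (n + 1) - ψ n) atTop (nhds 0))
    (hθ : Irrational θ ∨ ∀ ψ, C ψ → Tendsto ψ atTop atTop ∨ Tendsto ψ atTop atBot) :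
    tailSigns R N = {(⊥ : WithBot (List SignType))} := by
  have key : ∀ g ψ : ℕ → ℝ, (∀ n : ℕ, N ≤ n → SignType.sign (g n) =
      SignType.sign (Real.sin (n * (θ * Real.pi) + ψ n))) → C ψ →
      ∀ s, HasShortestUltimateSign g s ↔ s = ⊥ := by
    intro g ψ hs hψ s
    refine hasShortestUltimateSign_iff_bot (not_hasUltimateSign_of_phase
      (φ := fun n : ℕ => n * (θ * Real.pi) + ψ n) (θ := θ)
      ((eventually_ge_atTop N).mono hs) ?_ ?_) s
    · have := (hstep ψ hψ).const_add (θ * Real.pi)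
      rw [add_zero] at this
      refine this.congr fun n => ?_
      push_cast
      ring
    · simpa using hθ.imp_right fun h => h ψ hψ
  ext s
  rw [Set.mem_singleton_iff]
  constructor
  · rintro ⟨g, hg, hne, hgs⟩
    obtain ⟨ψ, hs, hψ⟩ := h.1 g hg hne
    exact (key g ψ hs hψ s).1 hgs
  · rintro rfl
    obtain ⟨g, hg, hne, ψ, -, hs, hψ⟩ := h.2 0
    exact ⟨g, hg, hne, (key g ψ hs hψ _).2 rfl⟩

/-! ### Estimates of the phase increments, nonpositive degree -/

/-- The bound for the effect of the stretching on the phase. -/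
def stretchBound (R : ℕ → ℝ) (n : ℕ) : ℝ := |stretch R n - 1| / (2 * √(stretch R n))

/-- With `r` the argument on the left, `-r - 1 / 4 = (tan (θ π) / 2) ^ 2`. -/
lemma rootArg_of_cos {θ : ℝ} (h0 : 0 ≤ θ) (h1 : θ < 1 / 2) :
    rootArg (-1 / (4 * Real.cos (θ * Real.pi) ^ 2)) = θ * Real.pi := by
  have hpi := Real.pi_pos
  have hlt : θ * Real.pi < Real.pi / 2 := by nlinarith
  have hge : 0 ≤ θ * Real.pi := by positivity
  have hc : 0 < Real.cos (θ * Real.pi) := Real.cos_pos_of_mem_Ioo ⟨by linarith, hlt⟩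
  have hs : 0 ≤ Real.sin (θ * Real.pi) :=
    Real.sin_nonneg_of_nonneg_of_le_pi hge (by linarith)
  have e : -(-1 / (4 * Real.cos (θ * Real.pi) ^ 2)) - 1 / 4 =
      (Real.tan (θ * Real.pi) / 2) ^ 2 := by
    rw [Real.tan_eq_sin_div_cos]
    field_simp
    linarith [Real.sin_sq_add_cos_sq (θ * Real.pi)]
  have ht : 0 ≤ Real.tan (θ * Real.pi) / 2 := by
    rw [Real.tan_eq_sin_div_cos]; positivity
  unfold rootArg
  rw [e, Real.sqrt_sq ht, mul_div_cancel₀ _ two_ne_zero, Real.arctan_tan (by linarith) hlt]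

lemma neg_inv_cos_lt {θ : ℝ} (h0 : 0 < θ) (h1 : θ < 1 / 2) :
    -1 / (4 * Real.cos (θ * Real.pi) ^ 2) < -1 / 4 := by
  have hpi := Real.pi_pos
  have hlt : θ * Real.pi < Real.pi / 2 := by nlinarith
  have hgt : 0 < θ * Real.pi := by positivity
  have hc : 0 < Real.cos (θ * Real.pi) := Real.cos_pos_of_mem_Ioo ⟨by linarith, hlt⟩
  have hs : 0 < Real.sin (θ * Real.pi) := Real.sin_pos_of_pos_of_lt_pi hgt (by linarith)
  have hsc := Real.sin_sq_add_cos_sq (θ * Real.pi)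
  rw [div_lt_div_iff₀ (by positivity) (by norm_num)]
  have : 0 < Real.sin (θ * Real.pi) ^ 2 := by positivity
  linarith

lemma stretch_eq_sqrt {R : ℕ → ℝ} {n : ℕ} (h : 0 ≤ -R n - 1 / 4) :
    stretch R n = √((-R (n + 1) - 1 / 4) / (-R n - 1 / 4)) := by
  unfold stretch
  rw [Real.sqrt_div' _ h]

lemma tendsto_stretch {R : ℕ → ℝ} (hpos : ∀ᶠ n in atTop, R n < -1 / 4)
    (h : Tendsto (fun n => (-R (n + 1) - 1 / 4) / (-R n - 1 / 4)) atTop (nhds 1)) :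
    Tendsto (stretch R) atTop (nhds 1) := by
  have h1 := h.sqrt
  rw [Real.sqrt_one] at h1
  refine h1.congr' ?_
  filter_upwards [hpos] with n hn
  rw [stretch_eq_sqrt (by linarith)]

lemma tendsto_stretchBound {R : ℕ → ℝ} (h : Tendsto (stretch R) atTop (nhds 1)) :
    Tendsto (stretchBound R) atTop (nhds 0) := by
  have h1 := ((h.sub_const 1).abs).div (h.sqrt.const_mul 2) (by norm_num)
  rw [sub_self, abs_zero, zero_div] at h1
  exact h1

lemma tendsto_ratio_of_lt {R : ℕ → ℝ} {a : ℝ} (ha : a < -1 / 4)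
    (hR : Tendsto R atTop (nhds a)) :
    Tendsto (fun n => (-R (n + 1) - 1 / 4) / (-R n - 1 / 4)) atTop (nhds 1) := by
  have h1 := (hR.neg).sub_const (1 / 4)
  have h2 := (h1.comp (tendsto_add_atTop_nat 1)).div h1 (by linarith)
  rwa [div_self (by linarith)] at h2

lemma continuous_rootArg : Continuous rootArg := by
  unfold rootArg
  fun_prop

lemma stretch_sub_one {R : ℕ → ℝ} {n : ℕ} (h0 : R n < -1 / 4) (h1 : R (n + 1) < -1 / 4) :
    |stretch R n - 1| = |(-R (n + 1) - 1 / 4) / (-R n - 1 / 4) - 1| / (stretch R n + 1) := by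
  have h2 : 0 < (-R (n + 1) - 1 / 4) / (-R n - 1 / 4) := div_pos (by linarith) (by linarith)
  have h3 : 0 ≤ stretch R n := by unfold stretch; positivity
  have h4 : (-R (n + 1) - 1 / 4) / (-R n - 1 / 4) = stretch R n ^ 2 := by
    rw [stretch_eq_sqrt (by linarith), Real.sq_sqrt h2.le]
  rw [h4, show stretch R n ^ 2 - 1 = (stretch R n - 1) * (stretch R n + 1) by ring, abs_mul,
    abs_of_pos (show 0 < stretch R n + 1 by linarith), mul_div_cancel_right₀]
  positivity

/-- Here `c = -rootArg' a`. Linearization costs at most `c / 4 * |R n - a|`. The stretch costs as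
much, because `R (n + 1) - R n` is small compared with `R n - a`. So the increment is close enough
to `-c * (R n - a)` to have its sign and order. -/
lemma phase_increment_estimate {R : ℕ → ℝ} {a : ℝ} (ha : a < -1 / 4)
    (hR : Tendsto R atTop (nhds a)) (h0 : ∀ᶠ n in atTop, R n - a ≠ 0)
    (h1 : Tendsto (fun n => (R (n + 1) - a) / (R n - a)) atTop (nhds 1)) :
    ∃ c : ℝ, 0 < c ∧ ∀ᶠ n in atTop,
      |rootArg (R n) - rootArg a + c * (R n - a)| + stretchBound R n ≤ c / 2 * |R n - a| := by
  obtain ⟨e, he⟩ : ∃ e, e = -a - 1 / 4 := ⟨_, rfl⟩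
  have hepos : 0 < e := by rw [he]; linarith
  obtain ⟨c, hc, hd⟩ : ∃ c : ℝ, 0 < c ∧ HasDerivAt rootArg (-c) a := by
    have h2 : HasDerivAt (fun r : ℝ => -r - 1 / 4) (-1) a :=
      ((hasDerivAt_id a).neg).sub_const (1 / 4)
    have h3 := ((h2.sqrt (by linarith)).const_mul 2).arctan
    refine ⟨-_, ?_, by rw [neg_neg]; exact h3⟩
    rw [← he]
    have : 0 < √e := Real.sqrt_pos.2 hepos
    rw [Left.neg_pos_iff]
    refine mul_neg_of_pos_of_neg (by positivity) ?_
    refine mul_neg_of_pos_of_neg two_pos ?_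
    rw [neg_div]
    exact neg_neg_of_pos (by positivity)
  refine ⟨c, hc, ?_⟩
  have hO := (hasDerivAt_iff_isLittleO.1 hd).bound (show 0 < c / 4 by positivity)
  have hlt : ∀ᶠ n in atTop, R n < -1 / 4 := hR.eventually_lt_const ha
  have hst := tendsto_stretch hlt (tendsto_ratio_of_lt ha hR)
  have hRe : ∀ᶠ n in atTop, e / 2 < -R n - 1 / 4 :=
    (hR.neg.sub_const (1 / 4)).eventually_const_lt (by linarith)
  have h1' : ∀ᶠ n in atTop, |(R (n + 1) - a) / (R n - a) - 1| < c * e / 8 := by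
    have h2 := (h1.sub_const 1).abs
    rw [sub_self, abs_zero] at h2
    exact h2.eventually_lt_const (by positivity)
  filter_upwards [hR.eventually hO, hlt, (tendsto_add_atTop_nat 1).eventually hlt, hRe, h1', h0,
    hst.eventually_const_lt (u := 1 / 4) (by norm_num)] with n h2 h3 h4 h5 h6 h7 h8
  rw [Real.norm_eq_abs, Real.norm_eq_abs, smul_eq_mul] at h2
  have h9 : |rootArg (R n) - rootArg a + c * (R n - a)| ≤ c / 4 * |R n - a| := by
    convert h2 using 2
    ring
  have hE : 0 < |R n - a| := abs_pos.2 h7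
  have h10 : stretchBound R n ≤ |stretch R n - 1| := by
    unfold stretchBound
    apply div_le_self (abs_nonneg _)
    have : 1 / 2 ≤ √(stretch R n) := by
      apply Real.le_sqrt_of_sq_le
      norm_num
      linarith
    linarith
  have h11 : |stretch R n - 1| ≤ c / 4 * |R n - a| := by
    rw [stretch_sub_one h3 h4]
    have h12 : (-R (n + 1) - 1 / 4) / (-R n - 1 / 4) - 1 =
        -((R n - a) * ((R (n + 1) - a) / (R n - a) - 1)) / (-R n - 1 / 4) := by
      have h13 : -R n - 1 / 4 ≠ 0 := by linarith
      rw [mul_sub, mul_div_cancel₀ _ h7, div_sub_one h13]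
      congr 1
      ring
    rw [h12, abs_div, abs_neg, abs_mul, abs_of_pos (show 0 < -R n - 1 / 4 by linarith), div_div,
      div_le_iff₀ (mul_pos (by linarith) (by linarith))]
    have h14 : |R n - a| * |(R (n + 1) - a) / (R n - a) - 1| ≤ |R n - a| * (c * e / 8) := by
      gcongr
    have h15 : c / 4 * |R n - a| * (e / 2) ≤
        c / 4 * |R n - a| * ((-R n - 1 / 4) * (stretch R n + 1)) := by
      refine mul_le_mul_of_nonneg_left ?_ (by positivity)
      nlinarith
    linarith
  linarith

lemma phase_step_tendsto {R ψ : ℕ → ℝ} {N : ℕ} {a c : ℝ} (hR : Tendsto R atTop (nhds a))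
    (hc : rootArg a = c) (hst : Tendsto (stretch R) atTop (nhds 1))
    (hψ : ∀ n, N ≤ n → |ψ (n + 1) - ψ n - (rootArg (R n) - c)| ≤ stretchBound R n) :
    Tendsto (fun n => ψ (n + 1) - ψ n) atTop (nhds 0) := by
  have h1 := ((continuous_rootArg.tendsto a).comp hR).sub_const c
  rw [hc, sub_self] at h1
  have h2 : Tendsto (fun n => ψ (n + 1) - ψ n - (rootArg (R n) - c)) atTop (nhds 0) := by
    refine squeeze_zero_norm' ?_ (tendsto_stretchBound hst)
    exact (eventually_ge_atTop N).mono hψ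
  have h3 := h2.add h1
  rw [add_zero] at h3
  refine h3.congr fun n => ?_
  simp only [Function.comp]
  ring

lemma tendsto_atTop_of_harmonic_step {ψ : ℕ → ℝ} {ε : ℝ} (hε : 0 < ε)
    (h : ∀ᶠ n : ℕ in atTop, ε / n ≤ ψ (n + 1) - ψ n) : Tendsto ψ atTop atTop := by
  obtain ⟨N, hN⟩ := eventually_atTop.1 h
  have hdiv : Tendsto (fun n : ℕ => ∑ i ∈ Finset.range n, ε / (i : ℝ)) atTop atTop := by
    rw [← not_summable_iff_tendsto_nat_atTop_of_nonneg (fun n => by positivity)]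
    intro hs
    refine Real.not_summable_one_div_natCast ((hs.mul_left ε⁻¹).congr fun n => ?_)
    field_simp
  have hle : ∀ n, N ≤ n →
      (ψ N - ∑ i ∈ Finset.range N, ε / (i : ℝ)) + ∑ i ∈ Finset.range n, ε / (i : ℝ) ≤ ψ n := by
    intro n hn
    induction n, hn using Nat.le_induction with
    | base => linarith
    | succ n hn ih =>
      rw [Finset.sum_range_succ]
      linarith [hN n hn]
  exact tendsto_atTop_mono' _ ((eventually_ge_atTop N).mono hle)
    (tendsto_atTop_add_const_left _ _ hdiv)

lemma RegularlyVarying.eventually_sign {F : ℕ → ℝ} {δ : ℤ} (hF : RegularlyVarying F δ) :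
    (∀ᶠ n in atTop, 0 < F n) ∨ ∀ᶠ n in atTop, F n < 0 := by
  obtain ⟨⟨c, hc, hlim⟩, -⟩ := hF
  rcases hc.lt_or_gt with h | h
  · right
    filter_upwards [hlim.eventually_lt_const h, eventually_natCast_pos] with n hn h0
    have h1 : 0 < (n : ℝ) ^ δ := by positivity
    simpa using (div_lt_iff₀ h1).1 hn
  · left
    filter_upwards [hlim.eventually_const_lt h, eventually_natCast_pos] with n hn h0
    exact (div_pos_iff_of_pos_right (by positivity)).1 hn

lemma exists_sum_Ico_lt {B : ℕ → ℝ} (hB0 : ∀ n, 0 ≤ B n) (hB : Summable B) {K : ℝ} (hK : 0 < K) :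
    ∀ᶠ N in atTop, ∀ n, ∑ i ∈ Finset.Ico N n, B i < K := by
  have hlim := hB.hasSum.tendsto_sum_nat
  filter_upwards [hlim.eventually_const_lt (u := (∑' i, B i) - K) (by linarith)] with N hN n
  rcases le_total N n with h | h
  · rw [Finset.sum_Ico_eq_sub _ h]
    have := hB.sum_le_tsum (Finset.range n) (fun i _ => hB0 i)
    linarith
  · rw [Finset.Ico_eq_empty_of_le h]
    simpa using hK

/-- Elliptic type with `θ ∈ (0, 1/2)` rational, non-constant ratio and `α₁ = 0`. -/
lemma tailSigns_of_summable {R : ℕ → ℝ} {δ : ℤ} {k r : ℕ} (hr : 0 < r) (hkr : Nat.Coprime k r)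
    {a K : ℝ} (ha : a < -1 / 4) (hrt : rootArg a = (k : ℝ) / r * Real.pi)
    (hR : Tendsto R atTop (nhds a)) (hE : RegularlyVarying (fun n => R n - a) δ)
    (hK : ∀ᶠ n : ℕ in atTop, |R n - a| ≤ K / (n : ℝ) ^ 2) :
    ∀ᶠ N in atTop, tailSigns R N = sWords k r := by
  obtain ⟨c, hc, hest⟩ := phase_increment_estimate ha hR hE.eventually_ne_zero hE.tendsto_one
  have hB : Summable fun n : ℕ => 2 * c * |K| * (1 / (n : ℝ) ^ 2) :=
    (Real.summable_one_div_nat_pow.2 one_lt_two).mul_left _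
  have hsgn : ∃ σ : ℝ, (σ = 1 ∨ σ = -1) ∧ ∀ᶠ n in atTop, σ * (R n - a) = -|R n - a| ∧
      R n - a ≠ 0 := by
    rcases hE.eventually_sign with h | h
    · exact ⟨-1, Or.inr rfl, h.mono fun n hn => ⟨by rw [abs_of_pos hn]; ring, hn.ne'⟩⟩
    · exact ⟨1, Or.inl rfl, h.mono fun n hn => ⟨by rw [abs_of_neg hn]; ring, hn.ne⟩⟩
  obtain ⟨σ, hσ, hs⟩ := hsgn
  obtain ⟨M, hM⟩ := eventually_atTop.1 (hest.and (hK.and (hs.and (hR.eventually_lt_const ha))))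
  have hr' : (0 : ℝ) < r := by exact_mod_cast hr
  -- The bound uses `2 c` in place of `3 c / 2`, and `|K|` so that all terms are nonnegative; the
  -- term at `n = 0` is 0 by the convention for division.
  filter_upwards [exists_sum_Ico_lt (fun n => by positivity) hB
    (K := Real.pi / r / 2) (by positivity), eventually_ge_atTop M] with N hN hMN
  refine tailSigns_of_oneSided hr hkr (B := fun n : ℕ => 2 * c * |K| * (1 / (n : ℝ) ^ 2)) ?_ hN
  refine (hasPhases_elliptic (fun n hn => (hM n (hMN.trans hn)).2.2.2) _).mono fun ψ hψ => ?_
  have hstep : ∀ n, N ≤ n → |ψ (n + 1) - ψ n + c * (R n - a)| ≤ c / 2 * |R n - a| := by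
    intro n hn
    have h1 := (hM n (hMN.trans hn)).1
    have h2 := hψ n hn
    rw [← hrt] at h2
    have e : ψ (n + 1) - ψ n + c * (R n - a) =
        (ψ (n + 1) - ψ n - (rootArg (R n) - rootArg a)) +
        (rootArg (R n) - rootArg a + c * (R n - a)) := by ring
    rw [e]
    refine (abs_add_le _ _).trans ?_
    have h3 : |stretch R n - 1| / (2 * √(stretch R n)) = stretchBound R n := rfl
    linarith
  have hpos : ∀ n, N ≤ n → 0 < σ * (ψ (n + 1) - ψ n) := by
    intro n hn
    have h1 := abs_le.1 (hstep n hn)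
    obtain ⟨h2, h3⟩ := (hM n (hMN.trans hn)).2.2.1
    have h4 : 0 < c * |R n - a| := mul_pos hc (abs_pos.2 h3)
    rcases hσ with rfl | rfl <;> nlinarith
  refine ⟨σ, hσ, fun n hn => ⟨(hpos n hn).le, ?_, ?_⟩⟩
  · have h1 := hpos n hn
    have h2 := hpos (n + 1) (by omega)
    calc 0 < σ * (ψ (n + 1) - ψ n) + σ * (ψ (n + 1 + 1) - ψ (n + 1)) := add_pos h1 h2
      _ = _ := by ring
  · have h1 := hstep n hn
    have h2 := (hM n (hMN.trans hn)).2.1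
    have h3 : |ψ (n + 1) - ψ n| ≤ 2 * c * |R n - a| := by
      have e : ψ (n + 1) - ψ n = (ψ (n + 1) - ψ n + c * (R n - a)) + (-(c * (R n - a))) := by ring
      rw [e]
      refine (abs_add_le _ _).trans ?_
      rw [abs_neg, abs_mul, abs_of_pos hc]
      have : 0 ≤ c * |R n - a| := by positivity
      linarith
    calc |ψ (n + 1) - ψ n| ≤ 2 * c * |R n - a| := h3
      _ ≤ 2 * c * (K / (n : ℝ) ^ 2) := by gcongr
      _ ≤ 2 * c * (|K| / (n : ℝ) ^ 2) := by gcongr; exact le_abs_self K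
      _ = _ := by ring

/-- Elliptic type with `θ ∈ (0, 1/2)` rational and constant ratio. -/
lemma tailSigns_of_eventually_const {R : ℕ → ℝ} {k r : ℕ} (hr : 2 ≤ r) (hkr : Nat.Coprime k r)
    {a : ℝ} (ha : a < -1 / 4) (hrt : rootArg a = (k : ℝ) / r * Real.pi)
    (hR : ∀ᶠ n in atTop, R n = a) :
    ∀ᶠ N in atTop, tailSigns R N = sWords k r ∪ tWords k r := by
  obtain ⟨M, hM⟩ := eventually_atTop.1 hR
  filter_upwards [eventually_ge_atTop M] with N hN
  refine tailSigns_of_const hr hkr ((hasPhases_elliptic (fun n hn => ?_) _).mono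
    fun ψ hψ n hn => ?_)
  · rw [hM n (hN.trans hn)]; exact ha
  · have h1 := hψ n hn
    have h2 : stretch R n = 1 := by
      unfold stretch
      rw [hM n (hN.trans hn), hM (n + 1) (by omega), div_self]
      exact (Real.sqrt_pos.2 (by linarith)).ne'
    rw [h2, hM n (hN.trans hn), hrt] at h1
    simp only [sub_self, abs_zero, zero_div, sub_zero] at h1
    exact sub_eq_zero.1 (abs_nonpos_iff.1 h1)

/-- Elliptic type with `θ ∈ (0, 1/2)` irrational. -/
lemma tailSigns_of_irrational {R : ℕ → ℝ} {a θ : ℝ} (ha : a < -1 / 4)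
    (hrt : rootArg a = θ * Real.pi) (hR : Tendsto R atTop (nhds a)) (hθ : Irrational θ) :
    ∀ᶠ N in atTop, tailSigns R N = {(⊥ : WithBot (List SignType))} := by
  have hlt : ∀ᶠ n in atTop, R n < -1 / 4 := hR.eventually_lt_const ha
  obtain ⟨M, hM⟩ := eventually_atTop.1 hlt
  filter_upwards [eventually_ge_atTop M] with N hN
  exact tailSigns_of_noSign (hasPhases_elliptic (fun n hn => hM n (hN.trans hn)) θ)
    (fun ψ hψ => phase_step_tendsto hR hrt (tendsto_stretch hlt (tendsto_ratio_of_lt ha hR)) hψ)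
    (Or.inl hθ)

/-- Elliptic type with `θ ∈ (0, 1/2)` and `α₁ ≠ 0`. -/
lemma tailSigns_of_drift {R : ℕ → ℝ} {a θ b : ℝ} {δ : ℤ} (ha : a < -1 / 4)
    (hrt : rootArg a = θ * Real.pi) (hR : Tendsto R atTop (nhds a))
    (hE : RegularlyVarying (fun n => R n - a) δ) (hb : b ≠ 0)
    (hlim : Tendsto (fun n : ℕ => (n : ℝ) * (R n - a)) atTop (nhds b)) :
    ∀ᶠ N in atTop, tailSigns R N = {(⊥ : WithBot (List SignType))} := by
  obtain ⟨c, hc, hest⟩ := phase_increment_estimate ha hR hE.eventually_ne_zero hE.tendsto_one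
  have hlt : ∀ᶠ n in atTop, R n < -1 / 4 := hR.eventually_lt_const ha
  obtain ⟨M, hM⟩ := eventually_atTop.1 hlt
  filter_upwards [eventually_ge_atTop M] with N hN
  refine tailSigns_of_noSign (hasPhases_elliptic (fun n hn => hM n (hN.trans hn)) θ)
    (fun ψ hψ => phase_step_tendsto hR hrt (tendsto_stretch hlt (tendsto_ratio_of_lt ha hR)) hψ)
    (Or.inr fun ψ hψ => ?_)
  have hstep : ∀ᶠ n in atTop, |ψ (n + 1) - ψ n + c * (R n - a)| ≤ c / 2 * |R n - a| := by
    filter_upwards [hest, eventually_ge_atTop N] with n h1 hn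
    have h2 := hψ n hn
    rw [← hrt] at h2
    have e : ψ (n + 1) - ψ n + c * (R n - a) =
        (ψ (n + 1) - ψ n - (rootArg (R n) - rootArg a)) +
        (rootArg (R n) - rootArg a + c * (R n - a)) := by ring
    rw [e]
    refine (abs_add_le _ _).trans ?_
    have h3 : |stretch R n - 1| / (2 * √(stretch R n)) = stretchBound R n := rfl
    linarith
  rcases hb.lt_or_gt with hb | hb
  · left
    refine tendsto_atTop_of_harmonic_step (ε := c / 2 * (-b / 2))
      (mul_pos (by positivity) (by linarith)) ?_
    filter_upwards [hstep, hlim.eventually_lt_const (show b < b / 2 by linarith),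
      eventually_natCast_pos] with n h1 h2 h3
    have h4 : R n - a < 0 := by
      by_contra! h
      have := mul_nonneg h3.le h
      linarith
    rw [abs_of_neg h4] at h1
    have h5 := (abs_le.1 h1).1
    rw [div_le_iff₀ h3]
    nlinarith
  · right
    rw [← tendsto_neg_atTop_iff]
    refine tendsto_atTop_of_harmonic_step (ε := c / 2 * (b / 2)) (by positivity) ?_
    filter_upwards [hstep, hlim.eventually_const_lt (show b / 2 < b by linarith),
      eventually_natCast_pos] with n h1 h2 h3
    have h4 : 0 < R n - a := by
      by_contra! h
      have := mul_nonpos_of_nonneg_of_nonpos h3.le h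
      linarith
    rw [abs_of_pos h4] at h1
    have h5 := (abs_le.1 h1).2
    rw [div_le_iff₀ h3]
    nlinarith

/-- The non-hyperbolic case with `θ = 0`. -/
lemma tailSigns_of_parabolic {R : ℕ → ℝ} {δ : ℤ} {s : ℝ}
    (hR : Tendsto R atTop (nhds (-1 / 4))) (hlt : ∀ᶠ n in atTop, R n < -1 / 4)
    (hE : RegularlyVarying (fun n => R n - -1 / 4) δ) (hδ : |(δ : ℝ)| ≤ 2) (hs : 1 / 4 < s)
    (hsn : ∀ᶠ n : ℕ in atTop, s ^ 2 ≤ (n : ℝ) ^ 2 * -(R n - -1 / 4)) :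
    ∀ᶠ N in atTop, tailSigns R N = {(⊥ : WithBot (List SignType))} := by
  have hratio : ∀ n, (-R (n + 1) - 1 / 4) / (-R n - 1 / 4) =
      (R (n + 1) - -1 / 4) / (R n - -1 / 4) := fun n => by
    rw [← neg_div_neg_eq]
    congr 1 <;> ring
  have hst : Tendsto (stretch R) atTop (nhds 1) :=
    tendsto_stretch hlt (hE.tendsto_one.congr fun n => (hratio n).symm)
  have hroot : rootArg (-1 / 4) = 0 * Real.pi := by
    unfold rootArg
    norm_num
  -- The squared stretch factor is `1 + δ / n + O(n ^ (-2))`; the root halves the deviation, and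
  -- `stretchBound` halves it again.
  have hB : Tendsto (fun n : ℕ => n * stretchBound R n) atTop (nhds (|(δ : ℝ)| / 4)) := by
    have h1 := hE.tendsto_mul.abs.div ((hst.add_const 1).mul (hst.sqrt.const_mul 2)) (by norm_num)
    norm_num at h1
    refine h1.congr' ?_
    filter_upwards [hlt, (tendsto_add_atTop_nat 1).eventually hlt, eventually_natCast_pos,
      hst.eventually_const_lt one_pos] with n h2 h3 h4 h5
    have h6 : 0 < √(stretch R n) := Real.sqrt_pos.2 h5
    rw [Pi.div_apply, stretchBound, stretch_sub_one h2 h3, hratio, ← abs_of_pos h4, ← abs_mul,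
      abs_of_pos h4]
    simp only [abs_mul, abs_of_pos h4]
    rw [div_div, mul_div_assoc]
    norm_num
  have harc : Tendsto (fun n : ℕ => (n : ℝ) * Real.arctan (2 * s / n)) atTop (nhds (2 * s)) := by
    have h1 : Tendsto (fun n : ℕ => 2 * s / (n : ℝ)) atTop (nhdsWithin 0 {0}ᶜ) := by
      refine tendsto_nhdsWithin_iff.2 ⟨?_, ?_⟩
      · simpa [div_eq_mul_inv] using tendsto_inv_natCast.const_mul (2 * s)
      · filter_upwards [eventually_natCast_pos] with n hn
        have : 0 < 2 * s / (n : ℝ) := by positivity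
        exact this.ne'
    have h2 := ((hasDerivAt_iff_tendsto_slope_zero.1 (Real.hasDerivAt_arctan 0)).comp h1).const_mul
      (2 * s)
    norm_num at h2
    refine h2.congr' ?_
    filter_upwards [eventually_natCast_pos] with n hn
    have hs0 : 2 * s ≠ 0 := by linarith
    field_simp
  -- The rotation is at least about `2 s / n` and the stretch costs about `|δ| / (4 n) ≤ 1 / (2 n)`.
  -- The forward drift is therefore harmonic as soon as `s > 1 / 4`, which is the origin of the
  -- threshold `-1 / 16`.
  have hgap := (harc.sub hB).eventually_const_lt (u := (2 * s - 1 / 2) / 2) (by linarith)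
  obtain ⟨M, hM⟩ := eventually_atTop.1 hlt
  filter_upwards [eventually_ge_atTop M] with N hN
  refine tailSigns_of_noSign (hasPhases_elliptic (fun n hn => hM n (hN.trans hn)) 0)
    (fun ψ hψ => phase_step_tendsto hR hroot hst hψ) (Or.inr fun ψ hψ => Or.inl ?_)
  refine tendsto_atTop_of_harmonic_step (ε := (2 * s - 1 / 2) / 2) (by linarith) ?_
  filter_upwards [hgap, hsn, eventually_natCast_pos, eventually_ge_atTop N] with n h1 h2 h3 h4
  have h5 := (abs_le.1 (hψ n h4)).1
  rw [zero_mul, sub_zero] at h5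
  have h6 : |stretch R n - 1| / (2 * √(stretch R n)) = stretchBound R n := rfl
  rw [h6] at h5
  have h7 : Real.arctan (2 * s / n) ≤ rootArg (R n) := by
    unfold rootArg
    apply Real.arctan_mono
    rw [mul_div_assoc]
    refine mul_le_mul_of_nonneg_left ?_ two_pos.le
    apply Real.le_sqrt_of_sq_le
    rw [div_pow, div_le_iff₀ (by positivity)]
    calc s ^ 2 ≤ _ := h2
      _ = _ := by ring
  rw [div_le_iff₀ h3]
  have h8 := mul_le_mul_of_nonneg_left h7 h3.le
  have h9 := mul_le_mul_of_nonneg_left h5 h3.le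
  nlinarith

/-! ### Estimates of the phase increments, positive degree -/

/-- The two consecutive losses are proportional to `cos φ ^ 2` and `sin (φ - d) ^ 2`, where `d ≤ 2 η
n ≤ 1 / 4`. Their sum is at least `1 - d`, so they cannot both be small. -/
lemma shear_two_step {η ψ : ℕ → ℝ} {n : ℕ} (h0 : 0 < η n) (h1 : 0 < η (n + 1))
    (hη : η n ≤ 1 / 8)
    (hψ : η n * Real.cos (n * (1 / 2 * Real.pi) + ψ n) ^ 2 / 3 ≤ ψ n - ψ (n + 1))
    (hψ' : ψ n - ψ (n + 1) ≤ 2 * η n)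
    (hψ1 : η (n + 1) * Real.cos ((n + 1 : ℕ) * (1 / 2 * Real.pi) + ψ (n + 1)) ^ 2 / 3 ≤
      ψ (n + 1) - ψ (n + 2)) :
    min (η n) (η (n + 1)) / 6 ≤ ψ n - ψ (n + 2) := by
  obtain ⟨φ, hφ⟩ : ∃ φ, φ = n * (1 / 2 * Real.pi) + ψ n := ⟨_, rfl⟩
  obtain ⟨d, hd⟩ : ∃ d, d = ψ n - ψ (n + 1) := ⟨_, rfl⟩
  have hcos : Real.cos ((n + 1 : ℕ) * (1 / 2 * Real.pi) + ψ (n + 1)) = - Real.sin (φ - d) := by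
    rw [← Real.cos_add_pi_div_two, hφ, hd]
    congr 1
    push_cast
    ring
  rw [← hφ] at hψ
  rw [hcos, neg_sq] at hψ1
  have hd0 : 0 ≤ d := by
    rw [hd]; exact le_trans (by positivity) hψ
  have hsin : Real.sin φ ^ 2 - d ≤ Real.sin (φ - d) ^ 2 := by
    have e : Real.sin φ ^ 2 - Real.sin (φ - d) ^ 2 = Real.sin (φ + (φ - d)) * Real.sin d := by
      have h2 : Real.sin d = Real.sin (φ - (φ - d)) := by ring_nf
      rw [h2, Real.sin_add, Real.sin_sub φ (φ - d)]
      have h3 := Real.sin_sq_add_cos_sq φ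
      have h4 := Real.sin_sq_add_cos_sq (φ - d)
      linear_combination Real.sin (φ - d) ^ 2 * h3 - Real.sin φ ^ 2 * h4
    have h2 : Real.sin (φ + (φ - d)) * Real.sin d ≤ d := by
      refine (le_abs_self _).trans ?_
      rw [abs_mul]
      have h3 := Real.abs_sin_le_one (φ + (φ - d))
      have h4 : |Real.sin d| ≤ |d| := Real.abs_sin_le_abs
      rw [abs_of_nonneg hd0] at h4
      calc _ ≤ 1 * d := mul_le_mul h3 h4 (abs_nonneg _) zero_le_one
        _ = d := one_mul d
    linarith
  have hs := Real.sin_sq_add_cos_sq φ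
  have hm0 : 0 < min (η n) (η (n + 1)) := lt_min h0 h1
  have h2 : min (η n) (η (n + 1)) * Real.cos φ ^ 2 ≤ η n * Real.cos φ ^ 2 := by
    gcongr; exact min_le_left _ _
  have h3 : min (η n) (η (n + 1)) * Real.sin (φ - d) ^ 2 ≤ η (n + 1) * Real.sin (φ - d) ^ 2 := by
    gcongr; exact min_le_right _ _
  have h4 : 1 / 2 ≤ Real.cos φ ^ 2 + Real.sin (φ - d) ^ 2 := by linarith
  have h5 := mul_le_mul_of_nonneg_left h4 hm0.le
  linarith

/-- The scaling data for a recurrence with coefficients of positive degree: the solution `p` of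
`p (n + 2) = -R n * p n`, and the bounds for `η n = p (n + 1) / p (n + 2)`. -/
lemma exists_shear_scaling {R : ℕ → ℝ} {N : ℕ} (hneg : ∀ n, N ≤ n → R n < 0) :
    ∃ p η : ℕ → ℝ, (∀ n, N ≤ n → 0 < p n) ∧ (∀ n, N ≤ n → p (n + 2) = -R n * p n) ∧
      (∀ n, η n = p (n + 1) / p (n + 2)) ∧ (∀ n, N ≤ n → 0 < η n) ∧
      ∀ n, N ≤ n → η n = η (n + 2) * (R (n + 2) / R (n + 1)) := by
  obtain ⟨p, p0, p1, hp⟩ := exists_recurrence_from (fun _ => 0) (fun n => -R n) N 1 1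
  have hp' : ∀ n, N ≤ n → p (n + 2) = -R n * p n := fun n hn => by rw [hp n hn]; ring
  have hpos2 : ∀ n, N ≤ n → 0 < p n ∧ 0 < p (n + 1) := by
    intro n hn
    induction n, hn using Nat.le_induction with
    | base => simp [p0, p1]
    | succ n hn ih =>
      refine ⟨ih.2, ?_⟩
      rw [hp' n hn]
      exact mul_pos (neg_pos.2 (hneg n hn)) ih.1
  have hpos : ∀ n, N ≤ n → 0 < p n := fun n hn => (hpos2 n hn).1
  refine ⟨p, fun n => p (n + 1) / p (n + 2), hpos, hp', fun n => rfl,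
    fun n hn => div_pos (hpos _ (by omega)) (hpos _ (by omega)), fun n hn => ?_⟩
  have h1 := hpos (n + 1) (by omega)
  have h2 := hpos (n + 2) (by omega)
  have h3 := (hneg (n + 1) (by omega)).ne
  have h4 := (hneg (n + 2) (by omega)).ne
  have e1 : p (n + 2 + 1) = -R (n + 1) * p (n + 1) := hp' (n + 1) (by omega)
  have e2 : p (n + 2 + 2) = -R (n + 2) * p (n + 2) := hp' (n + 2) (by omega)
  beta_reduce
  rw [e1, e2]
  field_simp

lemma RegularlyVarying.tendsto_shift_mul {F : ℕ → ℝ} {δ : ℤ} (hF : RegularlyVarying F δ) :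
    Tendsto (fun n : ℕ => (n : ℝ) * (F (n + 2) / F (n + 1) - 1)) atTop (nhds δ) := by
  have h1 := hF.tendsto_mul.comp (tendsto_add_atTop_nat 1)
  have h2 := (hF.tendsto_one.comp (tendsto_add_atTop_nat 1)).sub_const 1
  have h3 := h1.sub h2
  rw [sub_self, sub_zero] at h3
  refine h3.congr fun n => ?_
  simp only [Function.comp]
  push_cast
  ring

/-- Already for `d ≥ 1`, `n * η n ^ 4` is nonincreasing along each parity class for large `n`,
whence `η n = O(n ^ (-1 / 4))`. -/
lemma tendsto_zero_of_shear {R η : ℕ → ℝ} {N : ℕ} {d : ℝ} (hd : 1 ≤ d)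
    (hlim : Tendsto (fun n : ℕ => (n : ℝ) * (R (n + 2) / R (n + 1) - 1)) atTop (nhds d))
    (hpos : ∀ n, N ≤ n → 0 < η n)
    (hη : ∀ n, N ≤ n → η n = η (n + 2) * (R (n + 2) / R (n + 1))) :
    Tendsto η atTop (nhds 0) := by
  obtain ⟨M, hM⟩ := eventually_atTop.1 ((hlim.eventually_const_lt (u := 1 / 2) (by linarith)).and
    ((eventually_ge_atTop N).and eventually_natCast_pos))
  have hstep : ∀ n, M ≤ n → ((n + 2 : ℕ) : ℝ) * η (n + 2) ^ 4 ≤ (n : ℝ) * η n ^ 4 := by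
    intro n hn
    obtain ⟨h1, h2, h3⟩ := hM n hn
    have h4 := hpos (n + 2) (by omega)
    rw [hη n h2]
    generalize R (n + 2) / R (n + 1) = t at h1 ⊢
    have h5 : 1 + 1 / (2 * (n : ℝ)) ≤ t := by
      have : 1 / (2 * (n : ℝ)) < t - 1 := by
        rw [div_lt_iff₀ (by positivity)]
        linarith
      linarith
    -- Bernoulli's inequality; the fourth power turns the safe rate `1 / (2 n)` into the `2 / n`
    -- needed for a shift by 2.
    have h6 : 1 + 2 / (n : ℝ) ≤ t ^ 4 := by
      calc 1 + 2 / (n : ℝ) = 1 + (4 : ℕ) * (1 / (2 * (n : ℝ))) := by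
            push_cast; field_simp; ring
        _ ≤ (1 + 1 / (2 * (n : ℝ))) ^ 4 :=
            one_add_mul_le_pow (by have : 0 < 1 / (2 * (n : ℝ)) := by positivity
                                   linarith) 4
        _ ≤ t ^ 4 := by gcongr
    have h7 : (n : ℝ) + 2 ≤ n * t ^ 4 := by
      have := mul_le_mul_of_nonneg_left h6 h3.le
      have e : (n : ℝ) * (1 + 2 / (n : ℝ)) = n + 2 := by field_simp
      linarith
    push_cast
    calc ((n : ℝ) + 2) * η (n + 2) ^ 4 ≤ (n * t ^ 4) * η (n + 2) ^ 4 := by gcongr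
      _ = _ := by ring
  obtain ⟨K, hK⟩ : ∃ K : ℝ, ∀ n, M ≤ n → (n : ℝ) * η n ^ 4 ≤ K ∧
      ((n + 1 : ℕ) : ℝ) * η (n + 1) ^ 4 ≤ K := by
    refine ⟨max ((M : ℝ) * η M ^ 4) (((M + 1 : ℕ) : ℝ) * η (M + 1) ^ 4), fun n hn => ?_⟩
    induction n, hn using Nat.le_induction with
    | base => exact ⟨le_max_left _ _, le_max_right _ _⟩
    | succ n hn ih => exact ⟨ih.2, (hstep n hn).trans ih.1⟩
  have h4 : Tendsto (fun n => η n ^ 4) atTop (nhds 0) := by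
    have hlim0 : Tendsto (fun n : ℕ => K * (n : ℝ)⁻¹) atTop (nhds 0) := by
      simpa using tendsto_inv_natCast.const_mul K
    refine squeeze_zero' (Eventually.of_forall fun n => by positivity) ?_ hlim0
    filter_upwards [eventually_ge_atTop M, eventually_natCast_pos] with n h1 h2
    rw [← div_eq_mul_inv, le_div_iff₀ h2, mul_comm]
    exact (hK n h1).1
  rw [tendsto_order]
  refine ⟨fun a ha => (eventually_ge_atTop N).mono fun n hn => ha.trans (hpos n hn),
    fun a ha => ?_⟩
  filter_upwards [h4.eventually_lt_const (show 0 < a ^ 4 by positivity)] with n hn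
  exact lt_of_pow_lt_pow_left₀ 4 ha.le hn

/-- Elliptic type of degree greater than two. -/
lemma tailSigns_of_two_lt {R : ℕ → ℝ} {δ : ℤ} (hneg : ∀ᶠ n in atTop, R n < 0)
    (hR : RegularlyVarying R δ) (hδ : 2 < δ) :
    ∀ᶠ N in atTop, tailSigns R N = sWords 1 2 := by
  obtain ⟨N₀, hN₀⟩ := eventually_atTop.1 hneg
  obtain ⟨p, η, hp, hrec, hηp, hpos, hη⟩ := exists_shear_scaling hN₀
  have hlim := hR.tendsto_shift_mul
  have hδ3 : (3 : ℝ) ≤ δ := by exact_mod_cast hδ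
  have hη0 := tendsto_zero_of_shear (by linarith) hlim hpos hη
  obtain ⟨M, hM⟩ := eventually_atTop.1 ((hlim.eventually_const_lt (u := 5 / 2) (by linarith)).and
    ((eventually_ge_atTop N₀).and (hη0.eventually_lt_const (show (0 : ℝ) < 1 / 8 by norm_num))))
  have hsum : Summable fun n => 2 * η (n + M) := by
    rw [← summable_nat_add_iff 2]
    -- Raabe's test by telescoping: `T n - T (n + 1)` is `η (n + M + 2)` times a quantity tending to
    -- `δ - 2 ≥ 1`, hence eventually above `1 / 2`. The two summands of `T` cover both parity
    -- classes.
    obtain ⟨T, hT⟩ : ∃ T : ℕ → ℝ, ∀ n : ℕ, T n = ((n + M : ℕ) : ℝ) * η (n + M) +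
        ((n + 1 + M : ℕ) : ℝ) * η (n + 1 + M) := ⟨_, fun n => rfl⟩
    have hT0 : ∀ n, 0 ≤ T n := fun n => by
      rw [hT]
      have h1 := hpos (n + M) ((hM M le_rfl).2.1.trans (by omega))
      have h2 := hpos (n + 1 + M) ((hM M le_rfl).2.1.trans (by omega))
      positivity
    refine summable_of_sum_range_le (c := 4 * T 0) (fun n => ?_) fun n => ?_
    · have h1 := hpos (n + 2 + M) ((hM M le_rfl).2.1.trans (by omega))
      positivity
    · suffices h : ∑ i ∈ Finset.range n, 2 * η (i + 2 + M) ≤ 4 * T 0 - 4 * T n by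
        linarith [hT0 n]
      induction n with
      | zero => simp
      | succ n ih =>
        rw [Finset.sum_range_succ]
        obtain ⟨h1, h2, h3⟩ := hM (n + M) (by omega)
        have h4 := hη (n + M) h2
        have h5 := hpos (n + M + 2) (by omega)
        have e1 : n + 2 + M = n + M + 2 := by ring
        have e2 : n + 1 + 1 + M = n + M + 2 := by ring
        have e3 : T n - T (n + 1) = ((n + M : ℕ) : ℝ) * η (n + M) -
            ((n + M + 2 : ℕ) : ℝ) * η (n + M + 2) := by
          rw [hT, hT, e2]; ring
        rw [h4] at e3
        have e4 : T n - T (n + 1) = η (n + M + 2) *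
            (((n + M : ℕ) : ℝ) * (R (n + M + 2) / R (n + M + 1) - 1) - 2) := by
          rw [e3]; push_cast; ring
        have h6 : η (n + M + 2) * (1 / 2) ≤ T n - T (n + 1) := by
          rw [e4]
          exact mul_le_mul_of_nonneg_left (by linarith) h5.le
        rw [e1]
        linarith
  have hB0 : ∀ n, 0 ≤ 2 * |η n| := fun n => by positivity
  have hsum' : Summable fun n => 2 * |η n| := by
    rw [← summable_nat_add_iff M]
    refine hsum.congr fun n => ?_
    rw [abs_of_pos (hpos _ ((hM M le_rfl).2.1.trans (by omega)))]
  filter_upwards [exists_sum_Ico_lt hB0 hsum' (K := Real.pi / (2 : ℕ) / 2)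
    (by have := Real.pi_pos; positivity), eventually_ge_atTop M] with N hN hMN
  have hNN : N₀ ≤ N := (hM M le_rfl).2.1.trans hMN
  refine tailSigns_of_oneSided two_pos (by norm_num) (B := fun n => 2 * |η n|) ?_ hN
  have hph := (hasPhases_shear (fun n hn => hp n (hNN.trans hn))
    (fun n hn => hrec n (hNN.trans hn))
    (fun n hn => by rw [← hηp]; linarith [(hM n (hMN.trans hn)).2.2]))
  push_cast
  refine hph.mono fun ψ hψ => ⟨-1, Or.inr rfl, fun n hn => ?_⟩
  simp only [← hηp] at hψ
  have hη1 := hpos n (hNN.trans hn)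
  have hη2 := hpos (n + 1) (by omega)
  obtain ⟨h1, h2⟩ := hψ n hn
  have h3 := (hψ (n + 1) (by omega)).1
  have h4 : 0 ≤ ψ n - ψ (n + 1) := le_trans (by positivity) h1
  refine ⟨by linarith, ?_, ?_⟩
  · have h5 := shear_two_step hη1 hη2 (hM n (hMN.trans hn)).2.2.le h1 h2 h3
    have h6 : 0 < min (η n) (η (n + 1)) := lt_min hη1 hη2
    linarith
  · beta_reduce
    rw [abs_of_pos hη1, abs_sub_comm, abs_of_nonneg h4]
    exact h2

/-- Elliptic type of degree one or two. -/
lemma tailSigns_of_le_two {R : ℕ → ℝ} {δ : ℤ} (hneg : ∀ᶠ n in atTop, R n < 0)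
    (hR : RegularlyVarying R δ) (hδ1 : 1 ≤ δ) (hδ2 : δ ≤ 2) :
    ∀ᶠ N in atTop, tailSigns R N = {(⊥ : WithBot (List SignType))} := by
  obtain ⟨N₀, hN₀⟩ := eventually_atTop.1 hneg
  obtain ⟨p, η, hp, hrec, hηp, hpos, hη⟩ := exists_shear_scaling hN₀
  have hlim := hR.tendsto_shift_mul
  have hδ1' : (1 : ℝ) ≤ δ := by exact_mod_cast hδ1
  have hδ2' : (δ : ℝ) ≤ 2 := by exact_mod_cast hδ2
  have hη0 := tendsto_zero_of_shear hδ1' hlim hpos hη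
  obtain ⟨K, hK, hKb⟩ := IsBigO.exists_pos hR.2
  have hKb' := (tendsto_add_atTop_nat 1).eventually hKb.bound
  obtain ⟨M, hM⟩ := eventually_atTop.1 (hKb'.and ((eventually_ge_atTop N₀).and
    ((hη0.eventually_lt_const (show (0 : ℝ) < 1 / 8 by norm_num)).and
    (tendsto_natCast_real.eventually_gt_atTop K))))
  -- The shift by `K` absorbs the `O(n ^ (-2))` error of the ratio. Monotonicity along each parity
  -- class then bounds `η n` below by a multiple of `1 / n`, so the drift diverges.
  have hstep : ∀ n, M ≤ n → ((n : ℝ) - K) * η n ≤ (((n + 2 : ℕ) : ℝ) - K) * η (n + 2) := by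
    intro n hn
    obtain ⟨h1, h2, h3, h4⟩ := hM n hn
    have h5 := hpos (n + 2) (by omega)
    have h0 : (0 : ℝ) < n := hK.trans h4
    have h6 : R (n + 2) / R (n + 1) ≤ 1 + 2 / n + K / (n : ℝ) ^ 2 := by
      rw [Real.norm_eq_abs, Real.norm_of_nonneg (by positivity)] at h1
      have h7 := (abs_le.1 h1).2
      have e : R (n + 1 + 1) = R (n + 2) := rfl
      rw [e] at h7
      push_cast at h7
      have h8 : (δ : ℝ) / ((n : ℝ) + 1) ≤ 2 / n := by gcongr; linarith
      have h9 : K * (((n : ℝ) + 1) ^ 2)⁻¹ ≤ K / (n : ℝ) ^ 2 := by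
        rw [← div_eq_mul_inv]
        gcongr
        linarith
      linarith
    rw [hη n h2]
    have h7 : ((n : ℝ) - K) * (R (n + 2) / R (n + 1)) ≤ (n : ℝ) + 2 - K := by
      have h8 := mul_le_mul_of_nonneg_left h6 (sub_nonneg.2 h4.le)
      have e : ((n : ℝ) - K) * (1 + 2 / n + K / (n : ℝ) ^ 2) =
          n + 2 - K - (K / n + K ^ 2 / (n : ℝ) ^ 2) := by
        field_simp
        ring
      have h9 : 0 ≤ K / n + K ^ 2 / (n : ℝ) ^ 2 := by positivity
      linarith
    push_cast
    nlinarith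
  obtain ⟨ε, hε, hεη⟩ : ∃ ε : ℝ, 0 < ε ∧ ∀ n, M ≤ n → ε ≤ ((n : ℝ) - K) * η n ∧
      ε ≤ (((n + 1 : ℕ) : ℝ) - K) * η (n + 1) := by
    have hMK := (hM M le_rfl).2.2.2
    have hMN := (hM M le_rfl).2.1
    refine ⟨min (((M : ℝ) - K) * η M) ((((M + 1 : ℕ) : ℝ) - K) * η (M + 1)), lt_min ?_ ?_,
      fun n hn => ?_⟩
    · exact mul_pos (by linarith) (hpos M hMN)
    · exact mul_pos (by push_cast; linarith) (hpos (M + 1) (by omega))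
    · induction n, hn using Nat.le_induction with
      | base => exact ⟨min_le_left _ _, min_le_right _ _⟩
      | succ n hn ih => exact ⟨ih.2, ih.1.trans (hstep n hn)⟩
  have hlow : ∀ n, M ≤ n → ε / ((n : ℝ) + 1) ≤ min (η n) (η (n + 1)) := by
    intro n hn
    obtain ⟨h1, h2⟩ := hεη n hn
    obtain ⟨-, h3, -, h4⟩ := hM n hn
    have h5 := hpos n h3
    have h6 := hpos (n + 1) (by omega)
    push_cast at h2
    refine le_min ?_ ?_
    · rw [div_le_iff₀ (by positivity)]
      nlinarith
    · rw [div_le_iff₀ (by positivity)]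
      nlinarith
  filter_upwards [eventually_ge_atTop M] with N hMN
  have hNN : N₀ ≤ N := (hM M le_rfl).2.1.trans hMN
  have hph := (hasPhases_shear (fun n hn => hp n (hNN.trans hn))
    (fun n hn => hrec n (hNN.trans hn))
    (fun n hn => by rw [← hηp]; linarith [(hM n (hMN.trans hn)).2.2.1]))
  simp only [← hηp] at hph
  have hanti : ∀ ψ : ℕ → ℝ, (∀ n, N ≤ n →
      η n * Real.cos (n * (1 / 2 * Real.pi) + ψ n) ^ 2 / 3 ≤ ψ n - ψ (n + 1) ∧
      ψ n - ψ (n + 1) ≤ 2 * η n) → ∀ n, N ≤ n → 0 ≤ ψ n - ψ (n + 1) := fun ψ hψ n hn => by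
    have := hpos n (hNN.trans hn)
    exact le_trans (by positivity) (hψ n hn).1
  refine tailSigns_of_noSign hph (fun ψ hψ => ?_) (Or.inr fun ψ hψ => Or.inr ?_)
  · have h2 : Tendsto (fun n => 2 * η n) atTop (nhds 0) := by simpa using hη0.const_mul 2
    refine squeeze_zero_norm' ?_ h2
    filter_upwards [eventually_ge_atTop N] with n hn
    rw [Real.norm_eq_abs, abs_sub_comm, abs_of_nonneg (hanti ψ hψ n hn)]
    exact (hψ n hn).2
  · rw [← tendsto_neg_atTop_iff, ← tendsto_add_atTop_iff_nat 1]
    -- The step of this sum is the two-step loss `ψ n - ψ (n + 2)`, which is bounded below even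
    -- where single steps degenerate.
    have h1 : Tendsto (fun n => - ψ n - ψ (n + 1)) atTop atTop := by
      refine tendsto_atTop_of_harmonic_step (ε := ε / 12) (by positivity) ?_
      filter_upwards [eventually_ge_atTop N, eventually_ge_atTop 1] with n hn hn1
      have h2 := shear_two_step (hpos n (hNN.trans hn)) (hpos (n + 1) (by omega))
        (hM n (hMN.trans hn)).2.2.1.le (hψ n hn).1 (hψ n hn).2 (hψ (n + 1) (by omega)).1
      have h3 := hlow n (hMN.trans hn)
      have h4 : (1 : ℝ) ≤ n := by exact_mod_cast hn1
      have h5 : ε / 12 / n ≤ ε / ((n : ℝ) + 1) / 6 := by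
        rw [div_div, div_div, div_le_div_iff₀ (by positivity) (by positivity)]
        nlinarith
      have e : ψ (n + 1 + 1) = ψ (n + 2) := rfl
      rw [e]
      linarith
    refine tendsto_atTop_mono' _ ?_ (h1.atTop_div_const (two_pos : (0 : ℝ) < 2))
    filter_upwards [eventually_ge_atTop N] with n hn
    have := hanti ψ hψ n hn
    linarith

/-! ### The classification -/

lemma RatHasUltimateSign.eventually_sign {R : RatFunc ℝ} {a : SignType}
    (h : RatHasUltimateSign R a) : ∀ᶠ n : ℕ in atTop, SignType.sign (value R n) = a := by
  obtain ⟨N, -, hN⟩ := h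
  refine eventually_atTop.2 ⟨N, fun n hn => ?_⟩
  have := hN n hn
  simpa [Nat.mod_one] using this.symm

lemma value_ne_zero {R : RatFunc ℝ} (h0 : NoPolesInNat R) (h1 : NoZerosInNat R) (n : ℕ) :
    value R n ≠ 0 := by
  rw [value_eq_div]
  exact div_ne_zero (h1 n) (h0 n)

lemma ne_zero_of_noZerosInNat {R : RatFunc ℝ} (h : NoZerosInNat R) : R ≠ 0 := by
  rintro rfl
  exact h 0 (by simp)

lemma eventually_shortestSigns_eq {P Q : RatFunc ℝ} (hP : NoZerosInNat P)
    (hQ : NoPolesInNat Q) (hQ' : NoZerosInNat Q) (hs : RatHasUltimateSign P 1) :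
    ∀ᶠ N in atTop, shortestSigns P Q = tailSigns (fun n : ℕ => value (ratio P Q) n) N := by
  obtain ⟨M, hM⟩ := eventually_atTop.1 hs.eventually_sign
  obtain ⟨M', hM'⟩ := eventually_atTop.1 (tendsto_natCast_real.eventually
    (eventually_value_ratio (ne_zero_of_noZerosInNat hP) Q))
  filter_upwards [eventually_ge_atTop (M + 1), eventually_ge_atTop M'] with N h1 h2
  refine shortestSigns_eq_tailSigns P Q (value_ne_zero hQ hQ') (fun n hn => ?_)
    (fun n hn => hM' n (h2.trans hn))
  have h3 := hM (n - 1) (by omega)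
  rw [sign_eq_one_iff, Nat.cast_sub (by omega), Nat.cast_one] at h3
  exact h3

lemma ratio_sub_const_regularlyVarying {R : RatFunc ℝ} {a : ℝ} (h : R ≠ RatFunc.C a) :
    RegularlyVarying (fun n : ℕ => value R n - a) (R - RatFunc.C a).intDegree :=
  (regularlyVarying_value (sub_ne_zero.2 h)).congr
    (tendsto_natCast_real.eventually (eventually_value_sub_const R a))

lemma value_C (a x : ℝ) : value (RatFunc.C a) x = a := by
  simp [value]

lemma ne_C_of_tendsto {R : RatFunc ℝ} {a b : ℝ} {u : ℕ → ℝ} (hb : b ≠ 0)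
    (h : Tendsto (fun n : ℕ => u n * (value R n - a)) atTop (nhds b)) : R ≠ RatFunc.C a := by
  rintro rfl
  simp only [value_C, sub_self, mul_zero] at h
  exact hb (tendsto_nhds_unique h tendsto_const_nhds)

lemma RegularlyVarying.nonpos_of_tendsto_zero {F : ℕ → ℝ} {δ : ℤ} (hF : RegularlyVarying F δ)
    (h : Tendsto F atTop (nhds 0)) : δ ≤ 0 := by
  obtain ⟨⟨c, hc, hlim⟩, -⟩ := hF
  by_contra! hδ
  refine hc (tendsto_nhds_unique hlim ?_)
  refine squeeze_zero_norm' ?_ (by simpa using h.abs)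
  filter_upwards [eventually_ge_atTop 1] with n hn
  have h1 : (1 : ℝ) ≤ n := by exact_mod_cast hn
  rw [Real.norm_eq_abs, abs_div, abs_of_pos (show (0 : ℝ) < (n : ℝ) ^ δ by positivity)]
  exact div_le_self (abs_nonneg _) (one_le_zpow₀ h1 hδ.le)

/-- As `δ` is an integer, `δ < -2` would give `n ^ 2 * F n = O(1 / n)`. -/
lemma RegularlyVarying.ge_neg_two {F : ℕ → ℝ} {δ : ℤ} {ε : ℝ} (hF : RegularlyVarying F δ)
    (hε : 0 < ε) (h : ∀ᶠ n : ℕ in atTop, ε ≤ |(n : ℝ) ^ 2 * F n|) : -2 ≤ δ := by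
  obtain ⟨⟨c, hc, hlim⟩, -⟩ := hF
  by_contra! hδ
  have h0 : Tendsto (fun n : ℕ => (n : ℝ) ^ 2 * F n) atTop (nhds 0) := by
    have h1 : Tendsto (fun n : ℕ => |F n / (n : ℝ) ^ δ| * (n : ℝ)⁻¹) atTop (nhds 0) := by
      simpa using hlim.abs.mul tendsto_inv_natCast
    refine squeeze_zero_norm' ?_ h1
    filter_upwards [eventually_ge_atTop 1] with n hn
    have h1 : (1 : ℝ) ≤ n := by exact_mod_cast hn
    have h2 : (n : ℝ) ^ 2 * F n = (F n / (n : ℝ) ^ δ) * (n : ℝ) ^ (δ + 2) := by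
      rw [zpow_add₀ (by positivity)]
      field_simp
    rw [h2, Real.norm_eq_abs, abs_mul]
    refine mul_le_mul_of_nonneg_left ?_ (abs_nonneg _)
    rw [abs_of_nonneg (by positivity), ← zpow_neg_one]
    exact zpow_le_zpow_right₀ h1 (by omega)
  have h1 := h0.abs
  rw [abs_zero] at h1
  obtain ⟨n, h2, h3⟩ := (h.and (h1.eventually_lt_const hε)).exists
  linarith

lemma hyperbolic_tailSigns {P Q : RatFunc ℝ} (h : IsHyperbolic P Q) :
    ∀ᶠ N in atTop, tailSigns (fun n : ℕ => value (ratio P Q) n) N =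
      {(([1] : List SignType) : WithBot (List SignType)),
         (([-1] : List SignType) : WithBot (List SignType))} := by
  obtain ⟨hs, -, a, b, c, hexp, hl⟩ := h
  obtain ⟨K, -, hK⟩ := hexp.hyperbolic_bound hl
  obtain ⟨m, hm⟩ := exists_shift_bound K
  obtain ⟨M, hM⟩ := eventually_atTop.1 (hs.eventually_sign.and (hK.and hm))
  filter_upwards [eventually_ge_atTop M, tendsto_natCast_real.eventually_gt_atTop m] with N h1 h2
  obtain ⟨G, hG, hpos⟩ := exists_positive_solution (R := fun n : ℕ => value (ratio P Q) n) h2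
    (fun n hn => (hM n (h1.trans hn)).2.1.trans (hM n (h1.trans hn)).2.2)
  exact tailSigns_of_positive_solution
    (fun n hn => sign_eq_neg_one_iff.1 (hM n (h1.trans hn)).1) hG hpos

lemma HasExpansion.sq_bound {R : RatFunc ℝ} {a c : ℝ} (h : HasExpansion R a 0 c) :
    ∃ K : ℝ, ∀ᶠ n : ℕ in atTop, |value R n - a| ≤ K / (n : ℝ) ^ 2 := by
  refine ⟨|c| + 1, ?_⟩
  filter_upwards [h.tendsto_scaled.abs.eventually_lt_const (lt_add_one |c|),
    eventually_natCast_pos] with n hn h0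
  rw [zero_div, sub_zero, abs_mul, abs_of_pos (by positivity)] at hn
  rw [le_div_iff₀ (by positivity), mul_comm]
  exact hn.le

/-- Failure of the lexicographic bound at `α₀ = -1 / 4` forces `n ^ 2 * (-1 / 4 - R n)` to stay
above some `s ^ 2 > 1 / 16`. This also confines the degree of `R + 1 / 4` to `[-2, 0]`, as the drift
estimate requires. -/
lemma nonHyperbolic_parabolic {R : RatFunc ℝ} {b c : ℝ} (hexp : HasExpansion R (-1 / 4) b c)
    (hl : ¬ LexBound (-1 / 4) b c) :
    ∀ᶠ N in atTop, tailSigns (fun n : ℕ => value R n) N = {(⊥ : WithBot (List SignType))} := by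
  rw [lexBound_iff] at hl
  push Not at hl
  have hbc : b < 0 ∨ b = 0 ∧ c < -1 / 16 := by
    obtain ⟨h1, h2⟩ := hl.2 rfl
    rcases h1.lt_or_eq with h | h
    · exact Or.inl h
    · exact Or.inr ⟨h, h2 h⟩
  obtain ⟨s, hs, hsn⟩ : ∃ s : ℝ, 1 / 4 < s ∧
      ∀ᶠ n : ℕ in atTop, s ^ 2 ≤ (n : ℝ) ^ 2 * -(value R n - -1 / 4) := by
    rcases hbc with hb | ⟨rfl, hc⟩
    · refine ⟨1, by norm_num, ?_⟩
      filter_upwards [hexp.tendsto_mul.eventually_lt_const (show b < b / 2 by linarith),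
        tendsto_natCast_real.eventually_gt_atTop (2 / -b), eventually_natCast_pos] with n h1 h2 h3
      rw [div_lt_iff₀ (by linarith)] at h2
      have h4 : (n : ℝ) * (-b / 2) ≤ n * -(n * (value R n - -1 / 4)) :=
        mul_le_mul_of_nonneg_left (by linarith) h3.le
      calc (1 : ℝ) ^ 2 ≤ n * (-b / 2) := by linarith
        _ ≤ _ := h4
        _ = _ := by ring
    -- The square of `s` is the midpoint between the threshold `1 / 16` and the limit `-c`.
    · refine ⟨√((1 / 16 + -c) / 2), ?_, ?_⟩
      · apply Real.lt_sqrt_of_sq_lt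
        norm_num
        linarith
      · rw [Real.sq_sqrt (by linarith)]
        filter_upwards [hexp.tendsto_scaled.eventually_lt_const
          (show c < -((1 / 16 + -c) / 2) by linarith)] with n hn
        rw [zero_div, sub_zero] at hn
        linarith
  have hs2 : 0 < s ^ 2 := by positivity
  have hlt : ∀ᶠ n : ℕ in atTop, value R n < -1 / 4 := by
    filter_upwards [hsn] with n hn
    by_contra! h
    have h1 : (n : ℝ) ^ 2 * -(value R n - -1 / 4) ≤ 0 :=
      mul_nonpos_of_nonneg_of_nonpos (by positivity) (by linarith)
    linarith
  have hne : R ≠ RatFunc.C (-1 / 4) := by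
    rintro rfl
    obtain ⟨n, hn⟩ := hlt.exists
    rw [value_C] at hn
    exact lt_irrefl _ hn
  have hRV := ratio_sub_const_regularlyVarying hne
  have hδ0 := hRV.nonpos_of_tendsto_zero (by simpa using hexp.tendsto.sub_const (-1 / 4))
  have hδ2 := hRV.ge_neg_two hs2 (hsn.mono fun n hn => by
    refine hn.trans (le_trans (le_of_eq ?_) (neg_le_abs _))
    ring)
  refine tailSigns_of_parabolic hexp.tendsto hlt hRV ?_ hs hsn
  generalize (R - RatFunc.C (-1 / 4)).intDegree = δ at hδ0 hδ2
  have h0 : (δ : ℝ) ≤ 0 := by exact_mod_cast hδ0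
  have h2 : (-2 : ℝ) ≤ δ := by exact_mod_cast hδ2
  exact abs_le.2 ⟨h2, h0.trans zero_le_two⟩

lemma ratOmegaElliptic_tailSigns {P Q : RatFunc ℝ} (h : IsRatOmegaElliptic P Q) :
    ∀ᶠ N in atTop, tailSigns (fun n : ℕ => value (ratio P Q) n) N =
      {(⊥ : WithBot (List SignType))} := by
  rcases h with ⟨θ, b, ⟨hs, -, a, c, hexp, hl, h0, h1, ha⟩, hθ⟩ | ⟨hs, hd⟩
  · rcases h0.eq_or_lt with rfl | h0
    · have ha' : a = -1 / 4 := by rw [ha]; norm_num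
      rw [ha'] at hexp hl
      exact nonHyperbolic_parabolic hexp hl
    · have hlt : a < -1 / 4 := ha ▸ neg_inv_cos_lt h0 h1
      have hrt : rootArg a = θ * Real.pi := ha ▸ rootArg_of_cos h0.le h1
      by_cases hirr : Irrational θ
      · exact tailSigns_of_irrational hlt hrt hexp.tendsto hirr
      · have hb : b ≠ 0 := by
          rintro rfl
          apply hθ
          obtain ⟨q, hq⟩ := not_not.1 hirr
          refine ⟨⟨q, ?_, hq.symm⟩, rfl⟩
          rw [← hq] at h0
          exact_mod_cast h0
        exact tailSigns_of_drift hlt hrt hexp.tendsto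
          (ratio_sub_const_regularlyVarying (ne_C_of_tendsto hb hexp.tendsto_mul)) hb
          hexp.tendsto_mul
  · have hneg := hs.eventually_sign.mono fun n hn => sign_eq_neg_one_iff.1 hn
    have hne : ratio P Q ≠ 0 := by
      intro h0
      rw [h0, RatFunc.intDegree_zero] at hd
      omega
    exact tailSigns_of_le_two hneg (regularlyVarying_value hne) (by omega) (by omega)

lemma oElliptic_tailSigns {P Q : RatFunc ℝ} {k r : ℕ} (hr : 0 < r)
    (hkr : Nat.Coprime k r) (h : IsOElliptic ((k : ℝ) / (r : ℝ)) P Q) :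
    ((∃ c : ℝ, ratio P Q = RatFunc.C c) →
      ∀ᶠ N in atTop, tailSigns (fun n : ℕ => value (ratio P Q) n) N =
        sWords k r ∪ tWords k r) ∧
    ((¬ ∃ c : ℝ, ratio P Q = RatFunc.C c) →
      ∀ᶠ N in atTop, tailSigns (fun n : ℕ => value (ratio P Q) n) N = sWords k r) := by
  have hr' : (0 : ℝ) < r := by exact_mod_cast hr
  rcases h with ⟨⟨q, hq, hθ⟩, hs, -, a, c, hexp, hl, h0, h1, ha⟩ | ⟨hθ, hs, hd⟩
  · have hθ0 : 0 < (k : ℝ) / r := by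
      rw [hθ]
      exact_mod_cast hq
    have hlt : a < -1 / 4 := ha ▸ neg_inv_cos_lt hθ0 h1
    have hrt : rootArg a = (k : ℝ) / r * Real.pi := ha ▸ rootArg_of_cos h0 h1
    have hr2 : 2 ≤ r := by
      have h2 : (k : ℝ) < 1 / 2 * r := (div_lt_iff₀ hr').1 h1
      have h3 : (0 : ℝ) < k := (div_pos_iff_of_pos_right hr').1 hθ0
      have h4 : 1 ≤ k := by exact_mod_cast h3
      have h5 : (1 : ℝ) ≤ k := by exact_mod_cast h4
      have h6 : (2 : ℝ) ≤ r := by linarith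
      exact_mod_cast h6
    constructor
    · rintro ⟨e, he⟩
      refine tailSigns_of_eventually_const hr2 hkr hlt hrt (Eventually.of_forall fun n => ?_)
      have h2 := hexp.tendsto
      rw [he] at h2 ⊢
      simp only [value_C] at h2 ⊢
      exact tendsto_nhds_unique tendsto_const_nhds h2
    · intro hne
      obtain ⟨K, hK⟩ := hexp.sq_bound
      exact tailSigns_of_summable hr hkr hlt hrt hexp.tendsto
        (ratio_sub_const_regularlyVarying fun h => hne ⟨a, h⟩) hK
  · have hkr' : k = 1 ∧ r = 2 := by
      rw [div_eq_div_iff hr'.ne' two_ne_zero, one_mul] at hθ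
      have h2 : k * 2 = r := by exact_mod_cast hθ
      have h3 : k ∣ r := ⟨2, h2.symm⟩
      have h4 := Nat.Coprime.eq_one_of_dvd hkr h3
      omega
    obtain ⟨rfl, rfl⟩ := hkr'
    have hneg := hs.eventually_sign.mono fun n hn => sign_eq_neg_one_iff.1 hn
    have hne : ratio P Q ≠ 0 := by
      intro h0
      rw [h0, RatFunc.intDegree_zero] at hd
      omega
    refine ⟨?_, fun _ => tailSigns_of_two_lt hneg (regularlyVarying_value hne) hd⟩
    -- A constant ratio has degree 0, so only the non-constant alternative can occur for degree
    -- above 2.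
    rintro ⟨e, he⟩
    rw [he, RatFunc.intDegree_C] at hd
    omega

end

end Holonomic

/-! ### The main theorem -/

theorem mainTheorem2 (P Q : RatFunc ℝ)
    (hP_poles : Holonomic.NoPolesInNat P) (hP_zeros : Holonomic.NoZerosInNat P)
    (hQ_poles : Holonomic.NoPolesInNat Q) (hQ_zeros : Holonomic.NoZerosInNat Q)
    (hP_sign : Holonomic.RatHasUltimateSign P 1) :
    (Holonomic.IsLoxodromic P Q →
      Holonomic.shortestSigns P Q =
        {(([1] : List SignType) : WithBot (List SignType)),
         (([-1] : List SignType) : WithBot (List SignType)),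
         (([1, -1] : List SignType) : WithBot (List SignType)),
         (([-1, 1] : List SignType) : WithBot (List SignType))}) ∧
    (Holonomic.IsHyperbolic P Q →
      Holonomic.shortestSigns P Q =
        {(([1] : List SignType) : WithBot (List SignType)),
         (([-1] : List SignType) : WithBot (List SignType))}) ∧
    (∀ k r : ℕ, 0 < k → 0 < r → Nat.Coprime k r →
      Holonomic.IsOElliptic ((k : ℝ) / (r : ℝ)) P Q →
        ((∃ c : ℝ, Holonomic.ratio P Q = RatFunc.C c) →
          Holonomic.shortestSigns P Q = Holonomic.sWords k r ∪ Holonomic.tWords k r) ∧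
        ((¬ ∃ c : ℝ, Holonomic.ratio P Q = RatFunc.C c) →
          Holonomic.shortestSigns P Q = Holonomic.sWords k r)) ∧
    (Holonomic.IsRatOmegaElliptic P Q →
      Holonomic.shortestSigns P Q = {(⊥ : WithBot (List SignType))}) := by
  have hred := Holonomic.eventually_shortestSigns_eq hP_zeros hQ_poles hQ_zeros hP_sign
  -- Both the reduction and each classification hold for all large `N`; one common `N` suffices.
  have hcomb : ∀ S : Set (WithBot (List SignType)), (∀ᶠ N in atTop,
      Holonomic.tailSigns (fun n : ℕ => Holonomic.value (Holonomic.ratio P Q) n) N = S) →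
      Holonomic.shortestSigns P Q = S := fun S hS => by
    obtain ⟨N, h1, h2⟩ := (hred.and hS).exists
    rw [h1, h2]
  refine ⟨fun h => hcomb _ ?_, fun h => hcomb _ (Holonomic.hyperbolic_tailSigns h),
    fun k r _ hr hkr h => ?_, fun h => hcomb _ (Holonomic.ratOmegaElliptic_tailSigns h)⟩
  · have hs : Holonomic.RatHasUltimateSign (Holonomic.ratio P Q) 1 := by
      rcases h with h | h <;> exact h.1
    obtain ⟨M, hM⟩ := eventually_atTop.1 hs.eventually_sign
    filter_upwards [eventually_ge_atTop M] with N hN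
    exact Holonomic.tailSigns_of_pos fun n hn => sign_eq_one_iff.1 (hM n (hN.trans hn))
  · obtain ⟨h1, h2⟩ := Holonomic.oElliptic_tailSigns hr hkr h
    exact ⟨fun hc => hcomb _ (h1 hc), fun hc => hcomb _ (h2 hc)⟩
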